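/- Conventions. $M$ is a nonempty closed (compact, without boundary, not necessarily connected) smooth 3-manifold; all objects are $C^\infty$. A contact structure $\xi$ on $M$ is a field of planes which near every point is the kernel of a local one-form $\alpha$ with $\alpha\wedge d\alpha\neq 0$ everywhere. It is overtwisted if there is a smoothly embedded closed disc $D\subset M$ such that the characteristic foliation $D_\xi$ (the singular foliation defined by $T_pD\cap\xi_p$, $p\in D$) has a limit cycle, i.e. a closed leaf which is the limit set of an end of another leaf; otherwise it is tight. A gradient field is a vector field $X=-\nabla\Psi$ for some smooth function $\Psi$ and some Riemannian metric on $M$. A vector field $X$ contained in $\xi$ is nondegenerate if its set of fixed points (zeros) is a link, i.e. a finite disjoint union of smoothly embedded circles, at all but finitely many points of which both transverse eigenvalues of the linearization of $X$ (those induced on the quotient of $T_pM$ by the tangent line of the link) have nonzero real part, and if at each of the remaining points the degeneracy is of codimension one: along the link either the transverse eigenvalues are real and one of them passes transversally through $0$ while the other is nonzero (saddle-node), or they are a complex conjugate pair $a\pm ib$, $b\ne0$, passing transversally through the imaginary axis (Hopf). A sink circle of $X$ is a smoothly embedded circle of fixed points at each of which both transverse eigenvalues have negative real part. Proposition. Let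 $X$ be a nondegenerate gradient field which lies within a tight contact structure $\xi$ on $M$. Then $X$ also lies within an overtwisted contact structure $\xi'$ on $M$. More precisely, $X$ has a sink circle $\gamma$ such that for every open neighbourhood $U$ of $\gamma$ there is an overtwisted contact structure $\xi'$ on $M$ with $X_p\in\xi'_p$ for all $p\in M$ and $\xi'_p=\xi_p$ for all $p\notin U$. -/

import Mathlib

open scoped Manifold ContDiff Topology Bundle

noncomputable section

namespace PlaneFieldFlow

/-- The model space of three-manifolds. -/
abbrev E3 : Type := EuclideanSpace ℝ (Fin 3)

/-- The Euclidean plane. -/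
abbrev E2 : Type := EuclideanSpace ℝ (Fin 2)

/-! ### Contact forms on open subsets of three-space -/

/-- The exterior derivative of a one-form on (an open subset of) three-space:
`dα(v, w) = (D_v α)(w) - (D_w α)(v)`. -/
def dForm (α : E3 → (E3 →L[ℝ] ℝ)) (y v w : E3) : ℝ :=
  fderiv ℝ α y v w - fderiv ℝ α y w v

/-- The three-form `α ∧ dα`, evaluated on three vectors. -/
def wedgeD (α : E3 → (E3 →L[ℝ] ℝ)) (y u v w : E3) : ℝ :=
  α y u * dForm α y v w + α y v * dForm α y w u + α y w * dForm α y u v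

/-- `α` is a smooth contact form on the open set `U`: `α ∧ dα` vanishes nowhere on `U`. -/
def IsContactFormOn (α : E3 → (E3 →L[ℝ] ℝ)) (U : Set E3) : Prop :=
  ContDiffOn ℝ ∞ α U ∧ ∀ y ∈ U, ∃ u v w : E3, wedgeD α y u v w ≠ 0

variable {M : Type*} [TopologicalSpace M] [ChartedSpace E3 M]

/-! ### Contact structures -/

/-- A field of linear subspaces `ξ p ⊆ T_p M` is a contact structure if around every point it is
the kernel of a locally defined smooth contact form, written in some chart of the smooth structure.
(The non-vanishing of `α ∧ dα` forces `α` to vanish nowhere, so that `ξ` is a smooth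
field of planes. It need not be co-orientable.) -/
def IsContactStructure (ξ : ∀ p : M, Submodule ℝ (TangentSpace (𝓡 3) p)) : Prop :=
  ∀ p : M, ∃ e ∈ IsManifold.maximalAtlas (𝓡 3) ∞ M, p ∈ e.source ∧
    ∃ α : E3 → (E3 →L[ℝ] ℝ), IsContactFormOn α e.target ∧
      ∀ q ∈ e.source, ∀ v : TangentSpace (𝓡 3) q,
        v ∈ ξ q ↔ α (e q) (mfderiv (𝓡 3) 𝓘(ℝ, E3) e q v) = 0

/-- The characteristic foliation of the embedded surface parametrised by `f`, pulled back to the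
parameter plane: the tangent vectors `v` at `x` with `df_x v ∈ ξ (f x)`. It is a line where the
surface is transverse to `ξ`, and the whole plane at the singular points. -/
def charFoliation (ξ : ∀ p : M, Submodule ℝ (TangentSpace (𝓡 3) p)) (f : E2 → M) (x : E2) :
    Submodule ℝ (TangentSpace (𝓡 2) x) :=
  (ξ (f x)).comap (mfderiv (𝓡 2) (𝓡 3) f x).toLinearMap

/-- `c` is a regularly parametrised (arc of a) leaf of the characteristic foliation of the disc
`f (closed unit disc)`; it consists of nonsingular points. -/
def IsLeafArc (ξ : ∀ p : M, Submodule ℝ (TangentSpace (𝓡 3) p)) (f : E2 → M) (c : ℝ → E2) :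
    Prop :=
  ContDiff ℝ 1 c ∧ ∀ t : ℝ,
    c t ∈ Metric.closedBall (0 : E2) 1 ∧ charFoliation ξ f (c t) ≠ ⊤ ∧
    deriv c t ≠ 0 ∧ (deriv c t : TangentSpace (𝓡 2) (c t)) ∈ charFoliation ξ f (c t)

/-- The characteristic foliation of the disc `f (closed unit disc)` has a limit cycle: a closed
leaf `c` which is the limit set of (an end of) another leaf `b`. -/
def HasLimitCycle (ξ : ∀ p : M, Submodule ℝ (TangentSpace (𝓡 3) p)) (f : E2 → M) : Prop :=
  ∃ c b : ℝ → E2, IsLeafArc ξ f c ∧ (∃ T : ℝ, 0 < T ∧ Function.Periodic c T) ∧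
    IsLeafArc ξ f b ∧ Disjoint (Set.range b) (Set.range c) ∧
    {x : E2 | MapClusterPt x Filter.atTop b} = Set.range c

/-- A contact structure is overtwisted if there is an embedded disc whose characteristic foliation
has a limit cycle. The disc is the image of the closed unit disc under a smooth embedding of the
plane. -/
def IsOvertwisted (ξ : ∀ p : M, Submodule ℝ (TangentSpace (𝓡 3) p)) : Prop :=
  IsContactStructure ξ ∧
    ∃ f : E2 → M, Manifold.IsSmoothEmbedding (𝓡 2) (𝓡 3) ∞ f ∧ HasLimitCycle ξ f

/-- A contact structure is tight if it is not overtwisted. -/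
def IsTight (ξ : ∀ p : M, Submodule ℝ (TangentSpace (𝓡 3) p)) : Prop :=
  IsContactStructure ξ ∧ ¬ IsOvertwisted ξ

variable [IsManifold (𝓡 3) ∞ M]

/-! ### Gradient fields -/

/-- `X` is a smooth gradient field: `X = -∇Ψ` for a smooth function `Ψ`, the gradient being taken
with respect to some smooth Riemannian metric. -/
def IsGradientField (X : ∀ p : M, TangentSpace (𝓡 3) p) : Prop :=
  ∃ (g : Bundle.ContMDiffRiemannianMetric (𝓡 3) ∞ E3 (TangentSpace (𝓡 3) : M → Type))
    (Ψ : M → ℝ), ContMDiff (𝓡 3) 𝓘(ℝ, ℝ) ∞ Ψ ∧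
      ∀ (p : M) (v : TangentSpace (𝓡 3) p),
        g.inner p (X p) v = -(mfderiv (𝓡 3) 𝓘(ℝ, ℝ) Ψ p v : ℝ)

/-! ### Nondegenerate sections of a plane field -/

/-- The fixed point set of (the flow of) a vector field. -/
def fixedPoints (X : ∀ p : M, TangentSpace (𝓡 3) p) : Set M := {p | X p = 0}

/-- The derivative at `p` of the vector field `X`, computed in the tangent bundle trivialisation
given by the preferred chart at `p`. At a zero of `X` it is the linearisation of `X`, an
endomorphism of `T_p M` which does not depend on the chart. -/
def linearization (X : ∀ p : M, TangentSpace (𝓡 3) p) (p : M) : E3 →L[ℝ] E3 :=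
  mfderiv (𝓡 3) 𝓘(ℝ, E3)
    (fun q : M => (trivializationAt E3 (TangentSpace (𝓡 3) : M → Type) p
      (Bundle.TotalSpace.mk' E3 q (X q))).2) p

/-- `a` and `b` are the transverse eigenvalues at a point `p` of a curve of fixed points of `X`:
the eigenvalues of the linearisation at `p`, counted with algebraic multiplicity, are `a`, `b` and
the eigenvalue `0` of the direction of the curve. (Thus `a`, `b` are the eigenvalues of the
endomorphism induced on the quotient of `T_p M` by the tangent line of the curve.) -/
def HasTransverseEigenvalues (X : ∀ p : M, TangentSpace (𝓡 3) p) (p : M) (a b : ℂ) : Prop :=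
  (linearization X p).toLinearMap.charpoly.map (algebraMap ℝ ℂ) =
    Polynomial.X * (Polynomial.X - Polynomial.C a) * (Polynomial.X - Polynomial.C b)

/-- Transverse hyperbolicity: no transverse eigenvalue lies on the imaginary axis. -/
def IsTransversallyHyperbolic (X : ∀ p : M, TangentSpace (𝓡 3) p) (p : M) : Prop :=
  ∃ a b : ℂ, HasTransverseEigenvalues X p a b ∧ a.re ≠ 0 ∧ b.re ≠ 0

/-- A sink (fixed point of index zero): both transverse eigenvalues have negative real part. -/
def IsTransverseSink (X : ∀ p : M, TangentSpace (𝓡 3) p) (p : M) : Prop :=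
  ∃ a b : ℂ, HasTransverseEigenvalues X p a b ∧ a.re < 0 ∧ b.re < 0

/-- A saddle-node bifurcation at the parameter `t` of a curve `c` of fixed points: both transverse
eigenvalues are real, one passes transversally through zero and the other one is nonzero. -/
def IsSaddleNodeAt (X : ∀ p : M, TangentSpace (𝓡 3) p) (c : ℝ → M) (t : ℝ) : Prop :=
  ∃ a b : ℝ → ℝ, (∀ᶠ s in 𝓝 t, HasTransverseEigenvalues X (c s) (a s) (b s)) ∧
    a t = 0 ∧ b t ≠ 0 ∧ ∃ a' : ℝ, a' ≠ 0 ∧ HasDerivAt a a' t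

/-- A Hopf bifurcation at the parameter `t` of a curve `c` of fixed points: the transverse
eigenvalues form a complex conjugate pair `a ± i b`, `b ≠ 0`, which passes transversally through
the imaginary axis. -/
def IsHopfAt (X : ∀ p : M, TangentSpace (𝓡 3) p) (c : ℝ → M) (t : ℝ) : Prop :=
  ∃ a b : ℝ → ℝ, (∀ᶠ s in 𝓝 t, HasTransverseEigenvalues X (c s)
      ((a s : ℂ) + (b s : ℂ) * Complex.I) ((a s : ℂ) - (b s : ℂ) * Complex.I)) ∧
    a t = 0 ∧ b t ≠ 0 ∧ ∃ a' : ℝ, a' ≠ 0 ∧ HasDerivAt a a' t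

/-- `X` is a nondegenerate section of `ξ`: a smooth vector field contained in `ξ` whose
fixed point set is a link, i.e. a finite disjoint union of smoothly embedded circles, which is
transversally hyperbolic at all but finitely many points, the degeneracies at the latter being of
codimension one, i.e. saddle-node or Hopf bifurcations along the circle through the point. -/
def IsNondegenerateSection (ξ : ∀ p : M, Submodule ℝ (TangentSpace (𝓡 3) p))
    (X : ∀ p : M, TangentSpace (𝓡 3) p) : Prop :=
  ContMDiff (𝓡 3) (𝓡 3).tangent ∞ (fun p : M => (⟨p, X p⟩ : TangentBundle (𝓡 3) M)) ∧
  (∀ p : M, X p ∈ ξ p) ∧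
  ∃ (n : ℕ) (γ : Fin n → Circle → M),
    (∀ i, Manifold.IsSmoothEmbedding (𝓡 1) (𝓡 3) ∞ (γ i)) ∧
    (∀ i j, i ≠ j → Disjoint (Set.range (γ i)) (Set.range (γ j))) ∧
    (⋃ i, Set.range (γ i)) = fixedPoints X ∧
    {p ∈ fixedPoints X | ¬ IsTransversallyHyperbolic X p}.Finite ∧
    ∀ (i : Fin n) (t : ℝ), ¬ IsTransversallyHyperbolic X (γ i (Circle.exp t)) →
      IsSaddleNodeAt X (fun s : ℝ => γ i (Circle.exp s)) t ∨
      IsHopfAt X (fun s : ℝ => γ i (Circle.exp s)) t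

end PlaneFieldFlow

end

open PlaneFieldFlow

/-! Let `α` be a local contact form of `ξ` of unit length for the metric, and put `β = ι_X dα`. Both
forms kill `X`, and they are independent wherever `X ≠ 0`. Hence for every function `Θ` the kernel
of `cos Θ α + sin Θ β` contains `X`. Changing the sign of `α` changes the sign of `β`, so this
kernel is globally defined even when `ξ` is not co-orientable (`IsUnitForm.exists_sign`,
`exists_rotated`). The new structure has this form. Near a circle of minima of the potential `Ψ`,
the angle `Θ` is a function of `Ψ` equal to `π` for `Ψ ≤ c`, decreasing to `0` on `[c, c + η]`, and
zero afterwards. So `ξ` changes only in a thin shell around the circle, away from the zeros of `X`.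

The circle comes from a global minimum of `Ψ` (`exists_sink_circle`). `Ψ` is constant on the circle
of zeros through it, so all its points are minima. The linearisation of `X` is self-adjoint for the
metric there, with eigenvalues at most `0`. An eigenvalue that is never positive cannot cross `0`
transversally and a real one cannot belong to a Hopf pair, so the circle is hyperbolic and
attracting.

Contactness (`exists_contact_rotated`) follows by contracting the contact three-form with `X`
(`wedgeD_rotForm`). Up to sign, the result is `(XΘ + cos² Θ) α ∧ β` plus errors with coefficients
`cos Θ sin Θ` and `sin² Θ`. Both `Ψ` along `X` and `Θ` as a function of `Ψ` decrease, so `XΘ ≥ 0`.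
For small `η` it dominates where `sin Θ` is not small; elsewhere `cos² Θ` does
(`exists_rotation_speed`).

The overtwisted disc (`exists_disc_with_limit_cycle`) is a quadratic graph tangent to `ξ` at a point
`p` of the circle. Let `u` be the restriction of `Ψ`. In coordinates diagonalising the Hessian
(`exists_normal_frame`), to first order `du = a x dx + b y dy`, `α = C du + (κ/2)(x dy - y dx)` and
`β = -κ(a x dy - b y dx)`, where the quadratic term of the graph makes `C` as large as desired.
Traversed counterclockwise, leaves of `α` descend the levels of `u`, while leaves of `β` climb them
when weighted strongly enough (`exists_planar_estimates`). On an outer level `Θ = 0` and on an inner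
one `Θ` is a suitable angle in `(0, π/2)`, so leaves enter the annulus between them through both
boundaries. All forms in between are positive on the radial vector, so leaves are graphs of
solutions of a scalar equation periodic in the polar angle. A Poincaré return argument yields the
limit cycle (`exists_limit_cycle`, `exists_periodic_limit`). -/

noncomputable section

namespace PlaneFieldFlow

open Set Filter

section
/-! ### Scalar differential equations with periodic coefficients -/

/-- The uniform bound `L` lets Picard–Lindelöf run on every interval `[-(n + 1), n + 1]` with radius
`L * (n + 1)`, and uniqueness makes these solutions compatible. -/
theorem exists_global_solution {v : ℝ → ℝ → ℝ} {K L : NNReal} (hK : ∀ t, LipschitzWith K (v t))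
    (hL : ∀ t x, |v t x| ≤ L) (hc : ∀ x, Continuous fun t => v t x) (x₀ : ℝ) :
    ∃ f : ℝ → ℝ, f 0 = x₀ ∧ ∀ t, HasDerivAt f (v t (f t)) t := by
  have loc : ∀ n : ℕ, ∃ f : ℝ → ℝ, f 0 = x₀ ∧
      ∀ t ∈ Icc (-(n + 1) : ℝ) (n + 1), HasDerivWithinAt f (v t (f t)) (Icc (-(n + 1) : ℝ) (n + 1)) t := by
    intro n
    have h0 : (0 : ℝ) ∈ Icc (-(n + 1) : ℝ) (n + 1) := by constructor <;> linarith [n.cast_nonneg (α := ℝ)]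
    have hP : IsPicardLindelof v (⟨0, h0⟩ : Icc (-(n + 1) : ℝ) (n + 1)) x₀ (L * (n + 1)) 0 L K := by
      refine ⟨fun t _ => (hK t).lipschitzOnWith, fun x _ => (hc x).continuousOn,
        fun t _ x _ => by simpa using hL t x, ?_⟩
      simp
    exact hP.exists_eq_forall_mem_Icc_hasDerivWithinAt₀
  choose f hf0 hf using loc
  have hf' : ∀ n : ℕ, ∀ t ∈ Ioo (-(n + 1) : ℝ) (n + 1), HasDerivAt (f n) (v t (f n t)) t :=
    fun n t ht => (hf n t (Ioo_subset_Icc_self ht)).hasDerivAt (Icc_mem_nhds ht.1 ht.2)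
  have agree : ∀ m n : ℕ, m ≤ n → EqOn (f m) (f n) (Icc (-(m + 1) : ℝ) (m + 1)) := by
    intro m n hmn
    have hmn' : (m : ℝ) ≤ n := by exact_mod_cast hmn
    have hm : (0 : ℝ) ≤ m := m.cast_nonneg
    refine ODE_solution_unique_of_mem_Icc (v := v) (s := fun _ => univ) (K := K) (t₀ := 0)
      (fun t _ => (hK t).lipschitzOnWith) ⟨by linarith, by linarith⟩
      (fun t ht => (hf m t ht).continuousWithinAt) (hf' m) (fun _ _ => mem_univ _)
      ?_ ?_ (fun _ _ => mem_univ _) (by rw [hf0, hf0])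
    · exact fun t ht => ((hf n t ⟨by linarith [ht.1], by linarith [ht.2]⟩).continuousWithinAt).mono
        (Icc_subset_Icc (by linarith) (by linarith))
    · exact fun t ht => hf' n t ⟨by linarith [ht.1], by linarith [ht.2]⟩
  -- The index varies with the point, but near `t` all values agree with the single solution of
  -- index `⌈|t|⌉₊ + 1`, so the patched function is differentiable.
  refine ⟨fun t => f ⌈|t|⌉₊ t, by simp [hf0], fun t => ?_⟩
  set n := ⌈|t|⌉₊ + 1 with hn
  have htn : |t| < n := by rw [hn]; push_cast; linarith [Nat.le_ceil |t|]
  have key : ∀ s : ℝ, |s| < n → f ⌈|s|⌉₊ s = f n s := by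
    intro s hs
    refine agree _ _ (Nat.ceil_le.2 hs.le) ?_
    have := abs_le.1 (Nat.le_ceil |s|)
    exact ⟨by linarith, by linarith⟩
  have hev : (fun s => f ⌈|s|⌉₊ s) =ᶠ[𝓝 t] f n := by
    filter_upwards [(isOpen_lt continuous_abs continuous_const).mem_nhds htn] with s hs using key s hs
  have hd := hf' n t (by have := abs_lt.1 htn; constructor <;> linarith)
  rw [← key t htn] at hd
  exact hd.congr_of_eventuallyEq hev

/-- A solution of a scalar `T`-periodic equation which has decreased after one period and is
bounded below spirals down to a periodic solution. -/
theorem exists_periodic_limit {v : ℝ → ℝ → ℝ} {K L : NNReal} (hK : ∀ t, LipschitzWith K (v t))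
    (hL : ∀ t x, |v t x| ≤ L) (hc : ∀ x, Continuous fun t => v t x) {T : ℝ} (hT : 0 < T)
    (hper : ∀ t x, v (t + T) x = v t x) {r : ℝ → ℝ} (hr : ∀ t, HasDerivAt r (v t (r t)) t)
    (hdec : r T < r 0) {m : ℝ} (hm : ∀ t, 0 ≤ t → m ≤ r t) :
    ∃ c : ℝ → ℝ, (∀ t, HasDerivAt c (v t (c t)) t) ∧ Function.Periodic c T ∧ (∀ t, c t < r t) ∧
      Tendsto (fun t => r t - c t) atTop (𝓝 0) := by
  have uniq : ∀ f g : ℝ → ℝ, (∀ t, HasDerivAt f (v t (f t)) t) → (∀ t, HasDerivAt g (v t (g t)) t) →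
      ∀ t₀, f t₀ = g t₀ → f = g := fun f g hf hg t₀ h =>
    ODE_solution_unique_univ (v := v) (s := fun _ => univ) (K := K)
      (fun t => (hK t).lipschitzOnWith) (fun t => ⟨hf t, mem_univ _⟩) (fun t => ⟨hg t, mem_univ _⟩) h
  -- Graphs of two solutions cannot cross: uniqueness would identify them from a common value.
  have order : ∀ f g : ℝ → ℝ, (∀ t, HasDerivAt f (v t (f t)) t) → (∀ t, HasDerivAt g (v t (g t)) t) →
      ∀ t₀, f t₀ < g t₀ → ∀ t, f t < g t := by
    intro f g hf hg t₀ h t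
    by_contra hcon
    have hcf : Continuous fun t => g t - f t :=
      continuous_iff_continuousAt.2 fun t => ((hg t).sub (hf t)).continuousAt
    obtain ⟨s, hs⟩ := mem_range_of_exists_le_of_exists_ge hcf (c := 0) ⟨t, by linarith⟩ ⟨t₀, by linarith⟩
    have := uniq f g hf hg s (by linarith)
    rw [this] at h
    exact lt_irrefl _ h
  have perN : ∀ (n : ℕ) t x, v (t + n * T) x = v t x := by
    intro n
    induction n with
    | zero => simp
    | succ n ih =>
      intro t x
      rw [show t + ((n + 1 : ℕ) : ℝ) * T = (t + n * T) + T by push_cast; ring, hper, ih]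
  have shift : ∀ (f : ℝ → ℝ), (∀ t, HasDerivAt f (v t (f t)) t) → ∀ n : ℕ,
      ∀ t, HasDerivAt (fun t => f (t + n * T)) (v t (f (t + n * T))) t := by
    intro f hf n t
    have := (hf (t + n * T)).comp_add_const t (n * T)
    rwa [perN] at this
  have step : ∀ t, r (t + T) < r t := by
    have := shift r hr 1
    simp only [Nat.cast_one, one_mul] at this
    exact order _ _ this hr 0 (by simpa using hdec)
  -- These are iterates of the first-return map. They decrease to a limit `l`, whose solution turns
  -- out to be `T`-periodic.
  set s : ℕ → ℝ := fun n => r (n * T) with hs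
  have hanti : Antitone s := antitone_nat_of_succ_le fun n => by
    have := (step (n * T)).le
    simp only [hs]
    rwa [show ((n + 1 : ℕ) : ℝ) * T = n * T + T by push_cast; ring]
  have hbdd : BddBelow (range s) := ⟨m, by
    rintro _ ⟨n, rfl⟩
    exact hm _ (by positivity)⟩
  set l := ⨅ n, s n
  have hlim : Tendsto s atTop (𝓝 l) := tendsto_atTop_ciInf hanti hbdd
  obtain ⟨c, hc0, hcd⟩ := exists_global_solution hK hL hc l
  -- Grönwall is used over one period only, so the factor `exp (K * T)` does not depend on `n`.
  have est : ∀ n : ℕ, ∀ t ∈ Icc (0 : ℝ) T, dist (r (t + n * T)) (c t) ≤ dist (s n) l * Real.exp (K * T) := by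
    intro n t ht
    have hrn := shift r hr n
    have := dist_le_of_trajectories_ODE (v := v) (K := K) (f := fun t => r (t + n * T)) (g := c)
      (a := 0) (b := T) (δ := dist (s n) l) hK
      (fun t _ => (hrn t).continuousAt.continuousWithinAt) (fun t _ => (hrn t).hasDerivWithinAt)
      (fun t _ => (hcd t).continuousAt.continuousWithinAt) (fun t _ => (hcd t).hasDerivWithinAt)
      (by simp [hs, hc0]) t ht
    refine this.trans ?_
    gcongr
    linarith [ht.2]
  have hdist : Tendsto (fun n => dist (s n) l * Real.exp (K * T)) atTop (𝓝 0) := by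
    have := (tendsto_iff_dist_tendsto_zero.1 hlim).mul_const (Real.exp (K * T))
    simpa using this
  have hcT : c T = l := by
    have h1 : Tendsto (fun n : ℕ => r (T + n * T)) atTop (𝓝 (c T)) :=
      tendsto_iff_dist_tendsto_zero.2 (squeeze_zero (fun _ => dist_nonneg)
        (fun n => est n T ⟨hT.le, le_rfl⟩) hdist)
    have h2 : Tendsto (fun n : ℕ => r (T + n * T)) atTop (𝓝 l) := by
      refine (hlim.comp (tendsto_add_atTop_nat 1)).congr fun n => ?_
      simp only [hs, Function.comp]
      congr 1; push_cast; ring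
    exact tendsto_nhds_unique h1 h2
  have hcper : Function.Periodic c T := by
    have := uniq _ _ (shift c hcd 1) hcd 0 (by simp [hc0, hcT])
    intro t
    simpa using congrFun this t
  have hlt : l < r 0 := (ciInf_le hbdd 1).trans_lt (by simpa [hs] using hdec)
  refine ⟨c, hcd, hcper, order c r hcd hr 0 (by rw [hc0]; exact hlt), ?_⟩
  rw [Metric.tendsto_atTop]
  intro ε hε
  obtain ⟨N, hN⟩ := (Metric.tendsto_atTop.1 hdist) ε hε
  refine ⟨N * T, fun t ht => ?_⟩
  have hfl : (N : ℤ) ≤ ⌊t / T⌋ := Int.le_floor.2 (by push_cast; exact (le_div_iff₀ hT).2 ht)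
  obtain ⟨n, hn⟩ := Int.eq_ofNat_of_zero_le ((Int.natCast_nonneg N).trans hfl)
  have hn1 : (n : ℝ) ≤ t / T := by
    have := Int.floor_le (t / T); rw [hn] at this; exact_mod_cast this
  have hn2 : t / T < n + 1 := by
    have := Int.lt_floor_add_one (t / T); rw [hn] at this; exact_mod_cast this
  rw [le_div_iff₀ hT] at hn1
  rw [div_lt_iff₀ hT] at hn2
  have hNn : N ≤ n := by rw [hn] at hfl; exact_mod_cast hfl
  have h1 := est n (t - n * T) ⟨by linarith, by linarith⟩
  have h2 := hN n hNn
  rw [sub_add_cancel] at h1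
  have h3 : c (t - n * T) = c t := hcper.sub_nat_mul_eq n
  rw [h3] at h1
  rw [Real.dist_eq, sub_zero] at h2 ⊢
  rw [Real.dist_eq] at h1
  exact h1.trans_lt ((le_abs_self _).trans_lt h2)

end

section
/-! ### Limit cycles of planar line fields -/

/-- Rotation of the plane by a right angle. -/
def rot : E2 →L[ℝ] E2 := LinearMap.toContinuousLinearMap
  { toFun := fun v => !₂[-v 1, v 0]
    map_add' := fun v w => by ext i; fin_cases i <;> simp [add_comm]
    map_smul' := fun c v => by ext i; fin_cases i <;> simp }

@[simp] theorem rot_apply_zero (v : E2) : rot v 0 = -v 1 := rfl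
@[simp] theorem rot_apply_one (v : E2) : rot v 1 = v 0 := rfl

theorem norm_E2_sq (v : E2) : ‖v‖ ^ 2 = v 0 ^ 2 + v 1 ^ 2 := by
  simp [EuclideanSpace.norm_sq_eq]

theorem norm_rot (v : E2) : ‖rot v‖ = ‖v‖ := by
  have : ‖rot v‖ ^ 2 = ‖v‖ ^ 2 := by rw [norm_E2_sq, norm_E2_sq]; simp; ring
  exact (pow_left_inj₀ (norm_nonneg _) (norm_nonneg _) two_ne_zero).1 this

/-- The point with angle `θ` on the unit circle. -/
def unitVec (θ : ℝ) : E2 := !₂[Real.cos θ, Real.sin θ]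

@[simp] theorem unitVec_zero_apply (θ : ℝ) : unitVec θ 0 = Real.cos θ := rfl
@[simp] theorem unitVec_one_apply (θ : ℝ) : unitVec θ 1 = Real.sin θ := rfl

@[simp] theorem norm_unitVec (θ : ℝ) : ‖unitVec θ‖ = 1 := by
  have : ‖unitVec θ‖ ^ 2 = 1 ^ 2 := by rw [norm_E2_sq]; simp
  exact (pow_left_inj₀ (norm_nonneg _) zero_le_one two_ne_zero).1 this

theorem unitVec_periodic : Function.Periodic unitVec (2 * Real.pi) := fun θ => by
  simp [unitVec]

theorem hasDerivAt_unitVec (θ : ℝ) : HasDerivAt unitVec (rot (unitVec θ)) θ := by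
  have h : ∀ θ, unitVec θ = Real.cos θ • !₂[1, 0] + Real.sin θ • !₂[0, 1] := fun θ => by
    ext i; fin_cases i <;> simp
  have h1 := ((Real.hasDerivAt_cos θ).smul_const (!₂[1, 0] : E2)).add
    ((Real.hasDerivAt_sin θ).smul_const (!₂[0, 1] : E2))
  have h2 : rot (unitVec θ) = -Real.sin θ • (!₂[1, 0] : E2) + Real.cos θ • (!₂[0, 1] : E2) := by
    ext i; fin_cases i <;> simp
  rw [h2]
  exact h1.congr_of_eventuallyEq (Eventually.of_forall h)

theorem continuous_unitVec : Continuous unitVec :=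
  continuous_iff_continuousAt.2 fun θ => (hasDerivAt_unitVec θ).continuousAt

theorem unitVec_eq_iff {θ s : ℝ} (h : unitVec θ = unitVec s) : ∃ k : ℤ, θ = s + k * (2 * Real.pi) := by
  have h0 := congrArg (fun v : E2 => v 0) h
  have h1 := congrArg (fun v : E2 => v 1) h
  have := Real.Angle.cos_sin_inj (by simpa using h0) (by simpa using h1)
  obtain ⟨k, hk⟩ := Real.Angle.angle_eq_iff_two_pi_dvd_sub.1 this
  exact ⟨k, by linarith⟩

theorem LipschitzOnWith.abs_div_le {x y x' y' B a δ K : ℝ} (ha : 0 < a) (hy : a ≤ y) (hy' : a ≤ y')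
    (hx : |x'| ≤ B) (h1 : |x - x'| ≤ K * δ) (h2 : |y - y'| ≤ K * δ) (hδ : 0 ≤ K * δ) :
    |x / y - x' / y'| ≤ (K / a + B * K / a ^ 2) * δ := by
  have hy0 : 0 < y := ha.trans_le hy
  have hy0' : 0 < y' := ha.trans_le hy'
  have hB : 0 ≤ B := (abs_nonneg _).trans hx
  have e : x / y - x' / y' = (x - x') / y - x' * (y - y') / (y * y') := by
    field_simp; ring
  rw [e]
  refine (abs_sub _ _).trans ?_
  have t1 : |(x - x') / y| ≤ K * δ / a := by
    rw [abs_div, abs_of_pos hy0]; gcongr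
  have t2 : |x' * (y - y') / (y * y')| ≤ B * (K * δ) / (a * a) := by
    rw [abs_div, abs_mul, abs_of_pos (mul_pos hy0 hy0')]; gcongr
  calc _ ≤ K * δ / a + B * (K * δ) / (a * a) := add_le_add t1 t2
    _ = _ := by field_simp

/-- A Lipschitz function on a closed disc, in polar coordinates with clamped radius. -/
theorem exists_polar_equation {h : E2 → ℝ} {ra rb : ℝ} (hra : 0 < ra) (hab : ra < rb) {K : NNReal}
    (hh : LipschitzOnWith K h (Metric.closedBall 0 rb)) :
    ∃ (v : ℝ → ℝ → ℝ) (K L : NNReal), (∀ t, LipschitzWith K (v t)) ∧ (∀ t x, |v t x| ≤ L) ∧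
      (Continuous fun p : ℝ × ℝ => v p.1 p.2) ∧ (∀ t x, v (t + 2 * Real.pi) x = v t x) ∧
      ∀ t x, ra ≤ x → x ≤ rb → v t x = -x * h (x • unitVec t) := by
  -- Clamping makes the equation globally bounded and Lipschitz without altering it for radii in
  -- `[ra, rb]`.
  set cl : ℝ → ℝ := fun x => max ra (min x rb) with hcl
  have hcl1 : ∀ x, ra ≤ cl x := fun x => le_max_left _ _
  have hcl2 : ∀ x, cl x ≤ rb := fun x => max_le hab.le (min_le_right _ _)
  have hclL : ∀ x y, |cl x - cl y| ≤ |x - y| := by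
    intro x y
    have h1 := abs_max_sub_max_le_abs (min x rb) (min y rb) ra
    have h2 := abs_min_sub_min_le_max x rb y rb
    simp only [hcl, max_comm ra]
    refine h1.trans (h2.trans ?_)
    simp
  have hclc : Continuous cl := by fun_prop
  have mem : ∀ t x, cl x • unitVec t ∈ Metric.closedBall (0 : E2) rb := by
    intro t x
    rw [mem_closedBall_zero_iff, norm_smul, norm_unitVec, mul_one, Real.norm_eq_abs,
      abs_of_pos (hra.trans_le (hcl1 x))]
    exact hcl2 x
  obtain ⟨B, hB⟩ := (isCompact_closedBall (0 : E2) rb).exists_bound_of_continuousOn hh.continuousOn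
  have hrb : 0 < rb := hra.trans hab
  have hB0 : 0 ≤ B := (norm_nonneg _).trans (hB _ (mem 0 0))
  refine ⟨fun t x => -cl x * h (cl x • unitVec t), ⟨B + rb * K, by positivity⟩, ⟨rb * B, by positivity⟩,
    ?_, ?_, ?_, ?_, ?_⟩
  · intro t
    refine LipschitzWith.of_dist_le_mul fun x y => ?_
    have h1 : |h (cl x • unitVec t) - h (cl y • unitVec t)| ≤ K * |cl x - cl y| := by
      have := hh.dist_le_mul _ (mem t x) _ (mem t y)
      rwa [dist_eq_norm, dist_eq_norm, ← sub_smul, norm_smul, norm_unitVec, mul_one] at this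
    have h2 : |h (cl y • unitVec t)| ≤ B := hB _ (mem t y)
    have h2' : |h (cl x • unitVec t)| ≤ B := hB _ (mem t x)
    have h3 := hclL x y
    rw [Real.dist_eq, Real.dist_eq]
    have e : -cl x * h (cl x • unitVec t) - -cl y * h (cl y • unitVec t) =
        -((cl x - cl y) * h (cl x • unitVec t)
        + cl y * (h (cl x • unitVec t) - h (cl y • unitVec t))) := by ring
    rw [e, abs_neg]
    refine (abs_add_le _ _).trans ?_
    rw [abs_mul, abs_mul, abs_of_pos (hra.trans_le (hcl1 y))]
    change _ ≤ (B + rb * K) * |x - y|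
    calc _ ≤ |x - y| * B + rb * (K * |x - y|) := by
          gcongr
          · exact hcl2 y
          · exact h1.trans (by gcongr)
      _ = _ := by ring
  · intro t x
    rw [abs_mul, abs_neg, abs_of_pos (hra.trans_le (hcl1 x))]
    exact mul_le_mul (hcl2 x) (hB _ (mem t x)) (abs_nonneg _) hrb.le
  · have hw : Continuous fun p : ℝ × ℝ => cl p.2 • unitVec p.1 :=
      (hclc.comp continuous_snd).smul (continuous_unitVec.comp continuous_fst)
    exact ((hclc.comp continuous_snd).neg).mul
      (hh.continuousOn.comp_continuous hw fun p => mem p.1 p.2)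
  · intro t x
    simp only [unitVec_periodic t]
  · intro t x h1 h2
    have : cl x = x := by simp [hcl, h1, h2]
    simp only [this]

theorem eventually_lt_of_hasDerivAt_neg {g : ℝ → ℝ} {g' x : ℝ} (hg : HasDerivAt g g' x) (h : g' < 0) :
    (∀ᶠ t in 𝓝[>] x, g t < g x) ∧ ∀ᶠ t in 𝓝[<] x, g x < g t := by
  have := (hasDerivAt_iff_tendsto_slope.1 hg).eventually (gt_mem_nhds h)
  constructor
  · have h2 := this.filter_mono (nhdsWithin_mono x (fun t (ht : x < t) => ht.ne'))
    filter_upwards [h2, self_mem_nhdsWithin] with t ht htx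
    rw [slope_def_field, div_neg_iff] at ht
    have : x < t := htx
    rcases ht with ht | ht <;> linarith
  · have h2 := this.filter_mono (nhdsWithin_mono x (fun t (ht : t < x) => ht.ne))
    filter_upwards [h2, self_mem_nhdsWithin] with t ht htx
    rw [slope_def_field, div_neg_iff] at ht
    have : t < x := htx
    rcases ht with ht | ht <;> linarith

/-- `b` shadows the compact curve `c`, so it clusters nowhere else. At the times `ψ (s + n * T)` it
comes back to `c s`. The reparametrisation `φ` allows `b` to be traversed at another speed than `c`.
-/
theorem mapClusterPt_of_periodic {b c : ℝ → E2} {T : ℝ} (hT : 0 < T) (hc : Continuous c)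
    (hper : Function.Periodic c T) {φ : ℝ → ℝ}
    {ψ : ℝ → ℝ} (hψ : Tendsto ψ atTop atTop) (hφψ : ∀ᶠ s in atTop, φ (ψ s) = s)
    (h : Tendsto (fun t => b t - c (φ t)) atTop (𝓝 0)) :
    {x : E2 | MapClusterPt x atTop b} = range c := by
  have hcomp : IsCompact (range c) := by
    rw [← hper.image_Icc hT 0]
    exact isCompact_Icc.image hc
  apply Subset.antisymm
  · intro x hx
    by_contra hxc
    have hpos := (hcomp.isClosed.notMem_iff_infDist_pos (range_nonempty c)).1 hxc
    set δ := Metric.infDist x (range c)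
    have h1 : ∀ᶠ t in atTop, ‖b t - c (φ t)‖ < δ / 2 :=
      (tendsto_zero_iff_norm_tendsto_zero.1 h).eventually (gt_mem_nhds (by linarith))
    have h2 : ∃ᶠ t in atTop, b t ∈ Metric.ball x (δ / 2) :=
      hx.frequently (Metric.ball_mem_nhds x (by linarith))
    obtain ⟨t, ht2, ht1⟩ := (h2.and_eventually h1).exists
    have h3 : δ ≤ dist x (c (φ t)) := Metric.infDist_le_dist_of_mem (mem_range_self _)
    have h4 := dist_triangle x (b t) (c (φ t))
    rw [Metric.mem_ball, dist_comm] at ht2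
    rw [← dist_eq_norm] at ht1
    linarith
  · rintro _ ⟨s, rfl⟩
    have hseq : Tendsto (fun n : ℕ => s + n * T) atTop atTop :=
      tendsto_atTop_add_const_left _ _ (tendsto_natCast_atTop_atTop.atTop_mul_const hT)
    refine MapClusterPt.of_comp (hψ.comp hseq) (Tendsto.mapClusterPt ?_)
    have h1 : Tendsto (fun n : ℕ => b (ψ (s + n * T)) - c (φ (ψ (s + n * T)))) atTop (𝓝 0) :=
      h.comp (hψ.comp hseq)
    have h2 : ∀ᶠ n : ℕ in atTop, φ (ψ (s + n * T)) = s + n * T := hseq.eventually hφψ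
    have h3 := h1.add_const (c s)
    rw [zero_add] at h3
    refine h3.congr' ?_
    filter_upwards [h2] with n hn
    rw [hn, hper.nat_mul n s]
    simp

end

/-! ### Limit cycles in trapping annuli. -/

section
/-- `c` is a regularly parametrised curve in the region `ra ≤ ‖v‖ ≤ rb`, `u₁ ≤ u ≤ u₂`, tangent to
the kernel of the one-form `μ`. -/
def IsLeafIn (μ : E2 → E2 →L[ℝ] ℝ) (S : Set E2) (c : ℝ → E2) : Prop :=
  ContDiff ℝ 1 c ∧ ∀ t, c t ∈ S ∧ deriv c t ≠ 0 ∧ μ (c t) (deriv c t) = 0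

/-- The velocity is a multiple of `rot z - h z • z` at `z = r • unitVec`, a vector that `hS` puts in
the kernel of `μ z`. It is nonzero because its angular component is. -/
theorem isLeafIn_polar {μ : E2 → E2 →L[ℝ] ℝ} {S : Set E2} {h : E2 → ℝ} {r r' φ φ' : ℝ → ℝ}
    (hS : ∀ v ∈ S, μ v (rot v) = h v * μ v v)
    (hr : ∀ t, HasDerivAt r (r' t) t) (hr' : Continuous r')
    (hφ : ∀ t, HasDerivAt φ (φ' t) t) (hφ' : Continuous φ') (hφ0 : ∀ t, φ' t ≠ 0)
    (hmem : ∀ t, 0 < r (φ t) ∧ r (φ t) • unitVec (φ t) ∈ S ∧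
      r' (φ t) = -r (φ t) * h (r (φ t) • unitVec (φ t))) :
    IsLeafIn μ S (fun t => r (φ t) • unitVec (φ t)) := by
  have hφc : Continuous φ := continuous_iff_continuousAt.2 fun t => (hφ t).continuousAt
  have hrc : Continuous r := continuous_iff_continuousAt.2 fun t => (hr t).continuousAt
  have hd : ∀ t, HasDerivAt (fun t => r (φ t) • unitVec (φ t))
      (φ' t • (r (φ t) • rot (unitVec (φ t)) + r' (φ t) • unitVec (φ t))) t := by
    intro t
    have h1 : HasDerivAt (fun θ => r θ • unitVec θ)
      (r (φ t) • rot (unitVec (φ t)) + r' (φ t) • unitVec (φ t)) (φ t) :=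
      (hr (φ t)).smul (hasDerivAt_unitVec _)
    exact h1.scomp t (hφ t)
  refine ⟨contDiff_one_iff_deriv.2 ⟨fun t => (hd t).differentiableAt, ?_⟩, fun t => ?_⟩
  · rw [funext fun t => (hd t).deriv]
    have := continuous_unitVec
    fun_prop
  · obtain ⟨h1, h2, h3⟩ := hmem t
    refine ⟨h2, ?_, ?_⟩
    · rw [(hd t).deriv]
      refine smul_ne_zero (hφ0 t) fun h0 => ?_
      have e0 := congrArg (fun v : E2 => v 0) h0
      have e1 := congrArg (fun v : E2 => v 1) h0
      simp at e0 e1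
      have : r (φ t) = 0 := by
        linear_combination (-Real.sin (φ t)) * e0 + Real.cos (φ t) * e1
          - r (φ t) * Real.sin_sq_add_cos_sq (φ t)
      linarith
    · rw [(hd t).deriv, map_smul]
      have h4 := hS _ h2
      have e : r (φ t) • rot (unitVec (φ t)) + r' (φ t) • unitVec (φ t) =
          rot (r (φ t) • unitVec (φ t)) - h (r (φ t) • unitVec (φ t)) • (r (φ t) • unitVec (φ t)) := by
        rw [h3, map_smul, neg_mul, neg_smul, ← sub_eq_add_neg, mul_comm, mul_smul]
      rw [e]
      change φ' t • μ (r (φ t) • unitVec (φ t)) _ = 0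
      generalize r (φ t) • unitVec (φ t) = z at h4 ⊢
      rw [map_sub, h4, (μ z).map_smul]
      simp

/-- **Trapping annulus.** If the leaves of `ker μ` cross the two boundary curves `u = u₁`
and `u = u₂` of an annulus inwards, there is a limit cycle in the annulus. -/
theorem exists_limit_cycle {μ : E2 → E2 →L[ℝ] ℝ} {u : E2 → ℝ} {ra rb u₁ u₂ : ℝ} {O : Set E2}
    (hO : IsOpen O) (hRO : Metric.closedBall 0 rb ⊆ O) (hra : 0 < ra) (hab : ra < rb) (h12 : u₁ < u₂)
    (hμ : ContDiffOn ℝ 1 μ O) (hu : ContDiffOn ℝ 1 u O)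
    (hua : ∀ v, ‖v‖ = ra → u v < u₁) (hub : ∀ v, ‖v‖ = rb → u₂ < u v)
    (hpos : ∀ v, ra ≤ ‖v‖ → ‖v‖ ≤ rb → u₁ ≤ u v → u v ≤ u₂ → 0 < μ v v)
    (hin : ∀ v, ra ≤ ‖v‖ → ‖v‖ ≤ rb → u v = u₁ →
      0 < μ v v * fderiv ℝ u v (rot v) - μ v (rot v) * fderiv ℝ u v v)
    (hout : ∀ v, ra ≤ ‖v‖ → ‖v‖ ≤ rb → u v = u₂ →
      μ v v * fderiv ℝ u v (rot v) - μ v (rot v) * fderiv ℝ u v v < 0) :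
    ∃ c b : ℝ → E2,
      IsLeafIn μ {v | ra ≤ ‖v‖ ∧ ‖v‖ ≤ rb ∧ u₁ ≤ u v ∧ u v ≤ u₂} c ∧
      (∃ T : ℝ, 0 < T ∧ Function.Periodic c T) ∧
      IsLeafIn μ {v | ra ≤ ‖v‖ ∧ ‖v‖ ≤ rb ∧ u₁ ≤ u v ∧ u v ≤ u₂} b ∧
      Disjoint (range b) (range c) ∧ {x : E2 | MapClusterPt x atTop b} = range c := by
  set S : Set E2 := {v | ra ≤ ‖v‖ ∧ ‖v‖ ≤ rb ∧ u₁ ≤ u v ∧ u v ≤ u₂} with hSdef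
  have hrb : 0 < rb := hra.trans hab
  have hSO : S ⊆ O := fun v hv => hRO (mem_closedBall_zero_iff.2 hv.2.1)
  have huc : ContinuousOn u (Metric.closedBall 0 rb) := hu.continuousOn.mono hRO
  have hScomp : IsCompact S := by
    have h1 : IsClosed (Metric.closedBall (0 : E2) rb ∩ u ⁻¹' Icc u₁ u₂) :=
      huc.preimage_isClosed_of_isClosed Metric.isClosed_closedBall isClosed_Icc
    have h2 : IsClosed {v : E2 | ra ≤ ‖v‖} := isClosed_le continuous_const continuous_norm
    have h3 : S = Metric.closedBall (0 : E2) rb ∩ u ⁻¹' Icc u₁ u₂ ∩ {v : E2 | ra ≤ ‖v‖} := by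
      ext v
      simp [hSdef]
      tauto
    refine (isCompact_closedBall (0 : E2) rb).of_isClosed_subset (h3 ▸ h1.inter h2) ?_
    exact fun v hv => mem_closedBall_zero_iff.2 hv.2.1
  have hμv : ContDiffOn ℝ 1 (fun v => μ v v) O := hμ.clm_apply contDiffOn_id
  have hμr : ContDiffOn ℝ 1 (fun v => μ v (rot v)) O := hμ.clm_apply rot.contDiff.contDiffOn
  obtain ⟨a₀, ha₀, hSa⟩ := hScomp.exists_forall_le' (hμv.continuousOn.mono hSO) (a := 0)
    fun v hv => hpos v hv.1 hv.2.1 hv.2.2.1 hv.2.2.2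
  -- `μ v v` is known to be positive only on `S`. The maximum with `a₀` makes the quotient Lipschitz
  -- on the whole disc and changes nothing on `S`.
  set h : E2 → ℝ := fun v => μ v (rot v) / max (μ v v) a₀ with hh
  have hcv := convex_closedBall (0 : E2) rb
  have hcc := isCompact_closedBall (0 : E2) rb
  obtain ⟨K₁, hK₁⟩ := (hμv.mono hRO).exists_lipschitzOnWith one_ne_zero hcv hcc
  obtain ⟨K₂, hK₂⟩ := (hμr.mono hRO).exists_lipschitzOnWith one_ne_zero hcv hcc
  obtain ⟨B, hB⟩ := hcc.exists_bound_of_continuousOn hK₂.continuousOn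
  have hB0 : 0 ≤ B := (norm_nonneg _).trans (hB 0 (by simp [hrb.le]))
  have hhL : ∃ K : NNReal, LipschitzOnWith K h (Metric.closedBall 0 rb) := by
    refine ⟨⟨(max K₁ K₂ : NNReal) / a₀ + B * (max K₁ K₂ : NNReal) / a₀ ^ 2, by positivity⟩,
      LipschitzOnWith.of_dist_le_mul fun v hv w hw => ?_⟩
    refine LipschitzOnWith.abs_div_le ha₀ (le_max_right _ _) (le_max_right _ _) (hB w hw) ?_ ?_
      (by positivity)
    · refine (hK₂.dist_le_mul v hv w hw).trans ?_
      gcongr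
      exact_mod_cast le_max_right _ _
    · refine (abs_max_sub_max_le_abs _ _ _).trans ((hK₁.dist_le_mul v hv w hw).trans ?_)
      gcongr
      exact_mod_cast le_max_left _ _
  obtain ⟨K, hK⟩ := hhL
  have hhS : ∀ v ∈ S, μ v (rot v) = h v * μ v v := by
    intro v hv
    have h1 := hSa v hv
    simp only [hh, max_eq_left h1]
    field_simp [(ha₀.trans_le h1).ne']
  obtain ⟨V, KV, LV, hVK, hVL, hVc, hVp, hVeq⟩ := exists_polar_equation hra hab hK
  have hnorm : ∀ {x : ℝ} (θ : ℝ), 0 ≤ x → ‖x • unitVec θ‖ = x := fun {x} θ hx => by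
    rw [norm_smul, norm_unitVec, mul_one, Real.norm_eq_abs, abs_of_nonneg hx]
  -- the starting point: the outermost point of the ray with `u = u₂`
  have hray : ContinuousOn (fun x : ℝ => u (x • unitVec 0)) (Icc ra rb) :=
    huc.comp (by fun_prop) fun x hx => by
      rw [mem_closedBall_zero_iff, hnorm _ (hra.le.trans hx.1)]; exact hx.2
  obtain ⟨r₀, hr₀, hr₀max⟩ : ∃ r₀, (r₀ ∈ Icc ra rb ∧ u (r₀ • unitVec 0) = u₂) ∧
      ∀ x ∈ Icc ra rb, u (x • unitVec 0) ≤ u₂ → x ≤ r₀ := by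
    have hcl : IsCompact (Icc ra rb ∩ (fun x : ℝ => u (x • unitVec 0)) ⁻¹' Iic u₂) :=
      isCompact_Icc.of_isClosed_subset
        (hray.preimage_isClosed_of_isClosed isClosed_Icc isClosed_Iic) inter_subset_left
    have hne : (Icc ra rb ∩ (fun x : ℝ => u (x • unitVec 0)) ⁻¹' Iic u₂).Nonempty :=
      ⟨ra, ⟨le_rfl, hab.le⟩, ((hua _ (hnorm 0 hra.le)).trans h12).le⟩
    obtain ⟨r₀, hr₀, hmax⟩ := hcl.exists_isGreatest hne
    refine ⟨r₀, ⟨hr₀.1, le_antisymm hr₀.2 ?_⟩, fun x hx hx2 => hmax ⟨hx, hx2⟩⟩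
    by_contra hlt
    push Not at hlt
    have hrb2 := hub _ (hnorm 0 hrb.le)
    have hsub : Icc r₀ rb ⊆ Icc ra rb := Icc_subset_Icc_left hr₀.1.1
    obtain ⟨x, hx, hxe⟩ := intermediate_value_Icc hr₀.1.2 (hray.mono hsub) ⟨hlt.le, hrb2.le⟩
    have : x ≤ r₀ := hmax ⟨hsub hx, hxe.le⟩
    have : x = r₀ := le_antisymm this hx.1
    subst this
    exact hlt.ne hxe
  obtain ⟨r, hr0, hr⟩ := exists_global_solution hVK hVL
    (fun x => hVc.comp (by fun_prop : Continuous fun t : ℝ => (t, x))) r₀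
  have hrc : Continuous r := continuous_iff_continuousAt.2 fun t => (hr t).continuousAt
  set w : ℝ → E2 := fun t => r t • unitVec t with hw
  have hwc : Continuous w := hrc.smul continuous_unitVec
  have hwd : ∀ t, 0 ≤ r t → w t ∈ S → HasDerivAt w (rot (w t) - h (w t) • w t) t := by
    intro t ht hwS
    have h1 : HasDerivAt w _ t := (hr t).smul (hasDerivAt_unitVec t)
    convert h1 using 1
    rw [hVeq t (r t) (by simpa [hw, hnorm t ht] using hwS.1) (by simpa [hw, hnorm t ht] using hwS.2.1)]
    simp only [hw, map_smul]
    rw [neg_mul, neg_smul, ← sub_eq_add_neg, mul_comm, mul_smul]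
  -- Since `μ v v > 0` on `S`, the derivative of `u` along the leaf has the sign of the determinant
  -- in `hin` and `hout`.
  have hgd : ∀ t, 0 ≤ r t → w t ∈ S → ∃ g', HasDerivAt (fun t => u (w t)) g' t ∧
      g' * μ (w t) (w t) = μ (w t) (w t) * fderiv ℝ u (w t) (rot (w t))
        - μ (w t) (rot (w t)) * fderiv ℝ u (w t) (w t) := by
    intro t ht hwS
    have hdu : HasFDerivAt u (fderiv ℝ u (w t)) (w t) :=
      ((hu.contDiffAt (hO.mem_nhds (hSO hwS))).differentiableAt one_ne_zero).hasFDerivAt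
    refine ⟨_, hdu.comp_hasDerivAt t (hwd t ht hwS), ?_⟩
    rw [map_sub, hhS _ hwS, (fderiv ℝ u (w t)).map_smul, smul_eq_mul]
    ring
  have hμpos : ∀ v ∈ S, 0 < μ v v := fun v hv => ha₀.trans_le (hSa v hv)
  -- Continuous induction: the good times form a closed set that extends to the right. At `u₁` and
  -- `u₂` the leaf points inwards, and the radii `ra` and `rb` are never reached because there `u`
  -- lies outside `[u₁, u₂]`.
  have trap : ∀ t, 0 ≤ t → 0 ≤ r t ∧ w t ∈ S := by
    intro T hT
    have key : Icc 0 T ⊆ {t | r t ∈ Icc ra rb ∧ u (w t) ∈ Icc u₁ u₂} := by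
      have hgc : ContinuousOn (fun t => u (w t)) {t | r t ∈ Icc ra rb} :=
        huc.comp hwc.continuousOn fun t ht => by
          rw [mem_closedBall_zero_iff, hnorm t (hra.le.trans ht.1)]; exact ht.2
      refine IsClosed.Icc_subset_of_forall_exists_gt ?_ ?_ ?_
      · exact (hgc.preimage_isClosed_of_isClosed (isClosed_Icc.preimage hrc) isClosed_Icc).inter isClosed_Icc
      · change r 0 ∈ Icc ra rb ∧ u (r 0 • unitVec 0) ∈ Icc u₁ u₂
        rw [hr0, hr₀.2]
        exact ⟨hr₀.1, h12.le, le_rfl⟩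
      · rintro x ⟨⟨hx1, hx2⟩, hx3⟩ y hy
        have hrx : 0 ≤ r x := hra.le.trans hx1.1
        have hwn : ‖w x‖ = r x := hnorm x hrx
        have hxS : w x ∈ S := ⟨by rw [hwn]; exact hx1.1, by rw [hwn]; exact hx1.2, hx2⟩
        have hx1a : ra < r x := lt_of_le_of_ne hx1.1 fun he =>
          absurd (hua (w x) (by rw [hwn, he])) (not_lt.2 hx2.1)
        have hx1b : r x < rb := lt_of_le_of_ne hx1.2 fun he =>
          absurd (hub (w x) (by rw [hwn, he])) (not_lt.2 hx2.2)
        have ev1 : ∀ᶠ t in 𝓝[>] x, r t ∈ Icc ra rb :=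
          nhdsWithin_le_nhds (hrc.continuousAt.eventually (Icc_mem_nhds hx1a hx1b))
        obtain ⟨g', hg', hg'e⟩ := hgd x hrx hxS
        have hp := hμpos _ hxS
        have ev2 : ∀ᶠ t in 𝓝[>] x, u (w t) ≤ u₂ := by
          rcases hx2.2.lt_or_eq with hlt | heq
          · exact nhdsWithin_le_nhds
              ((hg'.continuousAt.eventually (gt_mem_nhds hlt)).mono fun _ h => le_of_lt h)
          · have h1 := hout _ hxS.1 hxS.2.1 heq
            have h2 : g' < 0 := by
              rw [← hg'e] at h1
              exact neg_of_mul_neg_left h1 hp.le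
            filter_upwards [(eventually_lt_of_hasDerivAt_neg hg' h2).1] with t ht
            linarith
        have ev3 : ∀ᶠ t in 𝓝[>] x, u₁ ≤ u (w t) := by
          rcases hx2.1.lt_or_eq with hlt | heq
          · exact nhdsWithin_le_nhds
              ((hg'.continuousAt.eventually (lt_mem_nhds hlt)).mono fun _ h => le_of_lt h)
          · have h1 := hin _ hxS.1 hxS.2.1 heq.symm
            have h2 : -g' < 0 := by
              rw [← hg'e] at h1
              linarith [pos_of_mul_pos_left h1 hp.le]
            filter_upwards [(eventually_lt_of_hasDerivAt_neg hg'.neg h2).1] with t ht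
            simp only [Pi.neg_apply] at ht
            linarith
        have ev4 : ∀ᶠ t in 𝓝[>] x, t ∈ Ioc x y := Ioc_mem_nhdsGT hy
        obtain ⟨t, h1, h2, h3, h4⟩ := (ev1.and (ev2.and (ev3.and ev4))).exists
        exact ⟨t, ⟨h1, h3, h2⟩, h4⟩
    obtain ⟨h1, h2⟩ := key ⟨hT, le_rfl⟩
    have h0 : 0 ≤ r T := hra.le.trans h1.1
    exact ⟨h0, by rw [hnorm T h0]; exact h1.1, by rw [hnorm T h0]; exact h1.2, h2⟩
  have hpi : 0 < 2 * Real.pi := Real.two_pi_pos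
  have hrS : ∀ t, 0 ≤ t → ra ≤ r t ∧ r t ≤ rb := fun t ht => by
    obtain ⟨h1, h2, h3, -⟩ := trap t ht
    rw [hnorm t h1] at h2 h3
    exact ⟨h2, h3⟩
  have hw2 : w (2 * Real.pi) = r (2 * Real.pi) • unitVec 0 := by
    simp only [hw]
    rw [← zero_add (2 * Real.pi), unitVec_periodic, zero_add]
  have hdec : r (2 * Real.pi) < r 0 := by
    rw [hr0]
    obtain ⟨h1, h2⟩ := trap _ hpi.le
    have hle : r (2 * Real.pi) ≤ r₀ :=
      hr₀max _ (hrS _ hpi.le) (by rw [← hw2]; exact h2.2.2.2)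
    -- A return to the starting point would lie on `u = u₂`, where `u` strictly decreases along the
    -- leaf, so `u > u₂` just before, against trapping.
    refine lt_of_le_of_ne hle fun he => ?_
    have hu2 : u (w (2 * Real.pi)) = u₂ := by rw [hw2, he]; exact hr₀.2
    obtain ⟨g', hg', hg'e⟩ := hgd _ h1 h2
    have h3 := hout _ h2.1 h2.2.1 hu2
    rw [← hg'e] at h3
    have h4 := (eventually_lt_of_hasDerivAt_neg hg' (neg_of_mul_neg_left h3 (hμpos _ h2).le)).2
    have h5 : ∀ᶠ t in 𝓝[<] (2 * Real.pi), 0 ≤ t :=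
      nhdsWithin_le_nhds ((lt_mem_nhds hpi).mono fun _ h => le_of_lt h)
    obtain ⟨t, ht1, ht2⟩ := (h4.and h5).exists
    have := (trap t ht2).2.2.2.2
    simp only [hu2] at ht1
    linarith
  obtain ⟨c, hc, hcper, hcr, hclim⟩ := exists_periodic_limit hVK hVL
    (fun x => hVc.comp (by fun_prop : Continuous fun t : ℝ => (t, x))) hpi hVp hr hdec
    (fun t ht => (hrS t ht).1)
  have hcc' : Continuous c := continuous_iff_continuousAt.2 fun t => (hc t).continuousAt
  -- Each point of the cycle is a limit of points of the trapped leaf at the same angle, and `S` is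
  -- closed.
  have hcS : ∀ t, 0 ≤ c t ∧ c t • unitVec t ∈ S := by
    intro t
    have hseq : Tendsto (fun n : ℕ => t + n * (2 * Real.pi)) atTop atTop :=
      tendsto_atTop_add_const_left _ _ (tendsto_natCast_atTop_atTop.atTop_mul_const hpi)
    have h1 : Tendsto (fun n : ℕ => r (t + n * (2 * Real.pi))) atTop (𝓝 (c t)) := by
      have h2 := (hclim.comp hseq).add_const (c t)
      rw [zero_add] at h2
      refine h2.congr fun n => ?_
      simp only [Function.comp]
      rw [hcper.nat_mul n t]
      ring
    have h2 : Tendsto (fun n : ℕ => w (t + n * (2 * Real.pi))) atTop (𝓝 (c t • unitVec t)) := by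
      refine (h1.smul_const (unitVec t)).congr fun n => ?_
      simp only [hw]
      rw [unitVec_periodic.nat_mul n t]
    have h3 : ∀ᶠ n : ℕ in atTop, 0 ≤ t + n * (2 * Real.pi) := hseq.eventually_ge_atTop 0
    refine ⟨?_, ?_⟩
    · exact ge_of_tendsto h1 (h3.mono fun n hn => (trap _ hn).1)
    · exact hScomp.isClosed.mem_of_tendsto h2 (h3.mono fun n hn => (trap _ hn).2)
  have hcS' : ∀ t, ra ≤ c t ∧ c t ≤ rb := fun t => by
    obtain ⟨h1, h2, h3, -⟩ := hcS t
    rw [hnorm t h1] at h2 h3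
    exact ⟨h2, h3⟩
  have hVr : Continuous fun t => V t (r t) :=
    hVc.comp (by fun_prop : Continuous fun t : ℝ => (t, r t))
  have hVc' : Continuous fun t => V t (c t) :=
    hVc.comp (by fun_prop : Continuous fun t : ℝ => (t, c t))
  -- The second leaf runs through the angle `exp t`: only nonnegative angles are known to be
  -- trapped, whereas a leaf needs every real parameter.
  refine ⟨fun t => c t • unitVec t, fun t => r (Real.exp t) • unitVec (Real.exp t), ?_, ?_, ?_, ?_, ?_⟩
  · exact isLeafIn_polar (φ := id) (φ' := fun _ => 1) hhS hc hVc' (fun t => hasDerivAt_id t)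
      continuous_const (fun _ => one_ne_zero)
      fun t => ⟨hra.trans_le (hcS' t).1, (hcS t).2, hVeq _ _ (hcS' t).1 (hcS' t).2⟩
  · exact ⟨2 * Real.pi, hpi, fun t => by simp only [hcper t, unitVec_periodic t]⟩
  · exact isLeafIn_polar (φ := Real.exp) (φ' := Real.exp) hhS hr hVr (fun t => Real.hasDerivAt_exp t)
      Real.continuous_exp (fun t => (Real.exp_pos t).ne') fun t =>
      have ht := (Real.exp_pos t).le
      ⟨hra.trans_le (hrS _ ht).1, (trap _ ht).2, hVeq _ _ (hrS _ ht).1 (hrS _ ht).2⟩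
  · rw [Set.disjoint_left]
    rintro _ ⟨t, rfl⟩ ⟨s, hs⟩
    simp only at hs
    have hn := congrArg norm hs
    have ht := (Real.exp_pos t).le
    rw [hnorm _ (hcS s).1, hnorm _ (trap _ ht).1] at hn
    rw [← hn] at hs
    have hcs : c s ≠ 0 := (hra.trans_le (hcS' s).1).ne'
    obtain ⟨k, hk⟩ := unitVec_eq_iff (smul_right_injective E2 hcs hs)
    have h1 : c s = c (Real.exp t) := by rw [hk]; exact hcper.int_mul k _
    have h2 := hcr (Real.exp t)
    linarith
  · refine mapClusterPt_of_periodic (φ := Real.exp) (ψ := Real.log) hpi (hcc'.smul continuous_unitVec)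
      (fun t => by simp only [hcper t, unitVec_periodic t]) Real.tendsto_log_atTop
      ((eventually_gt_atTop 0).mono fun s hs => Real.exp_log hs) ?_
    rw [tendsto_zero_iff_norm_tendsto_zero]
    have h1 := (tendsto_zero_iff_norm_tendsto_zero.1 (hclim.comp Real.tendsto_exp_atTop))
    refine h1.congr fun t => ?_
    simp only [Function.comp]
    rw [← sub_smul, norm_smul, norm_unitVec, mul_one]

end

section
/-! ### Exterior calculus of one-forms on three-space -/

theorem dForm_self (α : E3 → (E3 →L[ℝ] ℝ)) (y v : E3) : dForm α y v v = 0 := sub_self _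

theorem dForm_antisymm (α : E3 → (E3 →L[ℝ] ℝ)) (y v w : E3) : dForm α y v w = -dForm α y w v := by
  simp [dForm]

/-- The exterior derivative at a point as a bilinear map. -/
def dFormL (α : E3 → (E3 →L[ℝ] ℝ)) (y : E3) : E3 →L[ℝ] E3 →L[ℝ] ℝ :=
  fderiv ℝ α y - (fderiv ℝ α y).flip

theorem dFormL_apply (α : E3 → (E3 →L[ℝ] ℝ)) (y v w : E3) : dFormL α y v w = dForm α y v w := by
  simp [dFormL, dForm]

/-- The contraction of the exterior derivative with a vector field. -/
def contr (α : E3 → (E3 →L[ℝ] ℝ)) (X : E3 → E3) (y : E3) : E3 →L[ℝ] ℝ := dFormL α y (X y)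

theorem contr_apply (α : E3 → (E3 →L[ℝ] ℝ)) (X : E3 → E3) (y w : E3) :
    contr α X y w = dForm α y (X y) w := dFormL_apply _ _ _ _

theorem contDiffOn_fderiv_top {F : Type*} [NormedAddCommGroup F] [NormedSpace ℝ F]
    {E : Type*} [NormedAddCommGroup E] [NormedSpace ℝ E] {f : E → F} {V : Set E}
    (hV : IsOpen V) (hf : ContDiffOn ℝ ∞ f V) : ContDiffOn ℝ ∞ (fderiv ℝ f) V :=
  hf.fderiv_of_isOpen hV (by simp)

theorem contDiffOn_contr {α : E3 → (E3 →L[ℝ] ℝ)} {X : E3 → E3} {V : Set E3} (hV : IsOpen V)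
    (hα : ContDiffOn ℝ ∞ α V) (hX : ContDiffOn ℝ ∞ X V) : ContDiffOn ℝ ∞ (contr α X) V := by
  have h := contDiffOn_fderiv_top hV hα
  rw [contDiffOn_clm_apply]
  intro w
  simp only [contr_apply, dForm]
  exact ((h.clm_apply hX).clm_apply contDiffOn_const).sub
    ((h.clm_apply contDiffOn_const).clm_apply hX)

theorem dForm_congr {α β : E3 → (E3 →L[ℝ] ℝ)} {y : E3} (h : α =ᶠ[𝓝 y] β) (v w : E3) :
    dForm α y v w = dForm β y v w := by
  simp only [dForm, h.fderiv_eq]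

theorem dForm_smul {f : E3 → ℝ} {α : E3 → (E3 →L[ℝ] ℝ)} {y : E3} (hf : DifferentiableAt ℝ f y)
    (hα : DifferentiableAt ℝ α y) (v w : E3) :
    dForm (fun y => f y • α y) y v w =
      f y * dForm α y v w + (fderiv ℝ f y v * α y w - fderiv ℝ f y w * α y v) := by
  simp only [dForm, fderiv_fun_smul hf hα]
  simp
  ring

theorem dForm_add {α β : E3 → (E3 →L[ℝ] ℝ)} {y : E3} (hα : DifferentiableAt ℝ α y)
    (hβ : DifferentiableAt ℝ β y) (v w : E3) :
    dForm (fun y => α y + β y) y v w = dForm α y v w + dForm β y v w := by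
  simp only [dForm, fderiv_fun_add hα hβ]
  simp
  ring

theorem wedgeD_smul {f : E3 → ℝ} {α : E3 → (E3 →L[ℝ] ℝ)} {y : E3} (hf : DifferentiableAt ℝ f y)
    (hα : DifferentiableAt ℝ α y) (u v w : E3) :
    wedgeD (fun y => f y • α y) y u v w = f y ^ 2 * wedgeD α y u v w := by
  simp only [wedgeD, dForm_smul hf hα]
  simp
  ring

/-- The pullback of a one-form. -/
def pullForm (τ : E3 → E3) (α : E3 → (E3 →L[ℝ] ℝ)) (y : E3) : E3 →L[ℝ] ℝ :=
  (α (τ y)).comp (fderiv ℝ τ y)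

/-- The terms containing the second derivative of `τ` cancel on antisymmetrising, because that
derivative is symmetric. -/
theorem dForm_pullForm {τ : E3 → E3} {α : E3 → (E3 →L[ℝ] ℝ)} {y : E3} (hτ : ContDiffAt ℝ 2 τ y)
    (hα : DifferentiableAt ℝ α (τ y)) (v w : E3) :
    dForm (pullForm τ α) y v w = dForm α (τ y) (fderiv ℝ τ y v) (fderiv ℝ τ y w) := by
  have hτ1 : DifferentiableAt ℝ τ y := hτ.differentiableAt two_ne_zero
  have hτ2 : DifferentiableAt ℝ (fderiv ℝ τ) y :=
    (hτ.fderiv_right (m := 1) (by norm_num)).differentiableAt one_ne_zero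
  have hc : HasFDerivAt (fun y => α (τ y)) ((fderiv ℝ α (τ y)).comp (fderiv ℝ τ y)) y :=
    hα.hasFDerivAt.comp y hτ1.hasFDerivAt
  have h := (hc.clm_comp hτ2.hasFDerivAt).fderiv
  have hsymm : IsSymmSndFDerivAt ℝ τ y := hτ.isSymmSndFDerivAt (by simp)
  have e : pullForm τ α = fun y => (α (τ y)).comp (fderiv ℝ τ y) := rfl
  simp only [dForm, e, h]
  simp [hsymm.eq v w]

theorem wedgeD_pullForm {τ : E3 → E3} {α : E3 → (E3 →L[ℝ] ℝ)} {y : E3} (hτ : ContDiffAt ℝ 2 τ y)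
    (hα : DifferentiableAt ℝ α (τ y)) (u v w : E3) :
    wedgeD (pullForm τ α) y u v w =
      wedgeD α (τ y) (fderiv ℝ τ y u) (fderiv ℝ τ y v) (fderiv ℝ τ y w) := by
  simp only [wedgeD, dForm_pullForm hτ hα]
  rfl

/-- The exterior product of two covectors. -/
def wedge (σ τ : E3 →L[ℝ] ℝ) (v w : E3) : ℝ := σ v * τ w - σ w * τ v

/-- The form `cos Θ α + sin Θ β`. -/
def rotForm (Θ : E3 → ℝ) (α β : E3 → (E3 →L[ℝ] ℝ)) (y : E3) : E3 →L[ℝ] ℝ :=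
  Real.cos (Θ y) • α y + Real.sin (Θ y) • β y

/-- As `X` lies in the kernels of `α` and `β`, only the contractions `ι_X dα = β` and `ι_X dβ`
survive. The differential of `Θ` enters only through `XΘ`, the one term whose size can be controlled
at will. -/
theorem wedgeD_rotForm {Θ : E3 → ℝ} {α β : E3 → (E3 →L[ℝ] ℝ)} {X : E3 → E3} {y : E3}
    (hΘ : DifferentiableAt ℝ Θ y) (hα : DifferentiableAt ℝ α y) (hβ : DifferentiableAt ℝ β y)
    (hαX : α y (X y) = 0) (hβX : β y = contr α X y) (v w : E3) :
    wedgeD (rotForm Θ α β) y (X y) v w =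
      -((fderiv ℝ Θ y (X y) + Real.cos (Θ y) ^ 2) * wedge (α y) (β y) v w
        + Real.cos (Θ y) * Real.sin (Θ y) * wedge (α y) (contr β X y) v w
        + Real.sin (Θ y) ^ 2 * wedge (β y) (contr β X y) v w) := by
  have hcos := hΘ.hasFDerivAt.cos
  have hsin := hΘ.hasFDerivAt.sin
  have hd : ∀ v w, dForm (rotForm Θ α β) y v w =
      Real.cos (Θ y) * dForm α y v w + Real.sin (Θ y) * dForm β y v w
      + (-Real.sin (Θ y) * (fderiv ℝ Θ y v * α y w - fderiv ℝ Θ y w * α y v)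
        + Real.cos (Θ y) * (fderiv ℝ Θ y v * β y w - fderiv ℝ Θ y w * β y v)) := by
    intro v w
    have e : rotForm Θ α β = fun y => Real.cos (Θ y) • α y + Real.sin (Θ y) • β y := rfl
    rw [e, dForm_add (hcos.differentiableAt.fun_smul hα) (hsin.differentiableAt.fun_smul hβ),
      dForm_smul hcos.differentiableAt hα, dForm_smul hsin.differentiableAt hβ, hcos.fderiv, hsin.fderiv]
    simp
    ring
  have hXX : β y (X y) = 0 := by rw [hβX, contr_apply, dForm_self]
  have hβv : ∀ v, dForm α y (X y) v = β y v := fun v => by rw [hβX, contr_apply]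
  have hβv' : ∀ v, dForm α y v (X y) = -β y v := fun v => by rw [dForm_antisymm, hβv]
  have hκ' : ∀ v, dForm β y v (X y) = -contr β X y v := fun v => by rw [dForm_antisymm, contr_apply]
  have hκ : ∀ v, dForm β y (X y) v = contr β X y v := fun v => by rw [contr_apply]
  simp only [wedgeD, hd, hβv, hβv', hκ, hκ', hXX, hαX, wedge]
  simp only [rotForm, add_apply, smul_apply, smul_eq_mul, hXX, hαX]
  linear_combination (fderiv ℝ Θ y (X y) * (α y w * β y v - α y v * β y w))
    * Real.sin_sq_add_cos_sq (Θ y)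

theorem E3_eq_sum (v : E3) : v = v 0 • EuclideanSpace.single 0 1 + v 1 • EuclideanSpace.single 1 1
    + v 2 • EuclideanSpace.single 2 1 := by
  ext i; fin_cases i <;> simp

/-- If `α ∧ dα` does not vanish at `y`, neither does its contraction with a nonzero vector. -/
theorem exists_wedge_contr_ne_zero {α : E3 → (E3 →L[ℝ] ℝ)} {X : E3 → E3} {y : E3}
    (hc : ∃ u v w, wedgeD α y u v w ≠ 0) (hX : X y ≠ 0) (hαX : α y (X y) = 0) :
    ∃ v w, wedge (α y) (contr α X y) v w ≠ 0 := by
  set e0 : E3 := EuclideanSpace.single 0 1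
  set e1 : E3 := EuclideanSpace.single 1 1
  set e2 : E3 := EuclideanSpace.single 2 1
  by_contra! hcon
  obtain ⟨u, v, w, h⟩ := hc
  have a10 := dForm_antisymm α y e1 e0
  have a20 := dForm_antisymm α y e2 e0
  have a21 := dForm_antisymm α y e2 e1
  have a00 := dForm_self α y e0
  have a11 := dForm_self α y e1
  have a22 := dForm_self α y e2
  have exp1 : ∀ v, α y v = v 0 * α y e0 + v 1 * α y e1 + v 2 * α y e2 := fun v => by
    conv_lhs => rw [E3_eq_sum v]
    simp [e0, e1, e2]
  have exp2 : ∀ v w, dForm α y v w = (v 0 * w 1 - v 1 * w 0) * dForm α y e0 e1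
      + (v 0 * w 2 - v 2 * w 0) * dForm α y e0 e2 + (v 1 * w 2 - v 2 * w 1) * dForm α y e1 e2 := by
    intro v w
    have : dForm α y v w = dFormL α y (v 0 • e0 + v 1 • e1 + v 2 • e2) (w 0 • e0 + w 1 • e1 + w 2 • e2) := by
      rw [← E3_eq_sum v, ← E3_eq_sum w, dFormL_apply]
    rw [this]
    simp only [map_add, map_smul, add_apply, smul_apply,
      dFormL_apply, smul_eq_mul, a10, a20, a21, a00, a11, a22]
    ring
  set D := wedgeD α y e0 e1 e2 with hD
  have hDe : D = α y e0 * dForm α y e1 e2 - α y e1 * dForm α y e0 e2 + α y e2 * dForm α y e0 e1 := by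
    rw [hD, wedgeD, a20]; ring
  have hD0 : D ≠ 0 := by
    intro h0
    apply h
    rw [h0] at hDe
    simp only [wedgeD, exp1 u, exp1 v, exp1 w, exp2 v w, exp2 w u, exp2 u v]
    linear_combination (-(u 0 * (v 1 * w 2 - v 2 * w 1) - u 1 * (v 0 * w 2 - v 2 * w 0)
      + u 2 * (v 0 * w 1 - v 1 * w 0))) * hDe
  have hX0 := exp1 (X y)
  rw [hαX] at hX0
  apply hX
  have key : ∀ v w, wedge (α y) (contr α X y) v w = 0 := hcon
  simp only [wedge, contr_apply, exp2 (X y)] at key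
  -- Given `α(X) = 0`, the coordinate minors of `α ∧ ι_X dα` are, up to sign, `D` times the
  -- coordinates of `X`.
  have k01 := key e0 e1
  have k02 := key e0 e2
  have k12 := key e1 e2
  simp [e0, e1, e2] at k01 k02 k12 hX0 hDe
  ext i
  fin_cases i
  · have : X y 0 * D = 0 := by
      rw [hDe]; linear_combination -k12 - dForm α y e1 e2 * hX0
    simpa [hD0] using this
  · have : X y 1 * D = 0 := by
      rw [hDe]; linear_combination k02 + dForm α y e0 e2 * hX0
    simpa [hD0] using this
  · have : X y 2 * D = 0 := by
      rw [hDe]; linear_combination -k01 - dForm α y e0 e1 * hX0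
    simpa [hD0] using this

end

section
/-! ### Vector fields and metrics in charts -/

section Charts
variable {M : Type*} [TopologicalSpace M] [ChartedSpace E3 M]

/-- The differential of a chart. -/
def dE (e : OpenPartialHomeomorph M E3) (q : M) : TangentSpace (𝓡 3) q →L[ℝ] E3 :=
  mfderiv (𝓡 3) 𝓘(ℝ, E3) e q

/-- The differential of the inverse of a chart. -/
def dS (e : OpenPartialHomeomorph M E3) (y : E3) : E3 →L[ℝ] TangentSpace (𝓡 3) (e.symm y) :=
  mfderiv 𝓘(ℝ, E3) (𝓡 3) e.symm y

/-- A vector field in a chart. -/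
def chartVec (X : ∀ p : M, TangentSpace (𝓡 3) p) (e : OpenPartialHomeomorph M E3) (y : E3) : E3 :=
  dE e (e.symm y) (X (e.symm y))

theorem mdifferentiable_of_mem {e : OpenPartialHomeomorph M E3}
    (he : e ∈ IsManifold.maximalAtlas (𝓡 3) ∞ M) : e.MDifferentiable (𝓡 3) 𝓘(ℝ, E3) :=
  ⟨(contMDiffOn_of_mem_maximalAtlas he).mdifferentiableOn (by simp),
    (contMDiffOn_symm_of_mem_maximalAtlas he).mdifferentiableOn (by simp)⟩

variable {e e' : OpenPartialHomeomorph M E3} (he : e ∈ IsManifold.maximalAtlas (𝓡 3) ∞ M)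
  (he' : e' ∈ IsManifold.maximalAtlas (𝓡 3) ∞ M)

include he

theorem dE_dS {y : E3} (hy : y ∈ e.target) (w : E3) : dE e (e.symm y) (dS e y w) = w :=
  DFunLike.congr_fun ((mdifferentiable_of_mem he).comp_symm_deriv hy) w

theorem dE_bijective {q : M} (hq : q ∈ e.source) : Function.Bijective (dE e q) :=
  (mdifferentiable_of_mem he).mfderiv_bijective hq

theorem contDiffOn_chartFun {Ψ : M → ℝ} (hΨ : ContMDiff (𝓡 3) 𝓘(ℝ, ℝ) ∞ Ψ) :
    ContDiffOn ℝ ∞ (Ψ ∘ e.symm) e.target :=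
  (hΨ.comp_contMDiffOn (contMDiffOn_symm_of_mem_maximalAtlas he)).contDiffOn

theorem fderiv_chartFun {Ψ : M → ℝ} (hΨ : ContMDiff (𝓡 3) 𝓘(ℝ, ℝ) ∞ Ψ) {q : M} (hq : q ∈ e.source)
    (v : TangentSpace (𝓡 3) q) :
    fderiv ℝ (Ψ ∘ e.symm) (e q) (dE e q v) = (mfderiv (𝓡 3) 𝓘(ℝ, ℝ) Ψ q v : ℝ) := by
  have h1 : MDifferentiableAt 𝓘(ℝ, E3) 𝓘(ℝ, ℝ) (Ψ ∘ e.symm) (e q) :=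
    (((contDiffOn_chartFun he hΨ).contDiffAt (e.open_target.mem_nhds (e.map_source hq))).differentiableAt
      (by simp)).mdifferentiableAt
  have h2 : MDifferentiableAt (𝓡 3) 𝓘(ℝ, E3) e q := (mdifferentiable_of_mem he).mdifferentiableAt hq
  have h3 := mfderiv_comp q h1 h2
  have h4 : (Ψ ∘ e.symm) ∘ e =ᶠ[𝓝 q] Ψ := by
    filter_upwards [e.open_source.mem_nhds hq] with x hx
    simp [e.left_inv hx]
  rw [h4.mfderiv_eq] at h3
  rw [h3, mfderiv_eq_fderiv]
  rfl

include he' in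
theorem contDiffOn_transition :
    ContDiffOn ℝ ∞ (e' ∘ e.symm) (e.target ∩ e.symm ⁻¹' e'.source) := by
  have h := (contMDiffOn_of_mem_maximalAtlas he').comp
    ((contMDiffOn_symm_of_mem_maximalAtlas he).mono inter_subset_left) (t := e'.source)
    (s := e.target ∩ e.symm ⁻¹' e'.source) (fun y hy => hy.2)
  exact h.contDiffOn

include he' in
theorem dE_transition {q : M} (hq : q ∈ e.source) (hq' : q ∈ e'.source) (v : TangentSpace (𝓡 3) q) :
    dE e' q v = fderiv ℝ (e' ∘ e.symm) (e q) (dE e q v) := by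
  have hy : e q ∈ e.target ∩ e.symm ⁻¹' e'.source := ⟨e.map_source hq, by simpa [e.left_inv hq] using hq'⟩
  have hopen : IsOpen (e.target ∩ e.symm ⁻¹' e'.source) := e.isOpen_inter_preimage_symm e'.open_source
  have h1 : MDifferentiableAt 𝓘(ℝ, E3) 𝓘(ℝ, E3) (e' ∘ e.symm) (e q) :=
    (((contDiffOn_transition he he').contDiffAt (hopen.mem_nhds hy)).differentiableAt
      (by simp)).mdifferentiableAt
  have h2 : MDifferentiableAt (𝓡 3) 𝓘(ℝ, E3) e q := (mdifferentiable_of_mem he).mdifferentiableAt hq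
  have h3 := mfderiv_comp q h1 h2
  have h4 : (e' ∘ e.symm) ∘ e =ᶠ[𝓝 q] e' := by
    filter_upwards [e.open_source.mem_nhds hq] with x hx
    simp [e.left_inv hx]
  rw [h4.mfderiv_eq] at h3
  simp only [dE]
  rw [h3, mfderiv_eq_fderiv]
  rfl

variable [IsManifold (𝓡 3) ∞ M]

theorem contDiffOn_chartVec {X : ∀ p : M, TangentSpace (𝓡 3) p}
    (hX : ContMDiff (𝓡 3) (𝓡 3).tangent ∞ (fun p : M => (⟨p, X p⟩ : TangentBundle (𝓡 3) M))) :
    ContDiffOn ℝ ∞ (chartVec X e) e.target := by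
  have h1 := (contMDiffOn_of_mem_maximalAtlas he).contMDiffOn_tangentMapWithin (m := ∞) (by simp)
    e.open_source.uniqueMDiffOn
  have h2 : ContMDiffOn 𝓘(ℝ, E3) (𝓡 3).tangent ∞
      (fun y : E3 => (⟨e.symm y, X (e.symm y)⟩ : TangentBundle (𝓡 3) M)) e.target :=
    hX.comp_contMDiffOn (contMDiffOn_symm_of_mem_maximalAtlas he)
  have h3 := h1.comp h2 (fun y hy => e.map_target hy)
  have h4 := contMDiff_snd_tangentBundle_modelSpace E3 𝓘(ℝ, E3) (n := ∞)
  have h5 := (h4.comp_contMDiffOn h3).contDiffOn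
  refine h5.congr fun y hy => ?_
  simp only [Function.comp, tangentMapWithin]
  rw [mfderivWithin_of_isOpen e.open_source (e.map_target hy)]
  rfl

theorem contMDiffOn_dS (v : E3) :
    ContMDiffOn 𝓘(ℝ, E3) (𝓡 3).tangent ∞
      (fun y : E3 => (⟨e.symm y, dS e y v⟩ : TangentBundle (𝓡 3) M)) e.target := by
  have h1 := (contMDiffOn_symm_of_mem_maximalAtlas he).contMDiffOn_tangentMapWithin (m := ∞) (by simp)
    e.open_target.uniqueMDiffOn
  have h2 : ContMDiff 𝓘(ℝ, E3) 𝓘(ℝ, E3).tangent ∞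
      (fun y : E3 => (⟨y, v⟩ : TangentBundle 𝓘(ℝ, E3) E3)) :=
    (contMDiff_vectorSpace_iff_contDiff (V := fun _ => v)).2 contDiff_const
  have h3 := h1.comp h2.contMDiffOn (s := e.target) (fun y hy => hy)
  refine h3.congr fun y hy => ?_
  simp only [Function.comp, tangentMapWithin]
  rw [mfderivWithin_of_isOpen e.open_target hy]
  rfl

end Charts

section Metric
variable {M : Type*} [TopologicalSpace M] [ChartedSpace E3 M] [IsManifold (𝓡 3) ∞ M]
  (g : Bundle.ContMDiffRiemannianMetric (𝓡 3) ∞ E3 (TangentSpace (𝓡 3) : M → Type))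

/-- A Riemannian metric in a chart. -/
def chartMetric (e : OpenPartialHomeomorph M E3) (y : E3) : E3 →L[ℝ] E3 →L[ℝ] ℝ :=
  let A : E3 →L[ℝ] E3 := dS e y
  let B : E3 →L[ℝ] E3 →L[ℝ] ℝ := g.inner (e.symm y)
  B.bilinearComp A A

theorem chartMetric_apply (e : OpenPartialHomeomorph M E3) (y v w : E3) :
    chartMetric g e y v w = g.inner (e.symm y) (dS e y v) (dS e y w) := rfl

variable {e : OpenPartialHomeomorph M E3} (he : e ∈ IsManifold.maximalAtlas (𝓡 3) ∞ M)
include he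

theorem chartMetric_dE {q : M} (hq : q ∈ e.source) (v w : TangentSpace (𝓡 3) q) :
    chartMetric g e (e q) (dE e q v) (dE e q w) = g.inner q v w := by
  obtain ⟨y, hy, rfl⟩ : ∃ y ∈ e.target, e.symm y = q := ⟨e q, e.map_source hq, e.left_inv hq⟩
  have key : ∀ v, dS e y (dE e (e.symm y) v) = v := fun v =>
    (dE_bijective he hq).1 (dE_dS he hy _)
  rw [e.right_inv hy, chartMetric_apply, key, key]

theorem chartMetric_pos {y : E3} (hy : y ∈ e.target) {v : E3} (hv : v ≠ 0) :
    0 < chartMetric g e y v v := by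
  rw [chartMetric_apply]
  refine g.pos _ _ fun h => hv ?_
  exact (dE_dS he hy v).symm.trans ((congrArg (dE e _) h).trans (map_zero _))

omit he in
theorem chartMetric_symm (y v w : E3) : chartMetric g e y v w = chartMetric g e y w v := by
  rw [chartMetric_apply, chartMetric_apply, g.symm]

theorem contDiffOn_chartMetric : ContDiffOn ℝ ∞ (chartMetric g e) e.target := by
  simp only [contDiffOn_clm_apply]
  intro v w
  have hg := g.contMDiff.comp_contMDiffOn (contMDiffOn_symm_of_mem_maximalAtlas he)
  have h := ContMDiffOn.clm_bundle_apply₂ (F₁ := E3) (F₂ := E3) (F₃ := ℝ)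
    (E₃ := Bundle.Trivial M ℝ) (b := e.symm) hg (contMDiffOn_dS he v) (contMDiffOn_dS he w)
  have h2 : ContMDiffOn 𝓘(ℝ, E3) 𝓘(ℝ, ℝ) ∞ (fun y => chartMetric g e y v w) e.target := by
    intro y hy
    have := h y hy
    simp only [Bundle.contMDiffWithinAt_totalSpace] at this
    exact this.2
  exact h2.contDiffOn

theorem chart_gradient {X : ∀ p : M, TangentSpace (𝓡 3) p} {Ψ : M → ℝ}
    (hΨ : ContMDiff (𝓡 3) 𝓘(ℝ, ℝ) ∞ Ψ)
    (hg : ∀ (p : M) (v : TangentSpace (𝓡 3) p), g.inner p (X p) v = -(mfderiv (𝓡 3) 𝓘(ℝ, ℝ) Ψ p v : ℝ))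
    {y : E3} (hy : y ∈ e.target) (w : E3) :
    chartMetric g e y (chartVec X e y) w = -fderiv ℝ (Ψ ∘ e.symm) y w := by
  have hq := e.map_target hy
  have h1 := chartMetric_dE g he hq (X (e.symm y)) (dS e y w)
  have h2 := fderiv_chartFun he hΨ hq (dS e y w)
  rw [e.right_inv hy, dE_dS he hy] at h1 h2
  exact h1.trans ((hg _ _).trans (congrArg Neg.neg h2.symm))

end Metric

/-! ### Linearisation at zeros of gradient fields -/

/-- When `G y (Y y) w` is differentiated at a zero of `Y`, the term with the derivative of `G`
vanishes. What remains relates the linearisation to the Hessian, and thus makes it self-adjoint for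
a symmetric `G`. -/
theorem gradient_linearization {E : Type*} [NormedAddCommGroup E] [NormedSpace ℝ E] {W : Set E}
    (hW : IsOpen W) {G : E → E →L[ℝ] E →L[ℝ] ℝ} {Y : E → E} {ψ : E → ℝ} (hG : ContDiffOn ℝ ∞ G W) (hY : ContDiffOn ℝ ∞ Y W)
    (hψ : ContDiffOn ℝ ∞ ψ W) (hgrad : ∀ y ∈ W, ∀ w, G y (Y y) w = -fderiv ℝ ψ y w)
    {y : E} (hy : y ∈ W) (hY0 : Y y = 0) (v w : E) :
    G y (fderiv ℝ Y y v) w = -fderiv ℝ (fderiv ℝ ψ) y v w := by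
  have hWn := hW.mem_nhds hy
  have dG := ((hG.contDiffAt hWn).differentiableAt (by simp)).hasFDerivAt
  have dY := ((hY.contDiffAt hWn).differentiableAt (by simp)).hasFDerivAt
  have dψ := (((contDiffOn_fderiv_top hW hψ).contDiffAt hWn).differentiableAt (by simp)).hasFDerivAt
  have h1 := ((dG.clm_apply dY).clm_apply (hasFDerivAt_const w y))
  have h2 := (dψ.clm_apply (hasFDerivAt_const w y)).neg
  have heq : (fun y => G y (Y y) w) =ᶠ[𝓝 y] -fun y => fderiv ℝ ψ y w := by
    filter_upwards [hWn] with z hz using hgrad z hz w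
  have h3 := DFunLike.congr_fun (h1.unique (h2.congr_of_eventuallyEq heq)) v
  simpa [hY0] using h3

theorem fderiv_fderiv_symm {W : Set E3} (hW : IsOpen W) {ψ : E3 → ℝ} (hψ : ContDiffOn ℝ ∞ ψ W)
    {y : E3} (hy : y ∈ W) (v w : E3) :
    fderiv ℝ (fderiv ℝ ψ) y v w = fderiv ℝ (fderiv ℝ ψ) y w v :=
  ((hψ.contDiffAt (hW.mem_nhds hy)).isSymmSndFDerivAt
    (by simpa using (ENat.LEInfty.out : (2 : WithTop ℕ∞) ≤ ∞))).eq v w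

end

section
/-! ### Endomorphisms that are self-adjoint for a given scalar product -/

theorem exists_eigenbasis {V : Type*} [AddCommGroup V] [Module ℝ V] [FiniteDimensional ℝ V]
    {n : ℕ} (hn : Module.finrank ℝ V = n) {G : V →ₗ[ℝ] V →ₗ[ℝ] ℝ} (hsymm : ∀ v w, G v w = G w v)
    (hpos : ∀ v, v ≠ 0 → 0 < G v v) {L : V →ₗ[ℝ] V} (hL : ∀ v w, G (L v) w = G v (L w)) :
    ∃ (b : Module.Basis (Fin n) ℝ V) (μ : Fin n → ℝ), (∀ i, L (b i) = μ i • b i) ∧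
      (∀ i, G (b i) (b i) = 1) ∧ (∀ i j, i ≠ j → G (b i) (b j) = 0) ∧
      L.charpoly = ∏ i, (Polynomial.X - Polynomial.C (μ i)) := by
  let core : InnerProductSpace.Core ℝ V :=
    { inner := fun v w => G v w
      conj_inner_symm := fun v w => by simpa using hsymm w v
      re_inner_nonneg := fun v => by
        by_cases h : v = 0
        · simp [h]
        · simpa using (hpos v h).le
      add_left := fun u v w => by simp
      smul_left := fun u v c => by simp
      definite := fun v h => by
        by_contra hv
        exact (hpos v hv).ne' h }
  let _ : NormedAddCommGroup V := core.toNormedAddCommGroup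
  let _ : InnerProductSpace ℝ V := InnerProductSpace.ofCore core.toCore
  have hin : ∀ v w : V, inner ℝ v w = G v w := fun _ _ => rfl
  have hS : L.IsSymmetric := fun v w => hL v w
  refine ⟨(hS.eigenvectorBasis hn).toBasis, hS.eigenvalues hn, fun i => ?_, fun i => ?_, fun i j hij => ?_, ?_⟩
  · simp [hS.apply_eigenvectorBasis hn i]
  · rw [← hin, OrthonormalBasis.coe_toBasis, real_inner_self_eq_norm_sq,
      (hS.eigenvectorBasis hn).orthonormal.1 i, one_pow]
  · rw [← hin, OrthonormalBasis.coe_toBasis]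
    exact (hS.eigenvectorBasis hn).orthonormal.2 hij
  · rw [← L.charpoly_toMatrix (hS.eigenvectorBasis hn).toBasis, hS.toMatrix_eigenvectorBasis,
      Matrix.charpoly_diagonal]
    simp

/-- At a minimum the second derivative is nonnegative. -/
theorem hessian_nonneg {E : Type*} [NormedAddCommGroup E] [NormedSpace ℝ E] {W : Set E}
    (hW : IsOpen W) {ψ : E → ℝ} (hψ : ContDiffOn ℝ ∞ ψ W)
    {y : E} (hy : y ∈ W) (hmin : ∀ z ∈ W, ψ y ≤ ψ z) (v : E) :
    0 ≤ fderiv ℝ (fderiv ℝ ψ) y v v := by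
  by_contra! hneg
  have hline : Continuous fun t : ℝ => y + t • v := by fun_prop
  have hW' : ∀ᶠ t : ℝ in 𝓝 0, y + t • v ∈ W :=
    hline.continuousAt.eventually (hW.mem_nhds (by simpa using hy))
  have hl : ∀ t : ℝ, HasDerivAt (fun t : ℝ => y + t • v) v t := fun t => by
    simpa using ((hasDerivAt_id t).smul_const v).const_add y
  have hd : ∀ t : ℝ, y + t • v ∈ W → HasDerivAt (fun t : ℝ => ψ (y + t • v)) (fderiv ℝ ψ (y + t • v) v) t :=
    fun t ht => ((hψ.contDiffAt (hW.mem_nhds ht)).differentiableAt (by simp)).hasFDerivAt.comp_hasDerivAt t (hl t)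
  have hde : deriv (fun t : ℝ => ψ (y + t • v)) =ᶠ[𝓝 0] fun t => fderiv ℝ ψ (y + t • v) v :=
    hW'.mono fun t ht => (hd t ht).deriv
  have hdd : deriv (deriv (fun t : ℝ => ψ (y + t • v))) 0 = fderiv ℝ (fderiv ℝ ψ) y v v := by
    rw [hde.deriv_eq]
    have h2 : HasFDerivAt (fderiv ℝ ψ) (fderiv ℝ (fderiv ℝ ψ) y) (y + (0 : ℝ) • v) := by
      rw [zero_smul, add_zero]
      exact (((contDiffOn_fderiv_top hW hψ).contDiffAt (hW.mem_nhds hy)).differentiableAt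
        (by simp)).hasFDerivAt
    have h3 : HasDerivAt (fun t : ℝ => fderiv ℝ ψ (y + t • v)) (fderiv ℝ (fderiv ℝ ψ) y v) 0 :=
      h2.comp_hasDerivAt (0 : ℝ) (hl 0)
    have h4 := h3.clm_apply (hasDerivAt_const (0 : ℝ) v)
    simpa using h4.deriv
  have hmin0 : IsLocalMin (fun t : ℝ => ψ (y + t • v)) 0 :=
    hW'.mono fun t ht => by simpa using hmin _ ht
  -- A negative second derivative would give a local maximum as well. The function would then be
  -- locally constant on the line, with vanishing second derivative.
  have hmax := isLocalMax_of_deriv_deriv_neg (f := fun t : ℝ => ψ (y + t • v)) (x₀ := 0)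
    (by rw [hdd]; exact hneg) hmin0.deriv_eq_zero
    (hd 0 (by simpa using hy)).continuousAt
  have hconst : (fun t : ℝ => ψ (y + t • v)) =ᶠ[𝓝 0] fun _ => ψ (y + (0 : ℝ) • v) := by
    filter_upwards [hmin0, hmax] with t h1 h2 using le_antisymm h2 h1
  have h0 : deriv (fun t : ℝ => ψ (y + t • v)) =ᶠ[𝓝 0] fun _ => 0 := by
    filter_upwards [hconst.eventuallyEq_nhds] with t ht
    rw [ht.deriv_eq]; simp
  rw [h0.deriv_eq] at hdd
  simp at hdd
  linarith

/-- The linearisation of a gradient field at a minimum of the potential is diagonalisable with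
nonpositive eigenvalues. -/
theorem exists_eigenbasis_of_min {W : Set E3} (hW : IsOpen W) {G : E3 → E3 →L[ℝ] E3 →L[ℝ] ℝ}
    {Y : E3 → E3} {ψ : E3 → ℝ} (hG : ContDiffOn ℝ ∞ G W) (hY : ContDiffOn ℝ ∞ Y W)
    (hψ : ContDiffOn ℝ ∞ ψ W) (hGs : ∀ y v w, G y v w = G y w v)
    (hGp : ∀ y ∈ W, ∀ v, v ≠ 0 → 0 < G y v v)
    (hgrad : ∀ y ∈ W, ∀ w, G y (Y y) w = -fderiv ℝ ψ y w)
    {y : E3} (hy : y ∈ W) (hY0 : Y y = 0) (hmin : ∀ z ∈ W, ψ y ≤ ψ z) :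
    ∃ (b : Module.Basis (Fin 3) ℝ E3) (μ : Fin 3 → ℝ), (∀ i, fderiv ℝ Y y (b i) = μ i • b i) ∧
      (∀ i, μ i ≤ 0) ∧
      (∀ i, fderiv ℝ (fderiv ℝ ψ) y (b i) (b i) = -μ i) ∧
      (∀ i j, i ≠ j → fderiv ℝ (fderiv ℝ ψ) y (b i) (b j) = 0) ∧
      (fderiv ℝ Y y).toLinearMap.charpoly = ∏ i, (Polynomial.X - Polynomial.C (μ i)) := by
  have hlin := gradient_linearization hW hG hY hψ hgrad hy hY0
  have hsym := fderiv_fderiv_symm hW hψ hy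
  let G' : E3 →ₗ[ℝ] E3 →ₗ[ℝ] ℝ := LinearMap.mk₂ ℝ (fun v w => G y v w) (by simp) (by simp) (by simp) (by simp)
  obtain ⟨b, μ, h1, h2, h3, h4⟩ := exists_eigenbasis (V := E3) (n := 3) (by simp) (G := G')
    (fun v w => hGs y v w) (fun v hv => hGp y hy v hv) (L := (fderiv ℝ Y y).toLinearMap)
    (fun v w => by
      change G y (fderiv ℝ Y y v) w = G y v (fderiv ℝ Y y w)
      rw [hGs y v, hlin, hlin, hsym])
  replace h1 : ∀ i, fderiv ℝ Y y (b i) = μ i • b i := h1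
  replace h2 : ∀ i, G y (b i) (b i) = 1 := h2
  replace h3 : ∀ i j, i ≠ j → G y (b i) (b j) = 0 := h3
  have key : ∀ i j, fderiv ℝ (fderiv ℝ ψ) y (b i) (b j) = -(μ i * G y (b i) (b j)) := fun i j => by
    have := hlin (b i) (b j)
    rw [h1, map_smul, smul_apply, smul_eq_mul] at this
    linarith
  have k2 : ∀ i, fderiv ℝ (fderiv ℝ ψ) y (b i) (b i) = -μ i := fun i => by rw [key, h2, mul_one]
  refine ⟨b, μ, h1, fun i => ?_, k2, fun i j hij => by rw [key, h3 i j hij]; simp, h4⟩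
  have := hessian_nonneg hW hψ hy hmin (b i)
  rw [k2] at this
  linarith

end

section
/-! ### The sink circle -/

theorem eigenvalues_mem {n : ℕ} {q : Polynomial ℝ} {μ : Fin n → ℝ}
    (hq : q = ∏ i, (Polynomial.X - Polynomial.C (μ i))) {a b : ℂ}
    (h : q.map (algebraMap ℝ ℂ) =
      Polynomial.X * (Polynomial.X - Polynomial.C a) * (Polynomial.X - Polynomial.C b)) :
    (∃ i, a = μ i) ∧ ∃ i, b = μ i := by
  have key : ∀ z : ℂ, (q.map (algebraMap ℝ ℂ)).eval z = 0 → ∃ i, z = μ i := by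
    intro z hz
    rw [hq, Polynomial.map_prod, Polynomial.eval_prod, Finset.prod_eq_zero_iff] at hz
    obtain ⟨i, -, hi⟩ := hz
    exact ⟨i, by simpa [sub_eq_zero] using hi⟩
  exact ⟨key a (by rw [h]; simp), key b (by rw [h]; simp)⟩

variable {M : Type*} [TopologicalSpace M] [ChartedSpace E3 M] [IsManifold (𝓡 3) ∞ M]

omit [IsManifold (𝓡 3) ∞ M] in
theorem chartVec_apply {X : ∀ p : M, TangentSpace (𝓡 3) p} {e : OpenPartialHomeomorph M E3} {q : M}
    (hq : q ∈ e.source) : chartVec X e (e q) = dE e q (X q) := by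
  obtain ⟨y, hy, rfl⟩ : ∃ y ∈ e.target, e.symm y = q := ⟨e q, e.map_source hq, e.left_inv hq⟩
  unfold chartVec
  rw [e.right_inv hy]

omit [IsManifold (𝓡 3) ∞ M] in
theorem chartVec_eq_zero {X : ∀ p : M, TangentSpace (𝓡 3) p} {e : OpenPartialHomeomorph M E3} {p : M}
    (hp : p ∈ e.source) (h0 : X p = 0) : chartVec X e (e p) = 0 := by
  rw [chartVec_apply hp, h0, map_zero]

theorem linearization_eq {X : ∀ p : M, TangentSpace (𝓡 3) p}
    (hX : ContMDiff (𝓡 3) (𝓡 3).tangent ∞ (fun p : M => (⟨p, X p⟩ : TangentBundle (𝓡 3) M))) (p : M) :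
    linearization X p = fderiv ℝ (chartVec X (chartAt E3 p)) (chartAt E3 p p) := by
  set e := chartAt E3 p
  have he : e ∈ IsManifold.maximalAtlas (𝓡 3) ∞ M := IsManifold.chart_mem_maximalAtlas p
  have hp : p ∈ e.source := mem_chart_source E3 p
  have h1 : (fun q : M => (trivializationAt E3 (TangentSpace (𝓡 3) : M → Type) p
      (Bundle.TotalSpace.mk' E3 q (X q))).2) =ᶠ[𝓝 p] chartVec X e ∘ e := by
    filter_upwards [e.open_source.mem_nhds hp] with q hq
    have h2 := DFunLike.congr_fun
      (TangentBundle.continuousLinearMapAt_trivializationAt (I := 𝓡 3) (x₀ := p) (x := q) hq) (X q)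
    rw [Bundle.Trivialization.continuousLinearMapAt_apply,
      Bundle.Trivialization.linearMapAt_apply, if_pos (by simpa using hq)] at h2
    exact h2.trans (chartVec_apply hq).symm
  have h3 : MDifferentiableAt 𝓘(ℝ, E3) 𝓘(ℝ, E3) (chartVec X e) (e p) :=
    (((contDiffOn_chartVec he hX).contDiffAt (e.open_target.mem_nhds (e.map_source hp))).differentiableAt
      (by simp)).mdifferentiableAt
  have h4 : MDifferentiableAt (𝓡 3) 𝓘(ℝ, E3) e p := (mdifferentiable_of_mem he).mdifferentiableAt hp
  have h5 := mfderiv_comp p h3 h4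
  have h6 : mfderiv (𝓡 3) 𝓘(ℝ, E3) e p = ContinuousLinearMap.id ℝ _ :=
    mfderiv_extChartAt_self (I := 𝓡 3) (x := p)
  unfold linearization
  rw [h1.mfderiv_eq]
  refine h5.trans ?_
  rw [h6, mfderiv_eq_fderiv]
  rfl

/-- Differentiating the change of charts at a zero of `X` kills the second-derivative term, so the
two linearisations are conjugate by the differential of the transition map. -/
theorem charpoly_linearization {X : ∀ p : M, TangentSpace (𝓡 3) p}
    (hX : ContMDiff (𝓡 3) (𝓡 3).tangent ∞ (fun p : M => (⟨p, X p⟩ : TangentBundle (𝓡 3) M)))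
    {e : OpenPartialHomeomorph M E3} (he : e ∈ IsManifold.maximalAtlas (𝓡 3) ∞ M) {p : M}
    (hp : p ∈ e.source) (h0 : X p = 0) :
    (linearization X p).toLinearMap.charpoly = (fderiv ℝ (chartVec X e) (e p)).toLinearMap.charpoly := by
  rw [linearization_eq hX]
  set c := chartAt E3 p
  have hc : c ∈ IsManifold.maximalAtlas (𝓡 3) ∞ M := IsManifold.chart_mem_maximalAtlas p
  have hpc : p ∈ c.source := mem_chart_source E3 p
  have hU : IsOpen (e.target ∩ e.symm ⁻¹' c.source) := e.isOpen_inter_preimage_symm c.open_source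
  have hy : e p ∈ e.target ∩ e.symm ⁻¹' c.source :=
    ⟨e.map_source hp, by simpa [e.left_inv hp] using hpc⟩
  set τ := c ∘ e.symm with hτ
  have hτy : τ (e p) = c p := by simp [hτ, e.left_inv hp]
  have hτc := (contDiffOn_transition he hc).contDiffAt (hU.mem_nhds hy)
  have hτ1 : HasFDerivAt τ (fderiv ℝ τ (e p)) (e p) := (hτc.differentiableAt (by simp)).hasFDerivAt
  have hτ2 : DifferentiableAt ℝ (fderiv ℝ τ) (e p) :=
    (hτc.fderiv_right (m := 1) (by norm_cast)).differentiableAt one_ne_zero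
  have hXe := (((contDiffOn_chartVec he hX).contDiffAt
    (e.open_target.mem_nhds hy.1)).differentiableAt (by simp)).hasFDerivAt
  have hXc : HasFDerivAt (chartVec X c) (fderiv ℝ (chartVec X c) (c p)) (τ (e p)) := by
    rw [hτy]
    exact (((contDiffOn_chartVec hc hX).contDiffAt
      (c.open_target.mem_nhds (c.map_source hpc))).differentiableAt (by simp)).hasFDerivAt
  have hrel : chartVec X c ∘ τ =ᶠ[𝓝 (e p)] fun y => fderiv ℝ τ y (chartVec X e y) := by
    filter_upwards [hU.mem_nhds hy] with y hy
    have h1 := dE_transition he hc (e.map_target hy.1) hy.2 (X (e.symm y))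
    rw [e.right_inv hy.1] at h1
    exact (chartVec_apply hy.2).trans h1
  have hcomp := (hXc.comp (e p) hτ1).congr_of_eventuallyEq hrel.symm
  have hprod := hτ2.hasFDerivAt.clm_apply hXe
  rw [chartVec_eq_zero hp h0] at hprod
  have hLL := hcomp.unique hprod
  have key : ∀ v, fderiv ℝ (chartVec X c) (c p) (fderiv ℝ τ (e p) v) =
      fderiv ℝ τ (e p) (fderiv ℝ (chartVec X e) (e p) v) := fun v => by
    simpa using DFunLike.congr_fun hLL v
  have hbij : Function.Bijective (fderiv ℝ τ (e p)) := by
    have h1 := dE_bijective hc hpc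
    have h2 := dE_bijective he hp
    have h3 : dE c p = fun v => fderiv ℝ τ (e p) (dE e p v) :=
      funext fun v => dE_transition he hc hp hpc v
    refine ⟨fun v w hvw => ?_, fun w => ?_⟩
    · obtain ⟨v', rfl⟩ := h2.2 v
      obtain ⟨w', rfl⟩ := h2.2 w
      have h4 : v' = w' := h1.1 (by rw [h3]; exact hvw)
      rw [h4]
    · obtain ⟨v, hv⟩ := h1.2 w
      exact ⟨dE e p v, by rw [← hv]; exact (congrFun h3 v).symm⟩
  let T := LinearEquiv.ofBijective (fderiv ℝ τ (e p)).toLinearMap hbij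
  have hconj : (fderiv ℝ (chartVec X c) (c p)).toLinearMap =
      T.conj (fderiv ℝ (chartVec X e) (e p)).toLinearMap := by
    ext1 w
    obtain ⟨v, rfl⟩ := T.surjective w
    rw [LinearEquiv.conj_apply_apply, T.symm_apply_apply]
    exact key v
  rw [hconj, LinearEquiv.charpoly_conj]

/-- At a global minimum of the potential, in any chart, the linearisation is diagonalisable. -/
theorem exists_eigenbasis_chart
    {g : Bundle.ContMDiffRiemannianMetric (𝓡 3) ∞ E3 (TangentSpace (𝓡 3) : M → Type)}
    {X : ∀ p : M, TangentSpace (𝓡 3) p} {Ψ : M → ℝ} (hΨ : ContMDiff (𝓡 3) 𝓘(ℝ, ℝ) ∞ Ψ)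
    (hg : ∀ (p : M) (v : TangentSpace (𝓡 3) p), g.inner p (X p) v = -(mfderiv (𝓡 3) 𝓘(ℝ, ℝ) Ψ p v : ℝ))
    (hX : ContMDiff (𝓡 3) (𝓡 3).tangent ∞ (fun p : M => (⟨p, X p⟩ : TangentBundle (𝓡 3) M)))
    {e : OpenPartialHomeomorph M E3} (he : e ∈ IsManifold.maximalAtlas (𝓡 3) ∞ M) {p : M}
    (hp : p ∈ e.source) (h0 : X p = 0) (hmin : ∀ q, Ψ p ≤ Ψ q) :
    ∃ (b : Module.Basis (Fin 3) ℝ E3) (μ : Fin 3 → ℝ),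
      (∀ i, fderiv ℝ (chartVec X e) (e p) (b i) = μ i • b i) ∧
      (∀ i, μ i ≤ 0) ∧
      (∀ i, fderiv ℝ (fderiv ℝ (Ψ ∘ e.symm)) (e p) (b i) (b i) = -μ i) ∧
      (∀ i j, i ≠ j → fderiv ℝ (fderiv ℝ (Ψ ∘ e.symm)) (e p) (b i) (b j) = 0) ∧
      (linearization X p).toLinearMap.charpoly = ∏ i, (Polynomial.X - Polynomial.C (μ i)) := by
  rw [charpoly_linearization hX he hp h0]
  refine exists_eigenbasis_of_min e.open_target (contDiffOn_chartMetric g he) (contDiffOn_chartVec he hX)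
    (contDiffOn_chartFun he hΨ) (fun y v w => chartMetric_symm g y v w)
    (fun y hy v hv => chartMetric_pos g he hy hv) (fun y hy w => chart_gradient g he hΨ hg hy w)
    (e.map_source hp) (chartVec_eq_zero hp h0) fun z _ => ?_
  simp only [Function.comp, e.left_inv hp]
  exact hmin _

theorem gradient_eq_zero_iff
    {g : Bundle.ContMDiffRiemannianMetric (𝓡 3) ∞ E3 (TangentSpace (𝓡 3) : M → Type)}
    {X : ∀ p : M, TangentSpace (𝓡 3) p} {Ψ : M → ℝ}
    (hg : ∀ (p : M) (v : TangentSpace (𝓡 3) p), g.inner p (X p) v = -(mfderiv (𝓡 3) 𝓘(ℝ, ℝ) Ψ p v : ℝ))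
    (p : M) : X p = 0 ↔ mfderiv (𝓡 3) 𝓘(ℝ, ℝ) Ψ p = 0 := by
  constructor
  · intro h
    ext v
    have := hg p v
    rw [h, map_zero] at this
    exact neg_eq_zero.1 this.symm
  · intro h
    by_contra hne
    have h1 := g.pos p _ hne
    have h2 := hg p (X p)
    rw [h] at h2
    rw [h2] at h1
    exact lt_irrefl _ (h1.trans_eq neg_zero)

theorem gradient_eq_zero_of_min
    {g : Bundle.ContMDiffRiemannianMetric (𝓡 3) ∞ E3 (TangentSpace (𝓡 3) : M → Type)}
    {X : ∀ p : M, TangentSpace (𝓡 3) p} {Ψ : M → ℝ} (hΨ : ContMDiff (𝓡 3) 𝓘(ℝ, ℝ) ∞ Ψ)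
    (hg : ∀ (p : M) (v : TangentSpace (𝓡 3) p), g.inner p (X p) v = -(mfderiv (𝓡 3) 𝓘(ℝ, ℝ) Ψ p v : ℝ))
    {p : M} (hmin : ∀ q, Ψ p ≤ Ψ q) : X p = 0 := by
  rw [gradient_eq_zero_iff hg]
  set e := chartAt E3 p
  have he : e ∈ IsManifold.maximalAtlas (𝓡 3) ∞ M := IsManifold.chart_mem_maximalAtlas p
  have hp : p ∈ e.source := mem_chart_source E3 p
  have hz : fderiv ℝ (Ψ ∘ e.symm) (e p) = 0 := by
    refine IsLocalMin.fderiv_eq_zero (Eventually.of_forall fun y => ?_)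
    simp only [Function.comp, e.left_inv hp]
    exact hmin _
  ext v
  rw [← fderiv_chartFun he hΨ hp v, hz]
  rfl

/-- The differential of `Ψ` vanishes on the circle of zeros through a global minimum, so the entire
circle is at the minimal level. The Hessian is nonnegative there, so transverse eigenvalues are real
and at most `0`, which excludes both kinds of degeneracy. -/
theorem exists_sink_circle [CompactSpace M] [T2Space M] [Nonempty M]
    {ξ : ∀ p : M, Submodule ℝ (TangentSpace (𝓡 3) p)}
    {g : Bundle.ContMDiffRiemannianMetric (𝓡 3) ∞ E3 (TangentSpace (𝓡 3) : M → Type)}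
    {X : ∀ p : M, TangentSpace (𝓡 3) p} {Ψ : M → ℝ} (hΨ : ContMDiff (𝓡 3) 𝓘(ℝ, ℝ) ∞ Ψ)
    (hg : ∀ (p : M) (v : TangentSpace (𝓡 3) p), g.inner p (X p) v = -(mfderiv (𝓡 3) 𝓘(ℝ, ℝ) Ψ p v : ℝ))
    (hX : IsNondegenerateSection ξ X) :
    ∃ (γ : Circle → M) (m : ℝ) (N : Set M), Manifold.IsSmoothEmbedding (𝓡 1) (𝓡 3) ∞ γ ∧
      (∀ p ∈ range γ, X p = 0 ∧ IsTransverseSink X p ∧ Ψ p = m) ∧ (∀ q, m ≤ Ψ q) ∧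
      IsOpen N ∧ range γ ⊆ N ∧ ∀ q ∈ N, X q = 0 → q ∈ range γ := by
  obtain ⟨hXs, -, n, γ, hγ, hdisj, hfix, -, hdeg⟩ := hX
  obtain ⟨p₀, -, hp₀⟩ := isCompact_univ.exists_isMinOn univ_nonempty hΨ.continuous.continuousOn
  replace hp₀ : ∀ q, Ψ p₀ ≤ Ψ q := fun q => hp₀ (mem_univ q)
  have hX0 : X p₀ = 0 := gradient_eq_zero_of_min hΨ hg hp₀
  have hmem : p₀ ∈ ⋃ i, range (γ i) := by rw [hfix]; exact hX0
  obtain ⟨i, hi⟩ := mem_iUnion.1 hmem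
  have hzero : ∀ p ∈ range (γ i), X p = 0 := fun p hp => by
    have : p ∈ fixedPoints X := by rw [← hfix]; exact mem_iUnion.2 ⟨i, hp⟩
    exact this
  have hcirc : ∀ z : Circle, ∃ t : ℝ, Circle.exp t = z := fun z => ⟨_, Circle.exp_arg z⟩
  have hconst : ∀ p ∈ range (γ i), Ψ p = Ψ p₀ := by
    have hsm : ContMDiff 𝓘(ℝ, ℝ) (𝓡 3) ∞ (γ i ∘ Circle.exp) := (hγ i).contMDiff.comp contMDiff_circleExp
    have hd : ∀ t : ℝ, HasDerivAt (Ψ ∘ (γ i ∘ Circle.exp)) 0 t := by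
      intro t
      have h1 := mfderiv_comp (I := 𝓘(ℝ, ℝ)) (I' := 𝓡 3) (I'' := 𝓘(ℝ, ℝ))
        (f := γ i ∘ Circle.exp) (g := Ψ) t ((hΨ (γ i (Circle.exp t))).mdifferentiableAt (by simp))
        ((hsm t).mdifferentiableAt (by simp))
      have h3 := (gradient_eq_zero_iff hg (γ i (Circle.exp t))).1 (hzero _ (mem_range_self _))
      have hdiff : DifferentiableAt ℝ (Ψ ∘ (γ i ∘ Circle.exp)) t :=
        ((hΨ.comp hsm).contDiff.differentiable (by simp)) t
      have h2 : fderiv ℝ (Ψ ∘ (γ i ∘ Circle.exp)) t = 0 := by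
        rw [← mfderiv_eq_fderiv]
        refine h1.trans ?_
        ext
        exact DFunLike.congr_fun h3 _
      have := hdiff.hasFDerivAt
      rw [h2] at this
      simpa using this.hasDerivAt
    have hc := is_const_of_deriv_eq_zero (f := Ψ ∘ (γ i ∘ Circle.exp))
      (fun t => (hd t).differentiableAt) (fun t => (hd t).deriv)
    rintro _ ⟨z, rfl⟩
    obtain ⟨z₀, rfl⟩ := hi
    obtain ⟨t, rfl⟩ := hcirc z
    obtain ⟨t₀, rfl⟩ := hcirc z₀
    exact hc t t₀
  have eig : ∀ p ∈ range (γ i), ∀ a b : ℂ, HasTransverseEigenvalues X p a b →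
      (a.im = 0 ∧ a.re ≤ 0) ∧ (b.im = 0 ∧ b.re ≤ 0) := by
    intro p hp a b hab
    obtain ⟨-, μ, -, hμ, -, -, hchar⟩ := exists_eigenbasis_chart hΨ hg hXs
      (IsManifold.chart_mem_maximalAtlas (I := 𝓡 3) (n := ∞) p) (mem_chart_source E3 p) (hzero p hp)
      (fun q => (hconst p hp).trans_le (hp₀ q))
    obtain ⟨⟨i, rfl⟩, ⟨j, rfl⟩⟩ := eigenvalues_mem hchar hab
    simp [hμ]
  have hyp : ∀ p ∈ range (γ i), IsTransversallyHyperbolic X p := by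
    rintro _ ⟨z, rfl⟩
    obtain ⟨t, rfl⟩ := hcirc z
    by_contra hnot
    -- At a saddle-node the vanishing eigenvalue has a local maximum, so its derivative is zero. At
    -- a Hopf point the eigenvalues are not real.
    rcases hdeg i t hnot with ⟨a, b, hev, ha, -, a', ha', hd⟩ | ⟨a, b, hev, -, hb, -⟩
    · have hmax : IsLocalMax a t := by
        filter_upwards [hev] with s hs
        rw [ha]
        simpa using (eig _ (mem_range_self _) _ _ hs).1.2
      exact ha' (hmax.hasDerivAt_eq_zero hd)
    · have := (eig _ (mem_range_self _) _ _ hev.self_of_nhds).1.1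
      simp at this
      exact hb this
  -- The isolating neighbourhood is the complement of the other circles, a finite union of compact
  -- sets.
  refine ⟨γ i, Ψ p₀, (⋃ j ∈ {j | j ≠ i}, range (γ j))ᶜ, hγ i, fun p hp => ⟨hzero p hp, ?_, hconst p hp⟩,
    hp₀, ?_, ?_, ?_⟩
  · obtain ⟨a, b, hab, ha, hb⟩ := hyp p hp
    have := eig p hp a b hab
    exact ⟨a, b, hab, lt_of_le_of_ne this.1.2 ha, lt_of_le_of_ne this.2.2 hb⟩
  · rw [isOpen_compl_iff]
    exact (Set.toFinite {j | j ≠ i}).isClosed_biUnion fun j _ =>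
      (isCompact_range (hγ j).isEmbedding.continuous).isClosed
  · intro p hp hp'
    obtain ⟨j, hj, hpj⟩ := mem_iUnion₂.1 hp'
    exact (hdisj j i hj).le_bot ⟨hpj, hp⟩
  · intro q hq hq0
    have : q ∈ ⋃ i, range (γ i) := by rw [hfix]; exact hq0
    obtain ⟨j, hj⟩ := mem_iUnion.1 this
    by_cases h : j = i
    · exact h ▸ hj
    · exact absurd (mem_iUnion₂.2 ⟨j, h, hj⟩) hq

end

section
/-! ### Unit contact forms -/

theorem mem_contDiffGroupoid_E3 {σ : OpenPartialHomeomorph E3 E3} (h : ContDiffOn ℝ ∞ σ σ.source)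
    (h' : ContDiffOn ℝ ∞ σ.symm σ.target) : σ ∈ contDiffGroupoid ∞ (𝓡 3) := by
  rw [contDiffGroupoid, mem_groupoid_of_pregroupoid]
  simpa [contDiffPregroupoid] using ⟨h, h'⟩

/-- Used to shrink a chart to a ball and spread the ball over all of space, so that forms and fields
in the chart become globally smooth maps. -/
theorem exists_ball_chart (c : E3) {r : ℝ} (hr : 0 < r) :
    ∃ σ : OpenPartialHomeomorph E3 E3, σ.source = univ ∧ σ.target = Metric.ball c r ∧ σ.symm c = 0 ∧
      ContDiff ℝ ∞ σ ∧ ContDiffOn ℝ ∞ σ.symm σ.target ∧ ∀ x, Function.Surjective (fderiv ℝ σ x) := by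
  have hσt : (OpenPartialHomeomorph.univBall c r).target = Metric.ball c r :=
    OpenPartialHomeomorph.univBall_target _ hr
  have hσs : (OpenPartialHomeomorph.univBall c r).source = univ := OpenPartialHomeomorph.univBall_source _ _
  have hσ : ContDiff ℝ ∞ (OpenPartialHomeomorph.univBall c r) := OpenPartialHomeomorph.contDiff_univBall
  have hσ' : ContDiffOn ℝ ∞ (OpenPartialHomeomorph.univBall c r).symm (Metric.ball c r) :=
    OpenPartialHomeomorph.contDiffOn_univBall_symm
  have hσ0 := OpenPartialHomeomorph.univBall_symm_apply_center c r
  generalize OpenPartialHomeomorph.univBall c r = σ at *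
  rw [← hσt] at hσ'
  refine ⟨σ, hσs, hσt, hσ0, hσ, hσ', fun x w => ?_⟩
  have hx : σ x ∈ σ.target := σ.map_source (hσs ▸ mem_univ x)
  have h1 : HasFDerivAt σ.symm (fderiv ℝ σ.symm (σ x)) (σ x) :=
    ((hσ'.contDiffAt (σ.open_target.mem_nhds hx)).differentiableAt (by simp)).hasFDerivAt
  have h1' : DifferentiableAt ℝ σ (σ.symm (σ x)) := hσ.contDiffAt.differentiableAt (by simp)
  have h2 := h1'.hasFDerivAt.comp (σ x) h1
  have h3 : σ ∘ σ.symm =ᶠ[𝓝 (σ x)] id := by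
    filter_upwards [σ.open_target.mem_nhds hx] with y hy using σ.right_inv hy
  have h4 := (h2.congr_of_eventuallyEq h3.symm).unique (hasFDerivAt_id _)
  rw [σ.left_inv (hσs ▸ mem_univ x)] at h4
  exact ⟨_, DFunLike.congr_fun h4 w⟩

section
variable {M : Type*} [TopologicalSpace M] [ChartedSpace E3 M]

theorem trans_mem_maximalAtlas {e : OpenPartialHomeomorph M E3}
    (he : e ∈ IsManifold.maximalAtlas (𝓡 3) ∞ M) {σ : OpenPartialHomeomorph E3 E3}
    (hσ : σ ∈ contDiffGroupoid ∞ (𝓡 3)) : e.trans σ ∈ IsManifold.maximalAtlas (𝓡 3) ∞ M := by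
  intro e' he'
  obtain ⟨h1, h2⟩ := he e' he'
  rw [OpenPartialHomeomorph.trans_symm_eq_symm_trans_symm, OpenPartialHomeomorph.trans_assoc,
    ← OpenPartialHomeomorph.trans_assoc e'.symm]
  exact ⟨StructureGroupoid.trans _ (StructureGroupoid.symm _ hσ) h1, StructureGroupoid.trans _ h2 hσ⟩

/-- Contact forms can be transported to charts onto the whole space with small domains. -/
theorem IsContactStructure.exists_chart {ξ : ∀ p : M, Submodule ℝ (TangentSpace (𝓡 3) p)}
    (hξ : IsContactStructure ξ) (p : M) :
    ∃ e ∈ IsManifold.maximalAtlas (𝓡 3) ∞ M, p ∈ e.source ∧ e.target = univ ∧ e p = 0 ∧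
      ∃ α : E3 → (E3 →L[ℝ] ℝ), IsContactFormOn α univ ∧
        ∀ q ∈ e.source, ∀ v : TangentSpace (𝓡 3) q, v ∈ ξ q ↔ α (e q) (dE e q v) = 0 := by
  obtain ⟨e, he, hp, α, ⟨hα, hc⟩, hk⟩ := hξ p
  obtain ⟨r, hr, hball⟩ := Metric.isOpen_iff.1 e.open_target _ (e.map_source hp)
  obtain ⟨σ, hσs, hσt, hσ0, hσ, hσ', hsurj⟩ := exists_ball_chart (e p) hr
  have hσg : σ.symm ∈ contDiffGroupoid ∞ (𝓡 3) := mem_contDiffGroupoid_E3 hσ' hσ.contDiffOn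
  have hmem : ∀ x, σ x ∈ e.target := fun x => hball (hσt ▸ σ.map_source (hσs ▸ mem_univ x))
  have he' := trans_mem_maximalAtlas he hσg
  refine ⟨e.trans σ.symm, he', ?_, ?_, hσ0,
    pullForm σ α, ⟨?_, fun y _ => ?_⟩, fun q hq v => ?_⟩
  · rw [OpenPartialHomeomorph.trans_source]
    refine ⟨hp, ?_⟩
    simpa [hσt] using hr
  · rw [OpenPartialHomeomorph.trans_target]
    refine eq_univ_of_forall fun x => ⟨by simp [hσs], ?_⟩
    exact hmem x
  · have h1 : ContDiff ℝ ∞ (fun x => α (σ x)) :=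
      contDiffOn_univ.1 (hα.comp hσ.contDiffOn fun x _ => hmem x)
    exact (h1.clm_comp (hσ.fderiv_right (by simp))).contDiffOn
  · obtain ⟨u, v, w, h⟩ := hc _ (hmem y)
    obtain ⟨u, rfl⟩ := hsurj y u
    obtain ⟨v, rfl⟩ := hsurj y v
    obtain ⟨w, rfl⟩ := hsurj y w
    refine ⟨u, v, w, ?_⟩
    rw [wedgeD_pullForm (hσ.contDiffAt.of_le ENat.LEInfty.out)
      ((hα.contDiffAt (e.open_target.mem_nhds (hmem y))).differentiableAt (by simp))]
    exact h
  · have hq' := hq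
    rw [OpenPartialHomeomorph.trans_source] at hq
    have hqt : e q ∈ σ.target := hq.2
    have hσq : σ ((e.trans σ.symm) q) = e q := σ.right_inv hqt
    have h2 : dE e q v = fderiv ℝ σ ((e.trans σ.symm) q) (dE (e.trans σ.symm) q v) := by
      rw [dE_transition he' he hq' hq.1 v]
      congr 2
      exact funext fun x => e.right_inv (hmem x)
    rw [hk q hq.1]
    change α (e q) (dE e q v) = 0 ↔ α (σ ((e.trans σ.symm) q)) _ = 0
    rw [hσq, h2]
    rfl

end

variable {M : Type*} [TopologicalSpace M] [ChartedSpace E3 M] [IsManifold (𝓡 3) ∞ M]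

/-- `α` defines the plane field `ξ` in the chart `e`, which is onto, and has norm one. -/
structure IsUnitForm (g : Bundle.ContMDiffRiemannianMetric (𝓡 3) ∞ E3 (TangentSpace (𝓡 3) : M → Type))
    (ξ : ∀ p : M, Submodule ℝ (TangentSpace (𝓡 3) p)) (e : OpenPartialHomeomorph M E3)
    (α : E3 → (E3 →L[ℝ] ℝ)) : Prop where
  mem : e ∈ IsManifold.maximalAtlas (𝓡 3) ∞ M
  target : e.target = univ
  contDiff : ContDiff ℝ ∞ α
  contact : ∀ y, ∃ u v w : E3, wedgeD α y u v w ≠ 0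
  ker : ∀ q ∈ e.source, ∀ v : TangentSpace (𝓡 3) q, v ∈ ξ q ↔ α (e q) (dE e q v) = 0
  unit : ∀ y, ∃ n, chartMetric g e y n n = 1 ∧ α y = chartMetric g e y n

theorem contDiff_inverse {E F : Type*} [NormedAddCommGroup E] [NormedSpace ℝ E] [NormedAddCommGroup F]
    [NormedSpace ℝ F] [FiniteDimensional ℝ E] [FiniteDimensional ℝ F]
    (h : Module.finrank ℝ E = Module.finrank ℝ F) {D : Type*} [NormedAddCommGroup D] [NormedSpace ℝ D]
    {G : D → (E →L[ℝ] F)} (hG : ContDiff ℝ ∞ G) (hinj : ∀ y, Function.Injective (G y)) :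
    ContDiff ℝ ∞ (fun y => ContinuousLinearMap.inverse (G y)) ∧
      ∀ y w, G y (ContinuousLinearMap.inverse (G y) w) = w := by
  have : CompleteSpace E := FiniteDimensional.complete ℝ E
  have hex : ∀ y, ∃ A : E ≃L[ℝ] F, (A : E →L[ℝ] F) = G y := fun y =>
    ⟨(LinearEquiv.ofInjectiveOfFinrankEq (G y).toLinearMap (hinj y) h).toContinuousLinearEquiv, by ext; rfl⟩
  refine ⟨contDiff_iff_contDiffAt.2 fun y => ?_, fun y w => ?_⟩
  · obtain ⟨A, hA⟩ := hex y
    have := contDiffAt_map_inverse (n := ∞) A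
    rw [hA] at this
    exact this.comp y hG.contDiffAt
  · obtain ⟨A, hA⟩ := hex y
    rw [← hA, ContinuousLinearMap.inverse_equiv]
    simp

/-- With `n` the metric dual of a contact form and `N = α(n) > 0`, dividing the form by `√N` gives
it norm one. Rescaling by a nonvanishing function preserves the kernel and the contact condition. -/
theorem exists_unitForm (g : Bundle.ContMDiffRiemannianMetric (𝓡 3) ∞ E3 (TangentSpace (𝓡 3) : M → Type))
    {ξ : ∀ p : M, Submodule ℝ (TangentSpace (𝓡 3) p)} (hξ : IsContactStructure ξ) (p : M) :
    ∃ e α, IsUnitForm g ξ e α ∧ p ∈ e.source ∧ e p = 0 := by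
  obtain ⟨e, he, hp, het, hp0, α, ⟨hα, hc⟩, hk⟩ := hξ.exists_chart p
  rw [contDiffOn_univ] at hα
  have hG : ContDiff ℝ ∞ (chartMetric g e) := by
    have := contDiffOn_chartMetric g he
    rwa [het, contDiffOn_univ] at this
  have hpos : ∀ y v, v ≠ 0 → 0 < chartMetric g e y v v := fun y v hv =>
    chartMetric_pos g he (het ▸ mem_univ y) hv
  obtain ⟨hinv, hGinv⟩ := contDiff_inverse ((Subspace.dual_finrank_eq (K := ℝ) (V := E3)).symm.trans
    LinearMap.toContinuousLinearMap.finrank_eq) hG fun y => by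
    rw [injective_iff_map_eq_zero]
    intro v hv
    by_contra hne
    have := hpos y v hne
    rw [hv] at this
    exact lt_irrefl _ this
  set n := fun y => ContinuousLinearMap.inverse (chartMetric g e y) (α y) with hn
  have hns : ContDiff ℝ ∞ n := hinv.clm_apply hα
  have hGn : ∀ y, chartMetric g e y (n y) = α y := fun y => hGinv y (α y)
  have hα0 : ∀ y, α y ≠ 0 := fun y h => by
    obtain ⟨u, v, w, h'⟩ := hc y (mem_univ y)
    simp [wedgeD, h] at h'
  set N := fun y => α y (n y) with hN
  have hNs : ContDiff ℝ ∞ N := hα.clm_apply hns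
  have hNp : ∀ y, 0 < N y := fun y => by
    have h := hpos y (n y) fun h => hα0 y (by rw [← hGn, h, map_zero])
    rwa [hGn] at h
  set f := fun y => (Real.sqrt (N y))⁻¹ with hf
  have hfs : ContDiff ℝ ∞ f :=
    (hNs.sqrt fun y => (hNp y).ne').inv fun y => (Real.sqrt_pos.2 (hNp y)).ne'
  have hfp : ∀ y, 0 < f y := fun y => inv_pos.2 (Real.sqrt_pos.2 (hNp y))
  refine ⟨e, fun y => f y • α y, ⟨he, het, hfs.smul hα, fun y => ?_, fun q hq v => ?_, fun y => ?_⟩, hp, hp0⟩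
  · obtain ⟨u, v, w, h⟩ := hc y (mem_univ y)
    refine ⟨u, v, w, ?_⟩
    rw [wedgeD_smul (hfs.differentiable (by simp) y) (hα.differentiable (by simp) y)]
    exact mul_ne_zero (pow_ne_zero _ (hfp y).ne') h
  · rw [hk q hq]
    simp [(hfp _).ne']
  · refine ⟨f y • n y, ?_, ?_⟩
    · have h1 : chartMetric g e y (f y • n y) (f y • n y) = f y * (f y * N y) := by
        simp [hGn, hN]
      rw [h1, hf]
      have := Real.sq_sqrt (hNp y).le
      have h3 := (Real.sqrt_pos.2 (hNp y)).ne'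
      field_simp
      exact this.symm
    · rw [map_smul, hGn]

/-- Two covectors of norm one with the same kernel agree up to sign. -/
theorem eq_or_eq_neg_of_unit {E : Type*} [NormedAddCommGroup E] [NormedSpace ℝ E]
    {G : E →L[ℝ] E →L[ℝ] ℝ} (hpos : ∀ v, v ≠ 0 → 0 < G v v) (hsymm : ∀ v w, G v w = G w v)
    {a a' : E →L[ℝ] ℝ} (hk : ∀ v, a v = 0 ↔ a' v = 0) (h : ∃ n, G n n = 1 ∧ a = G n)
    (h' : ∃ n, G n n = 1 ∧ a' = G n) : a = a' ∨ a = -a' := by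
  obtain ⟨n, hn, rfl⟩ := h
  obtain ⟨n', hn', rfl⟩ := h'
  set c := G n n' with hc
  have h1 : G n (n' - c • n) = 0 := by rw [map_sub, map_smul, hn, ← hc]; simp
  have h2 := (hk _).1 h1
  have h3 : c * c = 1 := by
    have : G n' n = c := hsymm _ _
    rw [map_sub, map_smul, hn', this, smul_eq_mul] at h2
    linarith
  have h4 : n' = c • n := by
    by_contra hne
    have := hpos (n' - c • n) (sub_ne_zero.2 hne)
    simp only [map_sub, map_smul, sub_apply, smul_apply, smul_eq_mul, hn, hn'] at this
    rw [hsymm n' n, ← hc] at this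
    nlinarith
  rcases mul_self_eq_one_iff.1 h3 with h | h
  · left; rw [h4, h, one_smul]
  · right; rw [h4, h, map_smul]; ext; simp

/-- Unit forms of the same plane field in two charts agree near every point up to a sign. -/
theorem IsUnitForm.exists_sign
    {g : Bundle.ContMDiffRiemannianMetric (𝓡 3) ∞ E3 (TangentSpace (𝓡 3) : M → Type)}
    {ξ : ∀ p : M, Submodule ℝ (TangentSpace (𝓡 3) p)} {e e' : OpenPartialHomeomorph M E3}
    {α α' : E3 → (E3 →L[ℝ] ℝ)} (h : IsUnitForm g ξ e α) (h' : IsUnitForm g ξ e' α') {q : M}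
    (hq : q ∈ e.source) (hq' : q ∈ e'.source) :
    ∃ s : ℝ, (s = 1 ∨ s = -1) ∧ (∀ v, α (e q) (dE e q v) = s * α' (e' q) (dE e' q v)) ∧
      ∀ v w, dForm α (e q) (dE e q v) (dE e q w) = s * dForm α' (e' q) (dE e' q v) (dE e' q w) := by
  set τ := e' ∘ e.symm with hτ
  set W := e.target ∩ e.symm ⁻¹' e'.source
  have hW : IsOpen W := e.isOpen_inter_preimage_symm e'.open_source
  have hy : e q ∈ W := ⟨e.map_source hq, by simpa [e.left_inv hq] using hq'⟩
  have hτs : ContDiffOn ℝ ∞ τ W := contDiffOn_transition h.mem h'.mem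
  have hτq : τ (e q) = e' q := by simp [hτ, e.left_inv hq]
  set ρ := pullForm τ α' with hρ
  have hρs : ContDiffOn ℝ ∞ ρ W :=
    (h'.contDiff.comp_contDiffOn hτs).clm_comp (contDiffOn_fderiv_top hW hτs)
  have hpt : ∀ y ∈ W, α y = ρ y ∨ α y = -ρ y := by
    intro y hyW
    obtain ⟨x, hx, rfl⟩ : ∃ x ∈ e.source, e x = y := ⟨_, e.map_target hyW.1, e.right_inv hyW.1⟩
    have hx' : x ∈ e'.source := by simpa [e.left_inv hx] using hyW.2
    have hτx : τ (e x) = e' x := by simp [hτ, e.left_inv hx]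
    have hbij := dE_bijective h.mem hx
    have hbij' := dE_bijective h'.mem hx'
    have hρx : ∀ v, ρ (e x) (dE e x v) = α' (e' x) (dE e' x v) := fun v => by
      rw [dE_transition h.mem h'.mem hx hx' v, ← hτx]; rfl
    refine eq_or_eq_neg_of_unit (G := chartMetric g e (e x))
      (fun v hv => chartMetric_pos g h.mem (e.map_source hx) hv) (fun v w => chartMetric_symm g _ v w)
      (fun v => ?_) (h.unit _) ?_
    · obtain ⟨v, rfl⟩ := hbij.2 v
      rw [hρx, ← h.ker x hx, ← h'.ker x hx']
    · obtain ⟨n, hn1, hn2⟩ := h'.unit (e' x)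
      obtain ⟨n, rfl⟩ := hbij'.2 n
      refine ⟨dE e x n, ?_, ?_⟩
      · rw [chartMetric_dE g h.mem hx]
        rwa [chartMetric_dE g h'.mem hx'] at hn1
      · ext v
        obtain ⟨v, rfl⟩ := hbij.2 v
        rw [hρx, hn2, chartMetric_dE g h.mem hx, chartMetric_dE g h'.mem hx']
  have hα0 : α (e q) ≠ 0 := fun h0 => by
    obtain ⟨u, v, w, hne⟩ := h.contact (e q)
    simp [wedgeD, h0] at hne
  obtain ⟨v₀, hv₀⟩ : ∃ v, α (e q) v ≠ 0 := by
    by_contra! hcon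
    exact hα0 (ContinuousLinearMap.ext hcon)
  have hcα : ContinuousAt (fun y => α y v₀) (e q) :=
    (h.contDiff.continuous.clm_apply continuous_const).continuousAt
  have hcρ : ContinuousAt (fun y => ρ y v₀) (e q) :=
    ((hρs.continuousOn.continuousAt (hW.mem_nhds hy)).clm_apply continuousAt_const)
  -- Agreement of exterior derivatives needs equality of germs, so the pointwise sign must be
  -- locally constant. Continuity of both forms on a vector `v₀` where `α` is nonzero excludes the
  -- opposite sign nearby.
  have hsign : ∃ s : ℝ, (s = 1 ∨ s = -1) ∧ α =ᶠ[𝓝 (e q)] fun y => s • ρ y := by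
    rcases hpt _ hy with h0 | h0
    · refine ⟨1, Or.inl rfl, ?_⟩
      have : (fun y => α y v₀ + ρ y v₀) (e q) ≠ 0 := by
        change α (e q) v₀ + ρ (e q) v₀ ≠ 0
        rw [← h0]
        intro hz; apply hv₀; linarith
      filter_upwards [(hcα.add hcρ).eventually_ne this, hW.mem_nhds hy] with y h1 h2
      rcases hpt y h2 with h3 | h3
      · rw [h3, one_smul]
      · exact absurd (by change α y v₀ + ρ y v₀ = 0; rw [h3, neg_apply, neg_add_cancel]) h1
    · refine ⟨-1, Or.inr rfl, ?_⟩
      have : (fun y => α y v₀ - ρ y v₀) (e q) ≠ 0 := by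
        change α (e q) v₀ - ρ (e q) v₀ ≠ 0
        have : ρ (e q) = -α (e q) := by rw [h0, neg_neg]
        rw [this]
        intro hz; apply hv₀
        rw [neg_apply] at hz; linarith
      filter_upwards [(hcα.sub hcρ).eventually_ne this, hW.mem_nhds hy] with y h1 h2
      rcases hpt y h2 with h3 | h3
      · exact absurd (by change α y v₀ - ρ y v₀ = 0; rw [h3, sub_self]) h1
      · rw [h3]; ext; simp
  obtain ⟨s, hs, heq⟩ := hsign
  refine ⟨s, hs, fun v => ?_, fun v w => ?_⟩
  · rw [heq.eq_of_nhds, dE_transition h.mem h'.mem hq hq' v, ← hτq]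
    rfl
  · have hρd : DifferentiableAt ℝ ρ (e q) :=
      (hρs.contDiffAt (hW.mem_nhds hy)).differentiableAt (by simp)
    rw [dForm_congr heq, dForm_smul (differentiableAt_const s) hρd, hρ,
      dForm_pullForm ((hτs.contDiffAt (hW.mem_nhds hy)).of_le ENat.LEInfty.out)
        (h'.contDiff.differentiable (by simp) _), ← dE_transition h.mem h'.mem hq hq',
      ← dE_transition h.mem h'.mem hq hq', hτq]
    simp

/-- The plane field obtained by rotating the kernel of a unit form `α` towards the kernel of the
contraction of `dα` with `X`. -/
def rotPlane (X : ∀ p : M, TangentSpace (𝓡 3) p) (Θ : M → ℝ) (e : OpenPartialHomeomorph M E3)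
    (α : E3 → (E3 →L[ℝ] ℝ)) (q : M) : Submodule ℝ (TangentSpace (𝓡 3) q) :=
  Submodule.comap (dE e q).toLinearMap
    (LinearMap.ker (rotForm (Θ ∘ e.symm) α (contr α (chartVec X e)) (e q)).toLinearMap)

omit [IsManifold (𝓡 3) ∞ M] in
theorem mem_rotPlane {X : ∀ p : M, TangentSpace (𝓡 3) p} {Θ : M → ℝ} {e : OpenPartialHomeomorph M E3}
    {α : E3 → (E3 →L[ℝ] ℝ)} {q : M} (hq : q ∈ e.source) (v : TangentSpace (𝓡 3) q) :
    v ∈ rotPlane X Θ e α q ↔ Real.cos (Θ q) * α (e q) (dE e q v) +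
      Real.sin (Θ q) * dForm α (e q) (dE e q (X q)) (dE e q v) = 0 := by
  have h : v ∈ rotPlane X Θ e α q ↔
      rotForm (Θ ∘ e.symm) α (contr α (chartVec X e)) (e q) (dE e q v) = 0 := Iff.rfl
  rw [h, rotForm, add_apply, smul_apply, smul_apply, contr_apply, chartVec_apply hq, Function.comp,
    e.left_inv hq, smul_eq_mul, smul_eq_mul]

/-- Two unit forms differ locally by a sign, and their contractions with `X` by the same sign, so
the rotated kernel does not depend on the chart or the form. No orientation of `ξ` is needed. -/
theorem exists_rotated {g : Bundle.ContMDiffRiemannianMetric (𝓡 3) ∞ E3 (TangentSpace (𝓡 3) : M → Type)}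
    {ξ : ∀ p : M, Submodule ℝ (TangentSpace (𝓡 3) p)} (hξ : IsContactStructure ξ)
    (X : ∀ p : M, TangentSpace (𝓡 3) p) (hX : ∀ p, X p ∈ ξ p) (Θ : M → ℝ) :
    ∃ ξ' : ∀ p : M, Submodule ℝ (TangentSpace (𝓡 3) p),
      (∀ e α, IsUnitForm g ξ e α → ∀ q ∈ e.source, ξ' q = rotPlane X Θ e α q) ∧
      (∀ q, Real.sin (Θ q) = 0 → ξ' q = ξ q) ∧ ∀ q, X q ∈ ξ' q := by
  choose e α h hp _ using exists_unitForm g hξ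
  refine ⟨fun q => rotPlane X Θ (e q) (α q) q, fun e' α' h' q hq => ?_, fun q hs => ?_, fun q => ?_⟩
  · ext v
    rw [mem_rotPlane (hp q), mem_rotPlane hq]
    obtain ⟨s, hs, h1, h2⟩ := (h q).exists_sign h' (hp q) hq
    rw [h1, h2]
    rcases hs with rfl | rfl
    · simp
    · rw [← neg_eq_zero]; ring_nf
  · ext v
    rw [mem_rotPlane (hp q), hs, (h q).ker q (hp q)]
    have hc : Real.cos (Θ q) ≠ 0 := fun hc => by
      have := Real.sin_sq_add_cos_sq (Θ q)
      rw [hs, hc] at this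
      norm_num at this
    simp [hc]
  · rw [mem_rotPlane (hp q), ((h q).ker q (hp q) _).1 (hX q), dForm_self]
    simp

end

section
/-! ### The rotation profile -/

theorem hasDerivAt_expNegInvGlue {x : ℝ} (hx : 0 < x) :
    ∃ d, 0 < d ∧ HasDerivAt expNegInvGlue d x := by
  have h1 : HasDerivAt (fun x : ℝ => Real.exp (-x⁻¹)) (Real.exp (-x⁻¹) * (x ^ 2)⁻¹) x := by
    have := ((hasDerivAt_inv hx.ne').neg).exp
    simpa using this
  refine ⟨_, by positivity, h1.congr_of_eventuallyEq ?_⟩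
  filter_upwards [lt_mem_nhds hx] with y hy
  simp [expNegInvGlue, not_le.2 hy]

theorem hasDerivAt_smoothTransition {x : ℝ} (h0 : 0 < x) (h1 : x < 1) :
    ∃ d, 0 < d ∧ HasDerivAt Real.smoothTransition d x := by
  obtain ⟨d, hd, hd'⟩ := hasDerivAt_expNegInvGlue h0
  obtain ⟨e, he, he'⟩ := hasDerivAt_expNegInvGlue (sub_pos.2 h1)
  have he2 : HasDerivAt (fun x => expNegInvGlue (1 - x)) (-e) x := by
    simpa using he'.comp_const_sub 1 x
  have hpa := expNegInvGlue.pos_of_pos h0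
  have hpb := expNegInvGlue.pos_of_pos (sub_pos.2 h1)
  have hden : expNegInvGlue x + expNegInvGlue (1 - x) ≠ 0 := (add_pos hpa hpb).ne'
  refine ⟨_, ?_, hd'.div (hd'.add he2) hden⟩
  apply div_pos _ (by positivity)
  have : 0 < d * expNegInvGlue (1 - x) + expNegInvGlue x * e := by positivity
  linarith

/-- The rotation angle, decreasing from `π` to `0` on the unit interval. -/
def profile (t : ℝ) : ℝ := Real.pi * (1 - Real.smoothTransition t)

theorem contDiff_profile : ContDiff ℝ ∞ profile :=
  contDiff_const.mul (contDiff_const.sub Real.smoothTransition.contDiff)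

theorem profile_of_nonpos {t : ℝ} (h : t ≤ 0) : profile t = Real.pi := by
  simp [profile, Real.smoothTransition.zero_of_nonpos h]

theorem profile_of_one_le {t : ℝ} (h : 1 ≤ t) : profile t = 0 := by
  simp [profile, Real.smoothTransition.one_of_one_le h]

theorem deriv_profile_neg {t : ℝ} (h0 : 0 < t) (h1 : t < 1) : deriv profile t < 0 := by
  obtain ⟨d, hd, hd'⟩ := hasDerivAt_smoothTransition h0 h1
  have h := ((hd'.const_sub 1).const_mul Real.pi).deriv
  change deriv profile t = _ at h
  rw [h]
  have := mul_pos Real.pi_pos hd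
  linarith

theorem antitone_profile : Antitone profile := by
  refine antitone_of_deriv_nonpos (contDiff_profile.differentiable (by simp)) fun t => ?_
  rcases le_or_gt t 0 with h | h
  · refine le_of_eq (IsLocalMax.deriv_eq_zero (Eventually.of_forall fun s => ?_))
    rw [profile_of_nonpos h]
    simp only [profile]
    nlinarith [Real.pi_pos, Real.smoothTransition.nonneg s]
  rcases lt_or_ge t 1 with h' | h'
  · exact (deriv_profile_neg h h').le
  · refine le_of_eq (IsLocalMin.deriv_eq_zero (Eventually.of_forall fun s => ?_))
    rw [profile_of_one_le h']
    simp only [profile]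
    nlinarith [Real.pi_pos, Real.smoothTransition.le_one s]

/-- Fast rotation dominates bounded error terms. -/
theorem exists_rotation_speed {C : ℝ} (hC : 0 < C) : ∃ η₀ > 0, ∀ η, 0 < η → η ≤ η₀ → ∀ t x,
    1 ≤ C * (-x) → 0 < deriv profile t / η * x + Real.cos (profile t) ^ 2
      - C * (|Real.cos (profile t) * Real.sin (profile t)| + Real.sin (profile t) ^ 2) := by
  -- Two regimes. If `|sin| < δ`, then `cos²` alone beats the errors. On the compact set where
  -- `|sin| ≥ δ`, the profile has slope at most `-c < 0`, and the bound on `η` raises the first term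
  -- to `2 * C + 1`, above the total error `2 * C`.
  set δ := 1 / (2 * (C + 1)) with hδ
  have hδ0 : 0 < δ := by positivity
  have hδC : δ * (C + 1) = 1 / 2 := by rw [hδ]; field_simp
  set S := {t : ℝ | t ∈ Icc (0 : ℝ) 1 ∧ δ ≤ |Real.sin (profile t)|} with hS
  have hcont : Continuous fun t => |Real.sin (profile t)| :=
    (Real.continuous_sin.comp contDiff_profile.continuous).abs
  have hSc : IsCompact S := isCompact_Icc.inter_right (isClosed_le continuous_const hcont)
  have hSlt : ∀ t ∈ S, 0 < -deriv profile t := by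
    rintro t ⟨⟨h0, h1⟩, h2⟩
    have h0' : t ≠ 0 := by
      rintro rfl
      rw [profile_of_nonpos le_rfl] at h2
      simp at h2
      linarith
    have h1' : t ≠ 1 := by
      rintro rfl
      rw [profile_of_one_le le_rfl] at h2
      simp at h2
      linarith
    exact neg_pos.2 (deriv_profile_neg (lt_of_le_of_ne h0 h0'.symm) (lt_of_le_of_ne h1 h1'))
  obtain ⟨c, hc, hcS⟩ : ∃ c > 0, ∀ t ∈ S, c ≤ -deriv profile t := by
    rcases S.eq_empty_or_nonempty with h | h
    · exact ⟨1, one_pos, by simp [h]⟩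
    · obtain ⟨t₀, ht₀, hmin⟩ := hSc.exists_isMinOn h
        ((contDiff_profile.continuous_deriv (by simp)).neg.continuousOn)
      exact ⟨_, hSlt t₀ ht₀, fun t ht => hmin ht⟩
  refine ⟨c / (C * (2 * C + 1)), by positivity, fun η hη hη' t x hx => ?_⟩
  have hx0 : x < 0 := by
    by_contra! h
    nlinarith
  have hG : 0 ≤ deriv profile t / η * x :=
    mul_nonneg_of_nonpos_of_nonpos (div_nonpos_of_nonpos_of_nonneg (antitone_profile.deriv_nonpos) hη.le) hx0.le
  have hsc := Real.sin_sq_add_cos_sq (profile t)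
  rcases lt_or_ge |Real.sin (profile t)| δ with h | h
  · have h1 : |Real.cos (profile t) * Real.sin (profile t)| ≤ δ := by
      rw [abs_mul]
      nlinarith [Real.abs_cos_le_one (profile t), abs_nonneg (Real.sin (profile t)),
        abs_nonneg (Real.cos (profile t))]
    have h2 : Real.sin (profile t) ^ 2 ≤ δ * δ := by
      rw [← sq_abs]; nlinarith [abs_nonneg (Real.sin (profile t))]
    have h3 : δ ≤ 1 / 2 := by nlinarith
    nlinarith [mul_le_mul_of_nonneg_left h1 hC.le, mul_le_mul_of_nonneg_left h2 (by linarith : 0 ≤ C + 1)]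
  · have htS : t ∈ S := by
      refine ⟨⟨?_, ?_⟩, h⟩
      · by_contra! h0
        rw [profile_of_nonpos h0.le] at h
        simp at h
        linarith
      · by_contra! h0
        rw [profile_of_one_le h0.le] at h
        simp at h
        linarith
    have h1 : |Real.cos (profile t) * Real.sin (profile t)| ≤ 1 := by
      rw [abs_mul]
      exact mul_le_one₀ (Real.abs_cos_le_one _) (abs_nonneg _) (Real.abs_sin_le_one _)
    have h2 : Real.sin (profile t) ^ 2 ≤ 1 := Real.sin_sq_le_one _
    have h3 : 2 * C + 1 ≤ deriv profile t / η * x := by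
      have h4 : deriv profile t / η * x = (-deriv profile t) * (-x) / η := by ring
      rw [h4, le_div_iff₀ hη]
      rw [le_div_iff₀ (by positivity)] at hη'
      have h5 := hcS t htS
      have h6 : c * (1 : ℝ) ≤ (-deriv profile t) * (C * (-x)) :=
        mul_le_mul h5 hx zero_le_one (hc.le.trans h5)
      have h7 : C * ((2 * C + 1) * η) ≤ C * (-deriv profile t * -x) := by nlinarith
      exact le_of_mul_le_mul_left h7 hC
    nlinarith [mul_le_mul_of_nonneg_left h1 hC.le, mul_le_mul_of_nonneg_left h2 hC.le, sq_nonneg (Real.cos (profile t))]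

/-! ### The rotated plane field is a contact structure -/

section
variable {M : Type*} [TopologicalSpace M] [ChartedSpace E3 M]

/-- Nonvanishing of `α ∧ dα` on a fixed triple of vectors is an open condition, so it suffices to
check it at the point itself and restrict the chart. -/
theorem isContactStructure_of_local {ξ : ∀ p : M, Submodule ℝ (TangentSpace (𝓡 3) p)}
    (h : ∀ p, ∃ e ∈ IsManifold.maximalAtlas (𝓡 3) ∞ M, p ∈ e.source ∧
      ∃ (α : E3 → (E3 →L[ℝ] ℝ)) (W : Set E3), IsOpen W ∧ W ⊆ e.target ∧ e p ∈ W ∧ ContDiffOn ℝ ∞ α W ∧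
        (∃ u v w, wedgeD α (e p) u v w ≠ 0) ∧
        ∀ q ∈ e.source, e q ∈ W → ∀ v : TangentSpace (𝓡 3) q, v ∈ ξ q ↔ α (e q) (dE e q v) = 0) :
    IsContactStructure ξ := by
  intro p
  obtain ⟨e, he, hp, α, W, hW, hWe, hpW, hα, ⟨u, v, w, hne⟩, hk⟩ := h p
  have hα' := contDiffOn_fderiv_top hW hα
  have hcw : ContinuousOn (fun y => wedgeD α y u v w) W := by
    have c1 : ∀ a, ContinuousOn (fun y => α y a) W := fun a => hα.continuousOn.clm_apply continuousOn_const
    have c2 : ∀ a b, ContinuousOn (fun y => dForm α y a b) W := fun a b =>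
      ((hα'.continuousOn.clm_apply continuousOn_const).clm_apply continuousOn_const).sub
        ((hα'.continuousOn.clm_apply continuousOn_const).clm_apply continuousOn_const)
    exact (((c1 u).mul (c2 v w)).add ((c1 v).mul (c2 w u))).add ((c1 w).mul (c2 u v))
  set W' := W ∩ (fun y => wedgeD α y u v w) ⁻¹' {0}ᶜ with hW'
  have hW'o : IsOpen W' := hcw.isOpen_inter_preimage hW isOpen_compl_singleton
  have he' := trans_mem_maximalAtlas he (ofSet_mem_contDiffGroupoid (n := ∞) (I := 𝓡 3) hW'o)
  have ht : (e.trans (OpenPartialHomeomorph.ofSet W' hW'o)).target ⊆ W' := by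
    rw [OpenPartialHomeomorph.trans_target]
    exact inter_subset_left
  have hs : ∀ q, q ∈ (e.trans (OpenPartialHomeomorph.ofSet W' hW'o)).source ↔ q ∈ e.source ∧ e q ∈ W' := by
    intro q
    rw [OpenPartialHomeomorph.trans_source]
    rfl
  refine ⟨_, he', (hs p).2 ⟨hp, hpW, hne⟩, α, ⟨hα.mono (ht.trans inter_subset_left),
    fun y hy => ⟨u, v, w, (ht hy).2⟩⟩, fun q hq v => ?_⟩
  exact hk q ((hs q).1 hq).1 ((hs q).1 hq).2.1 v

end

variable {M : Type*} [TopologicalSpace M] [ChartedSpace E3 M] [IsManifold (𝓡 3) ∞ M]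

/-- Bounds at a point for the error terms of the contact condition of the rotated plane field. -/
def HasRotationBound (g : Bundle.ContMDiffRiemannianMetric (𝓡 3) ∞ E3 (TangentSpace (𝓡 3) : M → Type))
    (ξ : ∀ p : M, Submodule ℝ (TangentSpace (𝓡 3) p)) (X : ∀ p : M, TangentSpace (𝓡 3) p) (Ψ : M → ℝ)
    (C : ℝ) (q : M) : Prop :=
  ∃ e α, IsUnitForm g ξ e α ∧ q ∈ e.source ∧
    1 ≤ C * (-fderiv ℝ (Ψ ∘ e.symm) (e q) (chartVec X e (e q))) ∧
    ∃ v w, wedge (α (e q)) (contr α (chartVec X e) (e q)) v w ≠ 0 ∧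
      |wedge (α (e q)) (contr (contr α (chartVec X e)) (chartVec X e) (e q)) v w| ≤
        C * |wedge (α (e q)) (contr α (chartVec X e) (e q)) v w| ∧
      |wedge (contr α (chartVec X e) (e q)) (contr (contr α (chartVec X e)) (chartVec X e) (e q)) v w| ≤
        C * |wedge (α (e q)) (contr α (chartVec X e) (e q)) v w|

variable {g : Bundle.ContMDiffRiemannianMetric (𝓡 3) ∞ E3 (TangentSpace (𝓡 3) : M → Type)}
  {ξ : ∀ p : M, Submodule ℝ (TangentSpace (𝓡 3) p)} {X : ∀ p : M, TangentSpace (𝓡 3) p} {Ψ : M → ℝ}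

theorem HasRotationBound.mono {C C' : ℝ} (hC : 0 ≤ C) (h : C ≤ C') {q : M}
    (hq : HasRotationBound g ξ X Ψ C q) : HasRotationBound g ξ X Ψ C' q := by
  obtain ⟨e, α, h1, h2, h3, v, w, h4, h5, h6⟩ := hq
  refine ⟨e, α, h1, h2, h3.trans ?_, v, w, h4, h5.trans ?_, h6.trans ?_⟩
  · refine mul_le_mul_of_nonneg_right h ?_
    by_contra! hneg
    nlinarith
  all_goals exact mul_le_mul_of_nonneg_right h (abs_nonneg _)

/-- At a nonzero of `X` one has `-dΨ(X) = |X|² > 0`, and `α ∧ β` is nonzero on some pair `v, w`. The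
required inequalities, taken strict at `p`, persist nearby with the same chart, form and pair. -/
theorem exists_local_rotationBound (hξ : IsContactStructure ξ) (hΨ : ContMDiff (𝓡 3) 𝓘(ℝ, ℝ) ∞ Ψ)
    (hg : ∀ (p : M) (v : TangentSpace (𝓡 3) p), g.inner p (X p) v = -(mfderiv (𝓡 3) 𝓘(ℝ, ℝ) Ψ p v : ℝ))
    (hX : ContMDiff (𝓡 3) (𝓡 3).tangent ∞ (fun p : M => (⟨p, X p⟩ : TangentBundle (𝓡 3) M)))
    (hXξ : ∀ p, X p ∈ ξ p) {p : M} (hp : X p ≠ 0) :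
    ∃ C > 0, ∀ᶠ q in 𝓝 p, HasRotationBound g ξ X Ψ C q := by
  obtain ⟨e, α, h, hpe, -⟩ := exists_unitForm g hξ p
  set Y := chartVec X e with hY
  have hYs : ContDiff ℝ ∞ Y := by
    have := contDiffOn_chartVec h.mem hX
    rwa [h.target, contDiffOn_univ] at this
  have hΨs : ContDiff ℝ ∞ (Ψ ∘ e.symm) := by
    have := contDiffOn_chartFun h.mem hΨ
    rwa [h.target, contDiffOn_univ] at this
  have hβ : ContDiff ℝ ∞ (contr α Y) :=
    contDiffOn_univ.1 (contDiffOn_contr isOpen_univ h.contDiff.contDiffOn hYs.contDiffOn)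
  have hκ : ContDiff ℝ ∞ (contr (contr α Y) Y) :=
    contDiffOn_univ.1 (contDiffOn_contr isOpen_univ hβ.contDiffOn hYs.contDiffOn)
  have hY0 : Y (e p) ≠ 0 := by
    rw [hY, chartVec_apply hpe]
    intro h0
    exact hp ((dE_bijective h.mem hpe).1 (h0.trans (map_zero _).symm))
  have hαY : α (e p) (Y (e p)) = 0 := by
    rw [hY, chartVec_apply hpe]
    exact (h.ker p hpe _).1 (hXξ p)
  obtain ⟨v, w, hvw⟩ := exists_wedge_contr_ne_zero (h.contact (e p)) hY0 hαY
  have hneg : 0 < -fderiv ℝ (Ψ ∘ e.symm) (e p) (Y (e p)) := by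
    rw [← chart_gradient g h.mem hΨ hg (e.map_source hpe)]
    exact chartMetric_pos g h.mem (e.map_source hpe) hY0
  have wc : ∀ {σ τ : E3 → (E3 →L[ℝ] ℝ)}, ContDiff ℝ ∞ σ → ContDiff ℝ ∞ τ →
      Continuous fun y => |wedge (σ y) (τ y) v w| := fun hσ hτ =>
    (((hσ.continuous.clm_apply continuous_const).mul (hτ.continuous.clm_apply continuous_const)).sub
      ((hσ.continuous.clm_apply continuous_const).mul (hτ.continuous.clm_apply continuous_const))).abs
  have hA := wc h.contDiff hβ
  have hB := wc h.contDiff hκ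
  have hD := wc hβ hκ
  have hZ : Continuous fun y => -fderiv ℝ (Ψ ∘ e.symm) y (Y y) :=
    ((hΨs.continuous_fderiv (by simp)).clm_apply hYs.continuous).neg
  have hA0 := abs_pos.2 hvw
  set z := -fderiv ℝ (Ψ ∘ e.symm) (e p) (Y (e p))
  set A := |wedge (α (e p)) (contr α Y (e p)) v w|
  set B := |wedge (α (e p)) (contr (contr α Y) Y (e p)) v w| with hBe
  set D := |wedge (contr α Y (e p)) (contr (contr α Y) Y (e p)) v w| with hDe
  have hB0 : 0 ≤ B := abs_nonneg _
  have hD0 : 0 ≤ D := abs_nonneg _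
  obtain ⟨C, hC0, hC1, hC2, hC3⟩ : ∃ C > 0, 1 < C * z ∧ B < C * A ∧ D < C * A := by
    refine ⟨2 / z + (B + D + 1) / A, by positivity, ?_, ?_, ?_⟩
    · have : 0 ≤ (B + D + 1) / A * z := by positivity
      have h2 : 2 / z * z = 2 := by field_simp
      nlinarith
    all_goals
      have : 0 ≤ 2 / z * A := by positivity
      have h2 : (B + D + 1) / A * A = B + D + 1 := by field_simp
      nlinarith
  have hce : ContinuousAt e p := e.continuousAt hpe
  refine ⟨C, hC0, ?_⟩
  filter_upwards [e.open_source.mem_nhds hpe,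
    hce.eventually (((continuous_const.mul hZ).continuousAt).eventually (lt_mem_nhds hC1)),
    hce.eventually (hA.continuousAt.eventually (lt_mem_nhds hA0)),
    hce.eventually ((hB.continuousAt.prodMk (continuous_const.mul hA).continuousAt).eventually
      ((isOpen_lt continuous_fst continuous_snd).mem_nhds (x := (B, C * A)) hC2)),
    hce.eventually ((hD.continuousAt.prodMk (continuous_const.mul hA).continuousAt).eventually
      ((isOpen_lt continuous_fst continuous_snd).mem_nhds (x := (D, C * A)) hC3))] with q h1 h2 h3 h4 h5
  exact ⟨e, α, h, h1, h2.le, v, w, abs_pos.1 h3, le_of_lt h4, le_of_lt h5⟩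

/-- Charts and vectors may vary with the point; only the constant must be uniform. It can be
enlarged freely, so finite covers suffice. -/
theorem exists_rotationBound (hξ : IsContactStructure ξ) (hΨ : ContMDiff (𝓡 3) 𝓘(ℝ, ℝ) ∞ Ψ)
    (hg : ∀ (p : M) (v : TangentSpace (𝓡 3) p), g.inner p (X p) v = -(mfderiv (𝓡 3) 𝓘(ℝ, ℝ) Ψ p v : ℝ))
    (hX : ContMDiff (𝓡 3) (𝓡 3).tangent ∞ (fun p : M => (⟨p, X p⟩ : TangentBundle (𝓡 3) M)))
    (hXξ : ∀ p, X p ∈ ξ p) {K : Set M} (hK : IsCompact K) (hK0 : ∀ p ∈ K, X p ≠ 0) :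
    ∃ C > 0, ∀ q ∈ K, HasRotationBound g ξ X Ψ C q := by
  refine hK.induction_on (p := fun S => ∃ C > 0, ∀ q ∈ S, HasRotationBound g ξ X Ψ C q)
    ⟨1, one_pos, by simp⟩ ?_ ?_ ?_
  · rintro S T hST ⟨C, hC, h⟩
    exact ⟨C, hC, fun q hq => h q (hST hq)⟩
  · rintro S T ⟨C, hC, h⟩ ⟨C', hC', h'⟩
    refine ⟨max C C', lt_max_of_lt_left hC, ?_⟩
    rintro q (hq | hq)
    · exact (h q hq).mono hC.le (le_max_left _ _)
    · exact (h' q hq).mono hC'.le (le_max_right _ _)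
  · intro p hp
    obtain ⟨C, hC, h⟩ := exists_local_rotationBound hξ hΨ hg hX hXξ (hK0 p hp)
    exact ⟨_, mem_nhdsWithin_of_mem_nhds h, C, hC, fun q hq => hq⟩

open Classical in
/-- The rotation angle: a function of the potential on `N`, and zero elsewhere. -/
def rotAngle (Ψ : M → ℝ) (N : Set M) (c η : ℝ) (p : M) : ℝ :=
  if p ∈ N then profile ((Ψ p - c) / η) else 0

/-- Away from `N ∩ {c ≤ Ψ}` the angle is locally a multiple of `π` and the plane field is unchanged.
The cut-off at the frontier of `N` creates no jump, because the profile is already zero there. On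
the compact remainder `X ≠ 0`, and fast rotation gives the contact condition. -/
theorem exists_contact_rotated (hξ : IsContactStructure ξ) (hΨ : ContMDiff (𝓡 3) 𝓘(ℝ, ℝ) ∞ Ψ)
    (hg : ∀ (p : M) (v : TangentSpace (𝓡 3) p), g.inner p (X p) v = -(mfderiv (𝓡 3) 𝓘(ℝ, ℝ) Ψ p v : ℝ))
    (hX : ContMDiff (𝓡 3) (𝓡 3).tangent ∞ (fun p : M => (⟨p, X p⟩ : TangentBundle (𝓡 3) M)))
    (hXξ : ∀ p, X p ∈ ξ p) [CompactSpace M] {N : Set M} (hN : IsOpen N) {c d : ℝ} (hcd : c < d)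
    (hfr : ∀ p ∈ closure N, p ∉ N → d ≤ Ψ p) (hN0 : ∀ p ∈ closure N, c ≤ Ψ p → X p ≠ 0) :
    ∃ η > 0, c + η < d ∧ ∀ ξ' : ∀ p : M, Submodule ℝ (TangentSpace (𝓡 3) p),
      (∀ e α, IsUnitForm g ξ e α → ∀ q ∈ e.source, ξ' q = rotPlane X (rotAngle Ψ N c η) e α q) →
      (∀ q, Real.sin (rotAngle Ψ N c η q) = 0 → ξ' q = ξ q) → IsContactStructure ξ' := by
  have hK : IsCompact (closure N ∩ {p | c ≤ Ψ p}) :=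
    (isClosed_closure.inter (isClosed_le continuous_const hΨ.continuous)).isCompact
  obtain ⟨C, hC, hbound⟩ := exists_rotationBound hξ hΨ hg hX hXξ hK fun p hp => hN0 p hp.1 hp.2
  obtain ⟨η₀, hη₀, hspeed⟩ := exists_rotation_speed hC
  -- The second bound completes the rotation strictly below the level `d`, hence before the frontier
  -- of `N`.
  set η := min η₀ ((d - c) / 2) with hη
  have hη0 : 0 < η := lt_min hη₀ (by linarith)
  have hηd : c + η < d := by have := min_le_right η₀ ((d - c) / 2); linarith
  refine ⟨η, hη0, hηd, fun ξ' hrot hsame => isContactStructure_of_local fun p => ?_⟩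
  set Θ := rotAngle Ψ N c η with hΘ
  have key : (∀ᶠ q in 𝓝 p, Real.sin (Θ q) = 0) ∨ (p ∈ N ∧ c ≤ Ψ p) := by
    by_cases hpc : p ∈ closure N
    · by_cases hpN : p ∈ N
      · rcases lt_or_ge (Ψ p) c with h | h
        · left
          filter_upwards [hN.mem_nhds hpN, hΨ.continuous.continuousAt.eventually (gt_mem_nhds h)] with q h1 h2
          have : (Ψ q - c) / η ≤ 0 := div_nonpos_of_nonpos_of_nonneg (by linarith) hη0.le
          rw [hΘ, rotAngle, if_pos h1, profile_of_nonpos this, Real.sin_pi]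
        · exact Or.inr ⟨hpN, h⟩
      · left
        filter_upwards [hΨ.continuous.continuousAt.eventually
          (lt_mem_nhds (hηd.trans_le (hfr p hpc hpN)))] with q h2
        rw [hΘ, rotAngle]
        split_ifs
        · rw [profile_of_one_le ((one_le_div hη0).2 (by linarith)), Real.sin_zero]
        · exact Real.sin_zero
    · left
      filter_upwards [isClosed_closure.isOpen_compl.mem_nhds hpc] with q hq
      rw [hΘ, rotAngle, if_neg fun h => hq (subset_closure h), Real.sin_zero]
  rcases key with h | ⟨hpN, hpc⟩
  · obtain ⟨e, α, hu, hp, -⟩ := exists_unitForm g hξ p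
    obtain ⟨O, hO, hOo, hpO⟩ := mem_nhds_iff.1 h
    have hW : IsOpen (e.target ∩ e.symm ⁻¹' O) := e.isOpen_inter_preimage_symm hOo
    refine ⟨e, hu.mem, hp, α, _, hW, inter_subset_left, ⟨e.map_source hp, by simpa [e.left_inv hp]⟩,
      hu.contDiff.contDiffOn, hu.contact _, fun q hq hqW v => ?_⟩
    have hqO : q ∈ O := by simpa [e.left_inv hq] using hqW.2
    rw [hsame q (hO hqO), hu.ker q hq]
  · obtain ⟨e, α, hu, hp, hz, v, w, hA, hB, hD⟩ := hbound p ⟨subset_closure hpN, hpc⟩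
    have hW : IsOpen (e.target ∩ e.symm ⁻¹' N) := e.isOpen_inter_preimage_symm hN
    have hpW : e p ∈ e.target ∩ e.symm ⁻¹' N := ⟨e.map_source hp, by simpa [e.left_inv hp]⟩
    set ψ := Ψ ∘ e.symm with hψ
    have hψs : ContDiffOn ℝ ∞ ψ e.target := contDiffOn_chartFun hu.mem hΨ
    have hΘe : EqOn (Θ ∘ e.symm) (fun y => profile ((ψ y - c) / η)) (e.target ∩ e.symm ⁻¹' N) := by
      intro y hy
      exact if_pos hy.2
    have hΘs : ContDiffOn ℝ ∞ (Θ ∘ e.symm) (e.target ∩ e.symm ⁻¹' N) :=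
      ContDiffOn.congr (contDiff_profile.comp_contDiffOn
        (((hψs.mono inter_subset_left).sub contDiffOn_const).div_const η)) hΘe
    have hYs := contDiffOn_chartVec hu.mem hX
    have hβs := contDiffOn_contr e.open_target hu.contDiff.contDiffOn hYs
    have hn := hW.mem_nhds hpW
    have hnt := e.open_target.mem_nhds hpW.1
    have hfd : fderiv ℝ (Θ ∘ e.symm) (e p) (chartVec X e (e p)) =
        deriv profile ((ψ (e p) - c) / η) / η * fderiv ℝ ψ (e p) (chartVec X e (e p)) := by
      have h1 : HasDerivAt profile (deriv profile ((ψ (e p) - c) / η)) ((ψ (e p) - c) / η) :=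
        (contDiff_profile.differentiable (by simp) _).hasDerivAt
      have h2 := (((hψs.contDiffAt hnt).differentiableAt (by simp)).hasFDerivAt.sub_const c).mul_const η⁻¹
      have h3 := h1.comp_hasFDerivAt (e p) (f := fun y => (ψ y - c) / η) (by simpa only [div_eq_mul_inv] using h2)
      have h4 : (Θ ∘ e.symm) =ᶠ[𝓝 (e p)] profile ∘ fun y => (ψ y - c) / η := by
        filter_upwards [hn] with y hy using hΘe hy
      rw [(h3.congr_of_eventuallyEq h4).fderiv]
      simp only [smul_apply, smul_eq_mul]
      ring
    refine ⟨e, hu.mem, hp, rotForm (Θ ∘ e.symm) α (contr α (chartVec X e)), _, hW, inter_subset_left, hpW,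
      ?_, ⟨chartVec X e (e p), v, w, ?_⟩, fun q hq hqW v => ?_⟩
    · exact ((Real.contDiff_cos.comp_contDiffOn hΘs).smul hu.contDiff.contDiffOn).add
        ((Real.contDiff_sin.comp_contDiffOn hΘs).smul (hβs.mono inter_subset_left))
    · rw [wedgeD_rotForm ((hΘs.contDiffAt hn).differentiableAt (by simp))
        (hu.contDiff.differentiable (by simp) _) ((hβs.contDiffAt hnt).differentiableAt (by simp))
        (by rw [chartVec_apply hp]; exact (hu.ker p hp _).1 (hXξ p)) rfl, hfd, hΘe hpW]
      have h := hspeed η hη0 (min_le_left _ _) ((ψ (e p) - c) / η) _ hz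
      simp only
      set t := profile ((ψ (e p) - c) / η)
      set x := deriv profile ((ψ (e p) - c) / η) / η * fderiv ℝ ψ (e p) (chartVec X e (e p))
      set A := wedge (α (e p)) (contr α (chartVec X e) (e p)) v w
      set B := wedge (α (e p)) (contr (contr α (chartVec X e)) (chartVec X e) (e p)) v w
      set D := wedge (contr α (chartVec X e) (e p))
        (contr (contr α (chartVec X e)) (chartVec X e) (e p)) v w
      intro h0
      have hA' := abs_pos.2 hA
      -- If the three-form vanished, its main term would balance the two errors, contradicting the
      -- strict domination in `h`.
      have h1 : (x + Real.cos t ^ 2) * A = -(Real.cos t * Real.sin t * B + Real.sin t ^ 2 * D) := by linarith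
      have h2 : |(x + Real.cos t ^ 2) * A| ≤ |Real.cos t * Real.sin t| * (C * |A|) + Real.sin t ^ 2 * (C * |A|) := by
        rw [h1, abs_neg]
        refine (abs_add_le _ _).trans (add_le_add ?_ ?_)
        · rw [abs_mul]; exact mul_le_mul_of_nonneg_left hB (abs_nonneg _)
        · rw [abs_mul, abs_of_nonneg (sq_nonneg (Real.sin t))]
          exact mul_le_mul_of_nonneg_left hD (sq_nonneg _)
      rw [abs_mul] at h2
      have h3 := mul_pos h hA'
      have h4 := mul_le_mul_of_nonneg_right (le_abs_self (x + Real.cos t ^ 2)) hA'.le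
      nlinarith
    · rw [hrot e α hu q hq]
      rfl

end

section
/-! ### Planar estimates near a critical point -/

/-- Evaluating an `o(‖v‖)` covector on a vector as long as `v` costs another factor `‖v‖`. This
covers both `v` and `rot v`. -/
theorem eventually_abs_sub_le {A : E2 → E2 →L[ℝ] ℝ} {A' : E2 →L[ℝ] E2 →L[ℝ] ℝ} (hA : HasFDerivAt A A' 0)
    (h0 : A 0 = 0) {δ : ℝ} (hδ : 0 < δ) :
    ∀ᶠ v in 𝓝 (0 : E2), ∀ w, ‖w‖ = ‖v‖ → |A v w - A' v w| ≤ δ * ‖v‖ ^ 2 := by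
  filter_upwards [hA.isLittleO.def hδ] with v hv w hw
  rw [h0, sub_zero, sub_zero] at hv
  have h1 := (A v - A' v).le_opNorm w
  rw [Real.norm_eq_abs, sub_apply, hw] at h1
  calc _ ≤ _ := h1
    _ ≤ δ * ‖v‖ * ‖v‖ := mul_le_mul_of_nonneg_right hv (norm_nonneg _)
    _ = _ := by ring

theorem abs_det_sub_le {x y z w x₁ y₁ z₁ w₁ δ K R : ℝ} (hδ : 0 ≤ δ) (hδ1 : δ ≤ 1) (hR : 0 ≤ R)
    (hx : |x - x₁| ≤ δ * R) (hy : |y - y₁| ≤ δ * R) (hz : |z - z₁| ≤ δ * R) (hw : |w - w₁| ≤ δ * R)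
    (hx₁ : |x₁| ≤ K * R) (hy₁ : |y₁| ≤ K * R) (hz₁ : |z₁| ≤ K * R) (hw₁ : |w₁| ≤ K * R) :
    |(x * y - z * w) - (x₁ * y₁ - z₁ * w₁)| ≤ δ * (4 * K + 2) * R ^ 2 := by
  have e : (x * y - z * w) - (x₁ * y₁ - z₁ * w₁) =
      ((x - x₁) * (y - y₁) + ((x - x₁) * y₁ + x₁ * (y - y₁))) -
        ((z - z₁) * (w - w₁) + ((z - z₁) * w₁ + z₁ * (w - w₁))) := by ring
  have hδR : 0 ≤ δ * R := mul_nonneg hδ hR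
  have h2 : (δ * R) * (δ * R) ≤ δ * R ^ 2 := by nlinarith [mul_nonneg hδ (sq_nonneg R)]
  have hp : ∀ {p q P Q : ℝ}, |p| ≤ P → |q| ≤ Q → 0 ≤ P → |p * q| ≤ P * Q := fun hp hq hP => by
    rw [abs_mul]
    exact mul_le_mul hp hq (abs_nonneg _) hP
  have hKR : 0 ≤ K * R := (abs_nonneg _).trans hx₁
  rw [e]
  refine (abs_sub _ _).trans ?_
  have t1 := abs_add_three ((x - x₁) * (y - y₁)) ((x - x₁) * y₁) (x₁ * (y - y₁))
  have t2 := abs_add_three ((z - z₁) * (w - w₁)) ((z - z₁) * w₁) (z₁ * (w - w₁))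
  rw [add_assoc] at t1 t2
  have := hp hx hy hδR
  have := hp hx hy₁ hδR
  have := hp hx₁ hy hKR
  have := hp hz hw hδR
  have := hp hz hw₁ hδR
  have := hp hz₁ hw hKR
  nlinarith

/-- Here `h = a x² + b y²` and `g = (b - a) x y` are the Hessian on `(v, v)` and `(v, rot v)`. The
last bound rests on `g² + h² = (x² + y²)(a² x² + b² y²)`. -/
theorem quadratic_bounds {a b l : ℝ} (hl : 0 < l) (hla : l ≤ a) (hlb : l ≤ b) (x y : ℝ) :
    l * (x ^ 2 + y ^ 2) ≤ a * x ^ 2 + b * y ^ 2 ∧ a * x ^ 2 + b * y ^ 2 ≤ (a + b) * (x ^ 2 + y ^ 2) ∧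
      |(b - a) * (x * y)| ≤ (a + b) * (x ^ 2 + y ^ 2) ∧
      l * ((x ^ 2 + y ^ 2) * (a * x ^ 2 + b * y ^ 2)) ≤
        ((b - a) * (x * y)) ^ 2 + (a * x ^ 2 + b * y ^ 2) ^ 2 := by
  have ha : 0 < a := hl.trans_le hla
  have hb : 0 < b := hl.trans_le hlb
  have hx := sq_nonneg x
  have hy := sq_nonneg y
  refine ⟨?_, ?_, ?_, ?_⟩
  · linarith [mul_le_mul_of_nonneg_right hla hx, mul_le_mul_of_nonneg_right hlb hy]
  · linarith [mul_nonneg ha.le hy, mul_nonneg hb.le hx]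
  · have h1 : |b - a| ≤ a + b := abs_le.2 ⟨by linarith, by linarith⟩
    have h2 : |x * y| ≤ x ^ 2 + y ^ 2 := abs_le.2 ⟨by nlinarith [sq_nonneg (x + y)], by nlinarith [sq_nonneg (x - y)]⟩
    rw [abs_mul]
    exact mul_le_mul h1 h2 (abs_nonneg _) (by linarith)
  · have e : ((b - a) * (x * y)) ^ 2 + (a * x ^ 2 + b * y ^ 2) ^ 2 =
        (x ^ 2 + y ^ 2) * (a ^ 2 * x ^ 2 + b ^ 2 * y ^ 2) := by ring
    have h1 : l * (a * x ^ 2 + b * y ^ 2) ≤ a ^ 2 * x ^ 2 + b ^ 2 * y ^ 2 := by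
      linarith [mul_le_mul_of_nonneg_right hla (mul_nonneg ha.le hx),
        mul_le_mul_of_nonneg_right hlb (mul_nonneg hb.le hy)]
    rw [e]
    calc _ = (x ^ 2 + y ^ 2) * (l * (a * x ^ 2 + b * y ^ 2)) := by ring
      _ ≤ _ := mul_le_mul_of_nonneg_left h1 (add_nonneg hx hy)

/-- Without the errors, `A` is `(C h, C g + κR/2)` on `(v, rot v)`, `B` is `(κ g, -κ h)` and `du` is
`(h, g)`. The determinant of `A` with `du` is `-κ R h / 2 < 0`, independently of `C`. That of `k A +
s B` is `κ (s (g² + h²) - k R h / 2)`, at least `κ k R h / 2` because `g² + h² ≥ l R h` and `s l =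
k`. The choice of `C` makes `k C h` exceed `κ |g|` with margin `R`, which gives radial positivity.
Finally `δ` is small enough for errors of order `δ R` to preserve the signs. -/
theorem planar_inequalities {Λ κ l k s C δ K R h g A1 A2 B1 B2 U1 U2 : ℝ} (hκ : 0 < κ) (hl : 0 < l) (hΛ : 0 < Λ)
    (hk : 0 < k) (hs : 0 < s) (hk1 : k ≤ 1) (hs1 : s ≤ 1) (hskl : s * l = k) (hC : 0 < C)
    (hCl : C * k * l = κ * Λ + 1) (hδ : 0 < δ) (hδ1 : δ ≤ 1 / 4) (hδ2 : δ ≤ l / 2)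
    (hδ3 : 2 * δ * (4 * K + 2) ≤ κ * k * l / 4) (hK : K = C * Λ + κ * Λ + κ + Λ) (hR : 0 < R)
    (hhl : l * R ≤ h) (hhu : h ≤ Λ * R) (hgu : |g| ≤ Λ * R) (hgh : l * (R * h) ≤ g ^ 2 + h ^ 2)
    (hA : |A1 - C * h| ≤ δ * R) (hA' : |A2 - (C * g + κ / 2 * R)| ≤ δ * R) (hB : |B1 - κ * g| ≤ δ * R)
    (hB' : |B2 - -κ * h| ≤ δ * R) (hU : |U1 - h| ≤ δ * R) (hU' : |U2 - g| ≤ δ * R) :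
    0 < U1 ∧ (∀ c t, k ≤ c → c ≤ 1 → 0 ≤ t → t ≤ 1 → 0 < c * A1 + t * B1) ∧ A1 * U2 - A2 * U1 < 0 ∧
      0 < (k * A1 + s * B1) * U2 - (k * A2 + s * B2) * U1 := by
  have hCR : 0 < C * Λ * R := by positivity
  have hκR : 0 < κ * Λ * R := by positivity
  have hκR' : 0 < κ * R := by positivity
  have hh0 : 0 < h := (mul_pos hl hR).trans_le hhl
  have hg2 := abs_le.1 hgu
  have hδR : 0 < δ * R := mul_pos hδ hR
  have hR' : 0 < Λ * R := by positivity
  have bg : |g| ≤ K * R := by rw [hK]; linarith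
  have bh : |h| ≤ K * R := by rw [abs_of_pos hh0, hK]; linarith
  have bCh : |C * h| ≤ K * R := by
    rw [abs_of_pos (mul_pos hC hh0), hK]
    linarith [mul_le_mul_of_nonneg_left hhu hC.le]
  have bCg : |C * g + κ / 2 * R| ≤ K * R := by
    have h1 := mul_le_mul_of_nonneg_left hg2.1 hC.le
    have h2 := mul_le_mul_of_nonneg_left hg2.2 hC.le
    rw [hK, abs_le]
    constructor <;> linarith
  have hU1 : |U1 - h| ≤ 2 * δ * R := by linarith
  have hU2 : |U2 - g| ≤ 2 * δ * R := by linarith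
  refine ⟨?_, ?_, ?_, ?_⟩
  · linarith [(abs_le.1 hU).1, mul_le_mul_of_nonneg_right hδ2 hR.le, mul_pos hl hR]
  · intro c t hkc hc1 ht0 ht1
    have h1 := (abs_le.1 hA).1
    have h2 := (abs_le.1 hB).1
    have h3 : c * (C * h - δ * R) ≤ c * A1 := mul_le_mul_of_nonneg_left (by linarith) (hk.le.trans hkc)
    have h4 : t * (κ * g - δ * R) ≤ t * B1 := mul_le_mul_of_nonneg_left (by linarith) ht0
    have h5 : t * (δ * R) ≤ δ * R := mul_le_of_le_one_left hδR.le ht1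
    have h6 : c * (δ * R) ≤ δ * R := mul_le_of_le_one_left hδR.le hc1
    have h7 : k * (C * h) ≤ c * (C * h) := mul_le_mul_of_nonneg_right hkc (by positivity)
    have h8 : (κ * Λ + 1) * R ≤ k * (C * h) := by
      rw [← hCl]
      have := mul_le_mul_of_nonneg_left hhl (mul_pos hk hC).le
      linarith
    have h9 : -(κ * (Λ * R)) ≤ t * (κ * g) := by
      have h10 : -(Λ * R) ≤ t * g := by
        linarith [mul_le_mul_of_nonneg_left hg2.1 ht0, mul_le_of_le_one_left hR'.le ht1]
      linarith [mul_le_mul_of_nonneg_left h10 hκ.le]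
    linarith [mul_le_mul_of_nonneg_right hδ1 hR.le]
  · have := abs_det_sub_le (mul_pos two_pos hδ).le (by linarith) hR.le
      (hA.trans (by linarith)) hU2 (hA'.trans (by linarith)) hU1 bCh bg bCg bh
    have h1 := (abs_le.1 this).2
    have h2 : C * h * g - (C * g + κ / 2 * R) * h = -(κ / 2 * (R * h)) := by ring
    have h3 : κ * l * R ^ 2 ≤ κ * (R * h) := by
      have := mul_le_mul_of_nonneg_left (mul_le_mul_of_nonneg_left hhl hR.le) hκ.le
      linarith
    have h4 : 2 * δ * (4 * K + 2) * R ^ 2 ≤ κ * k * l / 4 * R ^ 2 :=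
      mul_le_mul_of_nonneg_right hδ3 (sq_nonneg _)
    have h5 : 0 < κ * l * R ^ 2 := by positivity
    have h6 : k * (κ * l * R ^ 2) ≤ κ * l * R ^ 2 := mul_le_of_le_one_left h5.le hk1
    linarith
  · have e1 : |k * A1 + s * B1 - (k * (C * h) + s * (κ * g))| ≤ 2 * δ * R := by
      have : k * A1 + s * B1 - (k * (C * h) + s * (κ * g)) = k * (A1 - C * h) + s * (B1 - κ * g) := by
        ring
      rw [this]
      refine (abs_add_le _ _).trans ?_
      rw [abs_mul, abs_mul, abs_of_pos hk, abs_of_pos hs]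
      linarith [mul_le_of_le_one_left (abs_nonneg (A1 - C * h)) hk1, mul_le_of_le_one_left (abs_nonneg (B1 - κ * g)) hs1]
    have e2 : |k * A2 + s * B2 - (k * (C * g + κ / 2 * R) + s * (-κ * h))| ≤ 2 * δ * R := by
      have : k * A2 + s * B2 - (k * (C * g + κ / 2 * R) + s * (-κ * h)) =
          k * (A2 - (C * g + κ / 2 * R)) + s * (B2 - (-κ * h)) := by ring
      rw [this]
      refine (abs_add_le _ _).trans ?_
      rw [abs_mul, abs_mul, abs_of_pos hk, abs_of_pos hs]
      linarith [mul_le_of_le_one_left (abs_nonneg (A2 - (C * g + κ / 2 * R))) hk1,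
        mul_le_of_le_one_left (abs_nonneg (B2 - (-κ * h))) hs1]
    have hκg := mul_le_mul_of_nonneg_left hg2.1 hκ.le
    have hκg' := mul_le_mul_of_nonneg_left hg2.2 hκ.le
    have hκh := mul_le_mul_of_nonneg_left hhu hκ.le
    have b1 : |k * (C * h) + s * (κ * g)| ≤ K * R := by
      have h1 : |k * (C * h)| ≤ C * Λ * R := by
        rw [abs_mul, abs_of_pos hk, abs_of_pos (mul_pos hC hh0)]
        linarith [mul_le_mul_of_nonneg_left hhu hC.le, mul_le_of_le_one_left (mul_pos hC hh0).le hk1]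
      have h2 : |s * (κ * g)| ≤ κ * Λ * R := by
        rw [abs_mul, abs_of_pos hs, abs_mul, abs_of_pos hκ]
        linarith [mul_le_mul_of_nonneg_left hgu hκ.le, mul_le_of_le_one_left (mul_nonneg hκ.le (abs_nonneg g)) hs1]
      refine (abs_add_le _ _).trans ?_
      rw [hK]
      linarith
    have b2 : |k * (C * g + κ / 2 * R) + s * (-κ * h)| ≤ K * R := by
      have h1 : |k * (C * g + κ / 2 * R)| ≤ C * Λ * R + κ * R := by
        have h3 : |C * g + κ / 2 * R| ≤ C * Λ * R + κ * R := by
          have h1 := mul_le_mul_of_nonneg_left hg2.1 hC.le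
          have h2 := mul_le_mul_of_nonneg_left hg2.2 hC.le
          rw [abs_le]
          constructor <;> linarith
        rw [abs_mul, abs_of_pos hk]
        linarith [mul_le_of_le_one_left (abs_nonneg (C * g + κ / 2 * R)) hk1]
      have h2 : |s * (-κ * h)| ≤ κ * Λ * R := by
        rw [abs_mul, abs_of_pos hs, abs_mul, abs_neg, abs_of_pos hκ, abs_of_pos hh0]
        linarith [mul_le_of_le_one_left (mul_pos hκ hh0).le hs1]
      refine (abs_add_le _ _).trans ?_
      rw [hK]
      linarith
    have := abs_det_sub_le (mul_pos two_pos hδ).le (by linarith) hR.le e1 hU2 e2 hU1 b1 bg b2 bh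
    have h1 := (abs_le.1 this).1
    have h2 : (k * (C * h) + s * (κ * g)) * g - (k * (C * g + κ / 2 * R) + s * (-κ * h)) * h =
        κ * (s * (g ^ 2 + h ^ 2) - k * (R * h) / 2) := by ring
    have h3 : s * l * (R * h) ≤ s * (g ^ 2 + h ^ 2) := by
      have := mul_le_mul_of_nonneg_left hgh hs.le
      linarith
    rw [hskl] at h3
    have h4 : 2 * δ * (4 * K + 2) * R ^ 2 ≤ κ * k * l / 4 * R ^ 2 :=
      mul_le_mul_of_nonneg_right hδ3 (sq_nonneg _)
    have h5 : 0 < κ * k * l * R ^ 2 := by positivity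
    have h6 : κ * k * l * R ^ 2 ≤ κ * (k * (R * h)) := by
      have := mul_le_mul_of_nonneg_left (mul_le_mul_of_nonneg_left hhl hR.le) (mul_pos hκ hk).le
      linarith
    have h7 := mul_le_mul_of_nonneg_left h3 hκ.le
    linarith

theorem exists_planar_estimates {A B U : E2 → E2 →L[ℝ] ℝ} {A' B' U' : E2 →L[ℝ] E2 →L[ℝ] ℝ}
    (hA : HasFDerivAt A A' 0) (hB : HasFDerivAt B B' 0) (hU : HasFDerivAt U U' 0)
    (hA0 : A 0 = 0) (hB0 : B 0 = 0) (hU0 : U 0 = 0) {a b κ l k s C : ℝ} (hκ : 0 < κ)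
    (hl : 0 < l) (hla : l ≤ a) (hlb : l ≤ b) (hk : 0 < k) (hs : 0 < s) (hks : k ^ 2 + s ^ 2 = 1)
    (hskl : s * l = k) (hC : 0 < C) (hCl : C * k * l = κ * (a + b) + 1)
    (hA' : ∀ v w, A' v w = C * (a * v 0 * w 0 + b * v 1 * w 1) + κ / 2 * (v 0 * w 1 - v 1 * w 0))
    (hB' : ∀ v w, B' v w = -κ * (a * v 0 * w 1 - b * v 1 * w 0))
    (hU' : ∀ v w, U' v w = a * v 0 * w 0 + b * v 1 * w 1) :
    ∀ᶠ v in 𝓝 (0 : E2), v ≠ 0 → 0 < U v v ∧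
      (∀ c t, k ≤ c → c ≤ 1 → 0 ≤ t → t ≤ 1 → 0 < c * A v v + t * B v v) ∧
      A v v * U v (rot v) - A v (rot v) * U v v < 0 ∧
      0 < (k * A v v + s * B v v) * U v (rot v) - (k * A v (rot v) + s * B v (rot v)) * U v v := by
  have ha : 0 < a := hl.trans_le hla
  have hb : 0 < b := hl.trans_le hlb
  have hk1 : k ≤ 1 := by nlinarith [sq_nonneg s]
  have hs1 : s ≤ 1 := by nlinarith [sq_nonneg k]
  set K := C * (a + b) + κ * (a + b) + κ + (a + b) with hK
  have hK0 : 0 < K := by positivity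
  obtain ⟨δ, hδ, hδ1, hδ2, hδ3⟩ : ∃ δ > 0, δ ≤ 1 / 4 ∧ δ ≤ l / 2 ∧ 2 * δ * (4 * K + 2) ≤ κ * k * l / 4 := by
    refine ⟨min (min (1 / 4) (l / 2)) (κ * k * l / (8 * (4 * K + 2))), by positivity,
      (min_le_left _ _).trans (min_le_left _ _), (min_le_left _ _).trans (min_le_right _ _), ?_⟩
    have := min_le_right (min (1 / 4) (l / 2)) (κ * k * l / (8 * (4 * K + 2)))
    rw [le_div_iff₀ (by positivity)] at this
    linarith
  filter_upwards [eventually_abs_sub_le hA hA0 hδ, eventually_abs_sub_le hB hB0 hδ,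
    eventually_abs_sub_le hU hU0 hδ] with v vA vB vU hv
  have hR : 0 < ‖v‖ ^ 2 := by positivity
  have hRe : ‖v‖ ^ 2 = v 0 ^ 2 + v 1 ^ 2 := norm_E2_sq v
  have A1 := vA v rfl
  have A2 := vA (rot v) (norm_rot v)
  have B1 := vB v rfl
  have B2 := vB (rot v) (norm_rot v)
  have U1 := vU v rfl
  have U2 := vU (rot v) (norm_rot v)
  simp only [hA', hB', hU', rot_apply_zero, rot_apply_one] at A1 A2 B1 B2 U1 U2
  obtain ⟨q1, q2, q3, q4⟩ := quadratic_bounds hl hla hlb (v 0) (v 1)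
  rw [← hRe] at q1 q2 q3 q4
  refine planar_inequalities (R := ‖v‖ ^ 2) (h := a * v 0 ^ 2 + b * v 1 ^ 2) (g := (b - a) * (v 0 * v 1)) hκ hl (add_pos ha hb)
    hk hs hk1 hs1 hskl hC hCl hδ hδ1 hδ2 hδ3 hK hR q1 q2 q3 q4 ?_ ?_ ?_ ?_ ?_ ?_
  · rwa [show C * (a * v 0 ^ 2 + b * v 1 ^ 2) =
      C * (a * v 0 * v 0 + b * v 1 * v 1) + κ / 2 * (v 0 * v 1 - v 1 * v 0) by ring]
  · rw [hRe] at A2 ⊢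
    rwa [show C * ((b - a) * (v 0 * v 1)) + κ / 2 * (v 0 ^ 2 + v 1 ^ 2) =
      C * (a * v 0 * -v 1 + b * v 1 * v 0) + κ / 2 * (v 0 * v 0 - v 1 * -v 1) by ring]
  · rwa [show κ * ((b - a) * (v 0 * v 1)) = -κ * (a * v 0 * v 1 - b * v 1 * v 0) by ring]
  · rwa [show -κ * (a * v 0 ^ 2 + b * v 1 ^ 2) = -κ * (a * v 0 * v 0 - b * v 1 * -v 1) by ring]
  · rwa [show a * v 0 ^ 2 + b * v 1 ^ 2 = a * v 0 * v 0 + b * v 1 * v 1 by ring]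
  · rwa [show (b - a) * (v 0 * v 1) = a * v 0 * -v 1 + b * v 1 * v 0 by ring]

end

section
/-! ### Graphs over a plane in a chart -/

/-- The shear of three-space along the last coordinate of a frame. -/
def shear (T : (E2 × ℝ) ≃L[ℝ] E3) (Q : E2 → ℝ) (hQ : Continuous Q) : E3 ≃ₜ E3 where
  toFun y := y - T (0, Q (T.symm y).1)
  invFun y := y + T (0, Q (T.symm y).1)
  left_inv y := by simp
  right_inv y := by simp
  continuous_toFun := continuous_id.sub (T.continuous.comp (continuous_const.prodMk
    (hQ.comp (continuous_fst.comp T.symm.continuous))))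
  continuous_invFun := continuous_id.add (T.continuous.comp (continuous_const.prodMk
    (hQ.comp (continuous_fst.comp T.symm.continuous))))

section
variable {M : Type*} [TopologicalSpace M] [ChartedSpace E3 M]

/-- The shear subtracting the graph function straightens the graph to a coordinate plane and is a
global diffeomorphism, so composing it with the chart exhibits the immersion. -/
theorem isSmoothEmbedding_graph {e : OpenPartialHomeomorph M E3}
    (he : e ∈ IsManifold.maximalAtlas (𝓡 3) ∞ M) (het : e.target = univ) (T : (E2 × ℝ) ≃L[ℝ] E3) {Q : E2 → ℝ}
    (hQ : ContDiff ℝ ∞ Q) :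
    Manifold.IsSmoothEmbedding (𝓡 2) (𝓡 3) ∞ (fun v => e.symm (T (v, Q v))) := by
  have hF : Topology.IsEmbedding fun v => T (v, Q v) :=
    Function.LeftInverse.isEmbedding (f := fun y => (T.symm y).1) (fun v => by simp)
      (continuous_fst.comp T.symm.continuous) (T.continuous.comp (continuous_id.prodMk hQ.continuous))
  have he' : Topology.IsEmbedding e.symm := (e.symm.isOpenEmbedding het).isEmbedding
  have hemb : Topology.IsEmbedding fun v => e.symm (T (v, Q v)) := he'.comp hF
  set S := (shear T Q hQ.continuous).toOpenPartialHomeomorph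
  have hs : ContDiff ℝ ∞ fun y : E3 => T (0, Q (T.symm y).1) :=
    T.contDiff.comp (contDiff_const.prodMk (hQ.comp (contDiff_fst.comp T.symm.contDiff)))
  have hS : S ∈ contDiffGroupoid ∞ (𝓡 3) :=
    mem_contDiffGroupoid_E3 (contDiff_id.sub hs).contDiffOn (contDiff_id.add hs).contDiffOn
  refine ⟨Manifold.IsImmersionOfComplement.isImmersion (F := ℝ) fun v => ?_, hemb⟩
  refine Manifold.IsImmersionAtOfComplement.mk_of_continuousAt hemb.continuous.continuousAt T
    (OpenPartialHomeomorph.refl E2) (e.trans S) (mem_univ _) ?_ ?_ (trans_mem_maximalAtlas he hS) ?_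
  · rw [OpenPartialHomeomorph.trans_source]
    exact ⟨e.map_target (het ▸ mem_univ _), mem_univ _⟩
  · exact StructureGroupoid.id_mem_maximalAtlas _
  · intro v _
    have h1 : e (e.symm (T (v, Q v))) = T (v, Q v) := e.right_inv (het ▸ mem_univ _)
    change S (e (e.symm (T (v, Q v)))) = T (v, 0)
    rw [h1]
    change T (v, Q v) - T (0, Q (T.symm (T (v, Q v))).1) = T (v, 0)
    rw [T.symm_apply_apply, ← map_sub]
    simp

end

/-- A quadratic graph. -/
def graphMap (T : (E2 × ℝ) ≃L[ℝ] E3) (q : E2 →L[ℝ] E2 →L[ℝ] ℝ) (v : E2) : E3 := T (v, q v v / 2)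

/-- The differential of a quadratic graph. -/
def graphD (T : (E2 × ℝ) ≃L[ℝ] E3) (q : E2 →L[ℝ] E2 →L[ℝ] ℝ) (v : E2) : E2 →L[ℝ] E3 :=
  (T : (E2 × ℝ) →L[ℝ] E3).comp ((ContinuousLinearMap.id ℝ E2).prod (q v))

/-- The pullback of a one-form to a quadratic graph. -/
def graphPull (T : (E2 × ℝ) ≃L[ℝ] E3) (q : E2 →L[ℝ] E2 →L[ℝ] ℝ) (φ : E3 → E3 →L[ℝ] ℝ) (v : E2) :
    E2 →L[ℝ] ℝ := (φ (graphMap T q v)).comp (graphD T q v)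

section
variable {T : (E2 × ℝ) ≃L[ℝ] E3} {q : E2 →L[ℝ] E2 →L[ℝ] ℝ}

theorem contDiff_quadratic : ContDiff ℝ ∞ fun v => q v v / 2 :=
  (q.contDiff.clm_apply contDiff_id).div_const 2

theorem contDiff_graphMap : ContDiff ℝ ∞ (graphMap T q) :=
  T.contDiff.comp (contDiff_id.prodMk contDiff_quadratic)

theorem graphMap_zero : graphMap T q 0 = 0 := by simp [graphMap]

theorem graphD_apply (v w : E2) : graphD T q v w = T (w, q v w) := rfl

theorem hasFDerivAt_graphMap (hq : ∀ v w, q v w = q w v) (v : E2) :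
    HasFDerivAt (graphMap T q) (graphD T q v) v := by
  have h1 : HasFDerivAt (fun v => q v v / 2) (q v) v := by
    have h := (q.hasFDerivAt (x := v)).clm_apply (hasFDerivAt_id v)
    have h2 := h.mul_const (2 : ℝ)⁻¹
    simp only [← div_eq_mul_inv] at h2
    refine h2.congr_fderiv ?_
    ext w
    simp [hq w v]
    ring
  exact T.hasFDerivAt.comp v ((hasFDerivAt_id v).prodMk h1)

theorem graphPull_apply (φ : E3 → E3 →L[ℝ] ℝ) (v w : E2) : graphPull T q φ v w =
    φ (graphMap T q v) (T (w, 0)) + q v w * φ (graphMap T q v) (T (0, 1)) := by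
  have : T (w, q v w) = T (w, 0) + q v w • T (0, 1) := by
    rw [← map_smul, ← map_add]; simp
  rw [graphPull, ContinuousLinearMap.comp_apply, graphD_apply, this, map_add, map_smul, smul_eq_mul]

theorem contDiff_graphPull {φ : E3 → E3 →L[ℝ] ℝ} (hφ : ContDiff ℝ ∞ φ) : ContDiff ℝ ∞ (graphPull T q φ) := by
  rw [contDiff_clm_apply_iff]
  intro w
  simp only [graphPull_apply]
  have h := hφ.comp (contDiff_graphMap (T := T) (q := q))
  exact (h.clm_apply contDiff_const).add ((q.contDiff.clm_apply contDiff_const).mul (h.clm_apply contDiff_const))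

theorem graphPull_zero {φ : E3 → E3 →L[ℝ] ℝ} (hφ : ∀ v, φ 0 (T (v, 0)) = 0) : graphPull T q φ 0 = 0 := by
  ext w
  simp [graphPull, graphMap_zero, graphD_apply, hφ]

/-- The second-order term `q` of the graph shifts the derivative by `q` times the value of `φ` on
the vertical vector. This is the freedom to prescribe the symmetric part of the linearised
foliation. -/
theorem fderiv_graphPull {φ : E3 → E3 →L[ℝ] ℝ} (hφ : ContDiff ℝ ∞ φ) (hq : ∀ v w, q v w = q w v) (v w : E2) :
    fderiv ℝ (graphPull T q φ) 0 v w =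
      fderiv ℝ φ 0 (T (v, 0)) (T (w, 0)) + q v w * φ 0 (T (0, 1)) := by
  have h1 := (((contDiff_graphPull (T := T) (q := q) hφ).differentiable (by simp) 0).hasFDerivAt).clm_apply
    (hasFDerivAt_const w (0 : E2))
  have h2 : HasFDerivAt (fun y => φ (graphMap T q y)) ((fderiv ℝ φ 0).comp (graphD T q 0)) 0 := by
    refine HasFDerivAt.comp (0 : E2) ?_ (hasFDerivAt_graphMap hq 0)
    rw [graphMap_zero]
    exact (hφ.differentiable (by simp) 0).hasFDerivAt
  have h3 := h2.clm_apply (hasFDerivAt_const (T (w, 0)) (0 : E2))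
  have h4 := ((q.hasFDerivAt (x := (0 : E2))).clm_apply (hasFDerivAt_const w (0 : E2))).mul
    (h2.clm_apply (hasFDerivAt_const (T (0, 1)) (0 : E2)))
  have h5 : (fun y => graphPull T q φ y w) =
      fun y => φ (graphMap T q y) (T (w, 0)) + q y w * φ (graphMap T q y) (T (0, 1)) :=
    funext fun y => graphPull_apply φ y w
  rw [h5] at h1
  have h6 := h1.unique (h3.add h4)
  have h7 := DFunLike.congr_fun h6 v
  simpa [graphMap_zero, graphD_apply, mul_comm] using h7

end

/-! ### Normal frames at a sink -/

/-- Comparing constant and linear coefficients shows that the product of the `μ i` is zero and their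
second symmetric function is `a * b ≠ 0`. So exactly one vanishes. -/
theorem exists_perm_of_charpoly {q : Polynomial ℝ} {μ : Fin 3 → ℝ}
    (hq : q = ∏ i, (Polynomial.X - Polynomial.C (μ i))) {a b : ℂ}
    (h : q.map (algebraMap ℝ ℂ) =
      Polynomial.X * (Polynomial.X - Polynomial.C a) * (Polynomial.X - Polynomial.C b))
    (ha : a ≠ 0) (hb : b ≠ 0) (hμ : ∀ i, μ i ≤ 0) :
    ∃ σ : Equiv.Perm (Fin 3), μ (σ 0) < 0 ∧ μ (σ 1) < 0 ∧ μ (σ 2) = 0 := by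
  rw [hq] at h
  have h0 := congrArg (Polynomial.eval 0) h
  have h1 := congrArg (fun r => Polynomial.eval 0 (Polynomial.derivative r)) h
  simp [Fin.prod_univ_three, Polynomial.derivative_mul] at h0 h1
  have h1' : (μ 1 * μ 2 + μ 0 * μ 2 + μ 0 * μ 1 : ℂ) = a * b := by linear_combination h1
  have hab : (μ 1 * μ 2 + μ 0 * μ 2 + μ 0 * μ 1 : ℂ) ≠ 0 := by rw [h1']; exact mul_ne_zero ha hb
  have hab' : μ 1 * μ 2 + μ 0 * μ 2 + μ 0 * μ 1 ≠ 0 := by exact_mod_cast hab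
  have lt : ∀ i, μ i ≠ 0 → μ i < 0 := fun i hi => lt_of_le_of_ne (hμ i) hi
  rcases h0 with (h0 | h0) | h0
  · rw [h0] at hab'
    have : μ 1 * μ 2 ≠ 0 := by simpa using hab'
    exact ⟨Equiv.swap 0 2, by simpa using lt 2 (right_ne_zero_of_mul this),
      lt 1 (left_ne_zero_of_mul this), by simpa using h0⟩
  · rw [h0] at hab'
    have : μ 0 * μ 2 ≠ 0 := by simpa using hab'
    exact ⟨Equiv.swap 1 2, lt 0 (left_ne_zero_of_mul this),
      by simpa using lt 2 (right_ne_zero_of_mul this), by simpa using h0⟩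
  · rw [h0] at hab'
    have : μ 0 * μ 1 ≠ 0 := by simpa using hab'
    exact ⟨1, lt 0 (left_ne_zero_of_mul this), lt 1 (right_ne_zero_of_mul this), h0⟩

theorem exists_frame (b : Module.Basis (Fin 3) ℝ E3) {c d : ℝ} (hc : c ≠ 0) (hd : d ≠ 0) :
    ∃ T : (E2 × ℝ) ≃L[ℝ] E3, ∀ v t, T (v, t) = v 0 • b 0 + (v 1 * c) • b 1 + (t * d) • b 2 := by
  let T₀ : (E2 × ℝ) →ₗ[ℝ] E3 :=
    { toFun := fun p => p.1 0 • b 0 + (p.1 1 * c) • b 1 + (p.2 * d) • b 2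
      map_add' := fun p p' => by simp only [Prod.fst_add, Prod.snd_add, PiLp.add_apply]; module
      map_smul' := fun r p => by
        simp only [Prod.smul_fst, Prod.smul_snd, PiLp.smul_apply, smul_eq_mul, RingHom.id_apply]; module }
  have hinj : Function.Injective T₀ := by
    rw [injective_iff_map_eq_zero]
    rintro ⟨v, t⟩ h
    have h1 := Fintype.linearIndependent_iff.1 b.linearIndependent ![v 0, v 1 * c, t * d]
      (by rw [Fin.sum_univ_three]; exact h)
    have h2 := h1 0
    have h3 := h1 1
    have h4 := h1 2
    simp [hc, hd] at h2 h3 h4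
    ext i
    · fin_cases i
      · exact h2
      · exact h3
    · exact h4
  exact ⟨(LinearEquiv.ofInjectiveOfFinrankEq T₀ hinj (by simp)).toContinuousLinearEquiv, fun v t => rfl⟩

/-- With two basis vectors in the kernel of `α`, the value of `α ∧ dα` on the basis reduces to `α(b
2) dα(b 0, b 1)`. -/
theorem dForm_basis_ne_zero {α : E3 → (E3 →L[ℝ] ℝ)} {y : E3} (hc : ∃ u v w, wedgeD α y u v w ≠ 0)
    (b : Module.Basis (Fin 3) ℝ E3) (h0 : α y (b 0) = 0) (h1 : α y (b 1) = 0) :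
    α y (b 2) ≠ 0 ∧ dForm α y (b 0) (b 1) ≠ 0 := by
  obtain ⟨u, v, w, h⟩ := hc
  have hsum : ∀ v, v = b.repr v 0 • b 0 + b.repr v 1 • b 1 + b.repr v 2 • b 2 := fun v => by
    conv_lhs => rw [← b.sum_repr v, Fin.sum_univ_three]
  have exp1 : ∀ v, α y v = b.repr v 2 * α y (b 2) := fun v => by
    conv_lhs => rw [hsum v]
    simp [h0, h1]
  constructor
  · intro h2
    simp only [wedgeD, exp1 u, exp1 v, exp1 w, h2] at h
    simp at h
  · intro h2
    have a10 := dForm_antisymm α y (b 1) (b 0)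
    have a20 := dForm_antisymm α y (b 2) (b 0)
    have a21 := dForm_antisymm α y (b 2) (b 1)
    have a00 := dForm_self α y (b 0)
    have a11 := dForm_self α y (b 1)
    have a22 := dForm_self α y (b 2)
    have exp2 : ∀ v w, dForm α y v w =
        (b.repr v 0 * b.repr w 2 - b.repr v 2 * b.repr w 0) * dForm α y (b 0) (b 2)
        + (b.repr v 1 * b.repr w 2 - b.repr v 2 * b.repr w 1) * dForm α y (b 1) (b 2) := by
      intro v w
      conv_lhs => rw [hsum v, hsum w, ← dFormL_apply]
      simp only [map_add, map_smul, add_apply, smul_apply,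
        dFormL_apply, smul_eq_mul, a10, a20, a21, a00, a11, a22, h2]
      ring
    apply h
    simp only [wedgeD, exp1 u, exp1 v, exp1 w, exp2 v w, exp2 w u, exp2 u v]
    ring

end

/-! ### Linearised contraction and the normal frame at a sink. -/

section
theorem fderiv_apply_of_contraction {E : Type*} [NormedAddCommGroup E] [NormedSpace ℝ E]
    {α β : E → (E →L[ℝ] ℝ)} {Y : E → E} {y : E} (hα : DifferentiableAt ℝ (fderiv ℝ α) y)
    (hβ : DifferentiableAt ℝ β y) (hY : DifferentiableAt ℝ Y y) (hy : Y y = 0)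
    (h : ∀ y w, β y w = fderiv ℝ α y (Y y) w - fderiv ℝ α y w (Y y)) (v w : E) :
    fderiv ℝ β y v w = fderiv ℝ α y (fderiv ℝ Y y v) w - fderiv ℝ α y w (fderiv ℝ Y y v) := by
  have h1 := hβ.hasFDerivAt.clm_apply (hasFDerivAt_const w y)
  have h2 := (hα.hasFDerivAt.clm_apply hY.hasFDerivAt).clm_apply (hasFDerivAt_const w y)
  have h3 := (hα.hasFDerivAt.clm_apply (hasFDerivAt_const w y)).clm_apply hY.hasFDerivAt
  have h4 : (fun y => β y w) = (fun y => fderiv ℝ α y (Y y) w) - fun y => fderiv ℝ α y w (Y y) :=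
    funext fun y => h y w
  rw [h4] at h1
  have h5 := DFunLike.congr_fun (h1.unique (h2.sub h3)) v
  simpa [hy] using h5

theorem fderiv_contr {α : E3 → (E3 →L[ℝ] ℝ)} {Y : E3 → E3} (hα : ContDiff ℝ ∞ α) (hY : ContDiff ℝ ∞ Y)
    {y : E3} (hy : Y y = 0) (v w : E3) :
    fderiv ℝ (contr α Y) y v w = dForm α y (fderiv ℝ Y y v) w := by
  have hβ : ContDiff ℝ ∞ (contr α Y) :=
    contDiffOn_univ.1 (contDiffOn_contr isOpen_univ hα.contDiffOn hY.contDiffOn)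
  have hα' : ContDiff ℝ ∞ (fderiv ℝ α) :=
    contDiffOn_univ.1 (contDiffOn_fderiv_top isOpen_univ hα.contDiffOn)
  exact fderiv_apply_of_contraction (hα'.differentiable (by simp) y) (hβ.differentiable (by simp) y)
    (hY.differentiable (by simp) y) hy (fun y w => contr_apply α Y y w) v w

section
variable {M : Type*} [TopologicalSpace M] [ChartedSpace E3 M] [IsManifold (𝓡 3) ∞ M]
  {g : Bundle.ContMDiffRiemannianMetric (𝓡 3) ∞ E3 (TangentSpace (𝓡 3) : M → Type)}
  {ξ : ∀ p : M, Submodule ℝ (TangentSpace (𝓡 3) p)} {X : ∀ p : M, TangentSpace (𝓡 3) p} {Ψ : M → ℝ}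

/-- Differentiating `α(Y) = 0` at the zero puts the image of the linearisation into the contact
plane, so the two eigenvectors with negative eigenvalues span it. They diagonalise the Hessian of
the potential, and since the contraction linearises to `dα(DY v, w)`, they give it a normal form
too. -/
theorem exists_normal_frame (hΨ : ContMDiff (𝓡 3) 𝓘(ℝ, ℝ) ∞ Ψ)
    (hg : ∀ (p : M) (v : TangentSpace (𝓡 3) p), g.inner p (X p) v = -(mfderiv (𝓡 3) 𝓘(ℝ, ℝ) Ψ p v : ℝ))
    (hX : ContMDiff (𝓡 3) (𝓡 3).tangent ∞ (fun p : M => (⟨p, X p⟩ : TangentBundle (𝓡 3) M)))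
    (hXξ : ∀ p, X p ∈ ξ p) {e : OpenPartialHomeomorph M E3} {α : E3 → (E3 →L[ℝ] ℝ)} (h : IsUnitForm g ξ e α)
    {p : M} (hp : p ∈ e.source) (he0 : e p = 0) (h0 : X p = 0) (hmin : ∀ q, Ψ p ≤ Ψ q)
    (hs : IsTransverseSink X p) :
    ∃ (T : (E2 × ℝ) ≃L[ℝ] E3) (a b κ : ℝ), 0 < a ∧ 0 < b ∧ 0 < κ ∧ (∀ v, α 0 (T (v, 0)) = 0) ∧
      α 0 (T (0, 1)) = 1 ∧ (∀ v w, dForm α 0 (T (v, 0)) (T (w, 0)) = κ * (v 0 * w 1 - v 1 * w 0)) ∧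
      (∀ v w, fderiv ℝ (fderiv ℝ (Ψ ∘ e.symm)) 0 (T (v, 0)) (T (w, 0)) = a * v 0 * w 0 + b * v 1 * w 1) ∧
      ∀ v w, fderiv ℝ (contr α (chartVec X e)) 0 (T (v, 0)) (T (w, 0)) =
        -κ * (a * v 0 * w 1 - b * v 1 * w 0) := by
  obtain ⟨B₀, μ, hL, hμ, hd, hoff, hchar⟩ := exists_eigenbasis_chart hΨ hg hX h.mem hp h0 hmin
  obtain ⟨z, z', hz, hzr, hzr'⟩ := hs
  obtain ⟨σ, hσ0, hσ1, -⟩ := exists_perm_of_charpoly hchar hz (fun h => by simp [h] at hzr)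
    (fun h => by simp [h] at hzr') hμ
  rw [he0] at hL hd hoff
  set B := B₀.reindex σ.symm with hB
  have hBi : ∀ i, B i = B₀ (σ i) := fun i => by simp [hB]
  set Y := chartVec X e with hY
  have hYs : ContDiff ℝ ∞ Y := by
    have := contDiffOn_chartVec h.mem hX
    rwa [h.target, contDiffOn_univ] at this
  have hY0 : Y 0 = 0 := by
    have := chartVec_eq_zero hp h0
    rwa [he0] at this
  have hαY : ∀ y, α y (Y y) = 0 := fun y => by
    have hy : y ∈ e.target := h.target ▸ mem_univ y
    have h1 := (h.ker _ (e.map_target hy) _).1 (hXξ (e.symm y))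
    rwa [e.right_inv hy] at h1
  have hαL : ∀ v, α 0 (fderiv ℝ Y 0 v) = 0 := fun v => by
    have h1 := ((h.contDiff.differentiable (by simp) 0).hasFDerivAt).clm_apply
      ((hYs.differentiable (by simp) 0).hasFDerivAt)
    have h2 : (fun y => α y (Y y)) = fun _ => 0 := funext hαY
    rw [h2] at h1
    have h3 := DFunLike.congr_fun (h1.unique (hasFDerivAt_const 0 0)) v
    simpa [hY0] using h3
  have hα : ∀ i, μ i < 0 → α 0 (B₀ i) = 0 := fun i hi => by
    have h1 := hαL (B₀ i)
    rw [hL, map_smul, smul_eq_mul] at h1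
    exact (mul_eq_zero.1 h1).resolve_left hi.ne
  have hα0 : α 0 (B 0) = 0 := by rw [hBi]; exact hα _ hσ0
  have hα1 : α 0 (B 1) = 0 := by rw [hBi]; exact hα _ hσ1
  obtain ⟨hα2, hκ⟩ := dForm_basis_ne_zero (h.contact 0) B hα0 hα1
  set κ₀ := dForm α 0 (B 0) (B 1) with hκ₀
  -- Flipping the second vector if necessary makes `dα` positive on the frame. As `c * c = 1`, the
  -- Hessian keeps its diagonal form.
  obtain ⟨c, hc, hκc⟩ : ∃ c : ℝ, c * c = 1 ∧ 0 < κ₀ * c := by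
    rcases lt_or_gt_of_ne hκ with h | h
    · exact ⟨-1, by norm_num, by linarith⟩
    · exact ⟨1, by norm_num, by linarith⟩
  have hc0 : c ≠ 0 := by rintro rfl; simp at hc
  obtain ⟨T, hT⟩ := exists_frame B hc0 (inv_ne_zero hα2)
  have hT0 : ∀ v, T (v, 0) = v 0 • B 0 + (v 1 * c) • B 1 := fun v => by rw [hT]; simp
  have hL0 : fderiv ℝ Y 0 (B 0) = μ (σ 0) • B 0 := by rw [hBi, hL]
  have hL1 : fderiv ℝ Y 0 (B 1) = μ (σ 1) • B 1 := by rw [hBi, hL]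
  have d00 : fderiv ℝ (fderiv ℝ (Ψ ∘ e.symm)) 0 (B 0) (B 0) = -μ (σ 0) := by rw [hBi, hd]
  have d11 : fderiv ℝ (fderiv ℝ (Ψ ∘ e.symm)) 0 (B 1) (B 1) = -μ (σ 1) := by rw [hBi, hd]
  have d01 : fderiv ℝ (fderiv ℝ (Ψ ∘ e.symm)) 0 (B 0) (B 1) = 0 := by
    rw [hBi, hBi, hoff _ _ (by simp)]
  have d10 : fderiv ℝ (fderiv ℝ (Ψ ∘ e.symm)) 0 (B 1) (B 0) = 0 := by
    rw [hBi, hBi, hoff _ _ (by simp)]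
  have w00 := dForm_self α 0 (B 0)
  have w11 := dForm_self α 0 (B 1)
  have w10 : dForm α 0 (B 1) (B 0) = -κ₀ := dForm_antisymm _ _ _ _
  refine ⟨T, -μ (σ 0), -μ (σ 1), κ₀ * c, neg_pos.2 hσ0, neg_pos.2 hσ1, hκc, fun v => ?_, ?_, fun v w => ?_,
    fun v w => ?_, fun v w => ?_⟩
  · rw [hT0]; simp [hα0, hα1]
  · rw [hT]; simp [hα2]
  · rw [hT0, hT0, ← dFormL_apply]
    simp only [map_add, map_smul, add_apply, smul_apply, dFormL_apply, smul_eq_mul, w00, w11, w10, ← hκ₀]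
    ring
  · rw [hT0, hT0]
    simp only [map_add, map_smul, add_apply, smul_apply, smul_eq_mul, d00, d11, d01, d10]
    linear_combination (-μ (σ 1) * v 1 * w 1) * hc
  · rw [fderiv_contr h.contDiff hYs hY0, hT0, hT0, map_add, map_smul, map_smul, hL0, hL1, ← dFormL_apply]
    simp only [map_add, map_smul, add_apply, smul_apply, dFormL_apply, smul_eq_mul, w00, w11, w10, ← hκ₀]
    ring

end

end

section
/-! ### The overtwisted disc -/

variable {M : Type*} [TopologicalSpace M] [ChartedSpace E3 M] [IsManifold (𝓡 3) ∞ M]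
  {g : Bundle.ContMDiffRiemannianMetric (𝓡 3) ∞ E3 (TangentSpace (𝓡 3) : M → Type)}
  {ξ : ∀ p : M, Submodule ℝ (TangentSpace (𝓡 3) p)} {X : ∀ p : M, TangentSpace (𝓡 3) p} {Ψ : M → ℝ}
  {e : OpenPartialHomeomorph M E3} {α : E3 → (E3 →L[ℝ] ℝ)}
  {T : (E2 × ℝ) ≃L[ℝ] E3} {q : E2 →L[ℝ] E2 →L[ℝ] ℝ}

theorem dE_mfderiv_graph (h : IsUnitForm g ξ e α) (hq : ∀ v w, q v w = q w v) (v : E2)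
    (w : TangentSpace (𝓡 2) v) :
    dE e (e.symm (graphMap T q v)) (mfderiv (𝓡 2) (𝓡 3) (fun v => e.symm (graphMap T q v)) v w) =
      graphD T q v w := by
  have hy : graphMap T q v ∈ e.target := h.target ▸ mem_univ _
  have hf : MDifferentiableAt (𝓡 2) (𝓡 3) (fun v => e.symm (graphMap T q v)) v :=
    (isSmoothEmbedding_graph h.mem h.target T (contDiff_quadratic (q := q))).contMDiff.mdifferentiableAt
      (by simp)
  have he : MDifferentiableAt (𝓡 3) 𝓘(ℝ, E3) e (e.symm (graphMap T q v)) :=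
    (mdifferentiable_of_mem h.mem).mdifferentiableAt (e.map_target hy)
  have h1 := mfderiv_comp v he hf
  have h2 : (e ∘ fun v => e.symm (graphMap T q v)) = graphMap T q :=
    funext fun v => e.right_inv (h.target ▸ mem_univ _)
  have h3 : mfderiv (𝓡 2) 𝓘(ℝ, E3) (e ∘ fun v => e.symm (graphMap T q v)) v = graphD T q v := by
    rw [h2]
    exact (mfderiv_eq_fderiv).trans (hasFDerivAt_graphMap hq v).fderiv
  exact DFunLike.congr_fun (h1.symm.trans h3) w

theorem mem_charFoliation_graph (h : IsUnitForm g ξ e α) (hq : ∀ v w, q v w = q w v) {Θ : M → ℝ}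
    {ξ' : ∀ p : M, Submodule ℝ (TangentSpace (𝓡 3) p)}
    (hrot : ∀ e α, IsUnitForm g ξ e α → ∀ q ∈ e.source, ξ' q = rotPlane X Θ e α q) (v w : E2) :
    w ∈ charFoliation ξ' (fun v => e.symm (graphMap T q v)) v ↔
      Real.cos (Θ (e.symm (graphMap T q v))) * graphPull T q α v w +
        Real.sin (Θ (e.symm (graphMap T q v))) * graphPull T q (contr α (chartVec X e)) v w = 0 := by
  have hy : graphMap T q v ∈ e.target := h.target ▸ mem_univ _
  have h1 : w ∈ charFoliation ξ' (fun v => e.symm (graphMap T q v)) v ↔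
      mfderiv (𝓡 2) (𝓡 3) (fun v => e.symm (graphMap T q v)) v w ∈ ξ' (e.symm (graphMap T q v)) := Iff.rfl
  have h2 : mfderiv (𝓡 2) (𝓡 3) (fun v => e.symm (graphMap T q v)) v w ∈
        rotPlane X Θ e α (e.symm (graphMap T q v)) ↔
      rotForm (Θ ∘ e.symm) α (contr α (chartVec X e)) (e (e.symm (graphMap T q v)))
        (dE e (e.symm (graphMap T q v)) (mfderiv (𝓡 2) (𝓡 3) (fun v => e.symm (graphMap T q v)) v w)) = 0 :=
    Iff.rfl
  have h3 := congrArg (rotForm (Θ ∘ e.symm) α (contr α (chartVec X e)) (e (e.symm (graphMap T q v))))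
    (dE_mfderiv_graph (T := T) h hq v w)
  have h4 : rotForm (Θ ∘ e.symm) α (contr α (chartVec X e)) (e (e.symm (graphMap T q v))) (graphD T q v w) =
      rotForm (Θ ∘ e.symm) α (contr α (chartVec X e)) (graphMap T q v) (graphD T q v w) := by
    rw [e.right_inv hy]
  have h5 := h1.trans ((iff_of_eq (congrArg (_ ∈ ·) (hrot e α h _ (e.map_target hy)))).trans h2)
  exact h5.trans (iff_of_eq (congrArg (· = 0) (h3.trans h4)))

/-- Positivity of the form on the radial vector excludes singular points of the characteristic
foliation along the curve. -/
theorem IsLeafIn.isLeafArc (h : IsUnitForm g ξ e α) (hq : ∀ v w, q v w = q w v) {Θ : M → ℝ}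
    {ξ' : ∀ p : M, Submodule ℝ (TangentSpace (𝓡 3) p)}
    (hrot : ∀ e α, IsUnitForm g ξ e α → ∀ q ∈ e.source, ξ' q = rotPlane X Θ e α q)
    {S : Set E2} (hS : S ⊆ Metric.closedBall 0 1) {μ : E2 → E2 →L[ℝ] ℝ}
    (hμ : ∀ v ∈ S, ∀ w, μ v w = Real.cos (Θ (e.symm (graphMap T q v))) * graphPull T q α v w +
        Real.sin (Θ (e.symm (graphMap T q v))) * graphPull T q (contr α (chartVec X e)) v w)
    (hpos : ∀ v ∈ S, 0 < μ v v) {c : ℝ → E2} (hc : IsLeafIn μ S c) :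
    IsLeafArc ξ' (fun v => e.symm (graphMap T q v)) c := by
  refine ⟨hc.1, fun t => ?_⟩
  obtain ⟨h1, h2, h3⟩ := hc.2 t
  refine ⟨hS h1, fun htop => ?_, h2, ?_⟩
  · have h4 : c t ∈ charFoliation ξ' (fun v => e.symm (graphMap T q v)) (c t) := by
      rw [htop]; trivial
    rw [mem_charFoliation_graph h hq hrot, ← hμ _ h1] at h4
    exact (hpos _ h1).ne' h4
  · exact (mem_charFoliation_graph h hq hrot _ _).2 ((hμ _ h1 _).symm.trans h3)

theorem exists_profile_eq {θ : ℝ} (h0 : 0 ≤ θ) (h1 : θ ≤ Real.pi) : ∃ t, 0 ≤ t ∧ t ≤ 1 ∧ profile t = θ := by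
  have h := intermediate_value_Icc' zero_le_one contDiff_profile.continuous.continuousOn (a := (0 : ℝ)) (b := 1)
  rw [profile_of_nonpos le_rfl, profile_of_one_le le_rfl] at h
  obtain ⟨t, ht, ht'⟩ := h ⟨h0, h1⟩
  exact ⟨t, ht.1, ht.2, ht'⟩

/-- A function increasing along rays is bounded below on a sphere. -/
theorem exists_lt_on_sphere {u : E2 → ℝ} (hu : ContDiff ℝ ∞ u) {r : ℝ} (hr : 0 < r)
    (hinc : ∀ v, v ≠ 0 → ‖v‖ ≤ r → 0 < fderiv ℝ u v v) : ∃ ε > 0, ∀ v, ‖v‖ = r → u 0 + ε < u v := by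
  have hlt : ∀ v : E2, ‖v‖ = r → u 0 < u v := by
    intro v hv
    have hd : ∀ t : ℝ, HasDerivAt (fun t : ℝ => u (t • v)) (fderiv ℝ u (t • v) v) t := fun t => by
      have h1 : HasDerivAt (fun t : ℝ => t • v) v t := by simpa using (hasDerivAt_id t).smul_const v
      exact ((hu.differentiable (by simp) _).hasFDerivAt).comp_hasDerivAt t h1
    have hm := strictMonoOn_of_deriv_pos (convex_Icc (0 : ℝ) 1)
      (fun t _ => (hd t).continuousAt.continuousWithinAt) fun t ht => by
        rw [interior_Icc] at ht
        have hv0 : v ≠ 0 := fun h => by rw [h, norm_zero] at hv; exact hr.ne hv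
        have h2 := hinc (t • v) (smul_ne_zero ht.1.ne' hv0) (by
          rw [norm_smul, Real.norm_of_nonneg ht.1.le, hv]
          exact mul_le_of_le_one_left hr.le ht.2.le)
        rw [map_smul, smul_eq_mul] at h2
        rw [(hd t).deriv]
        exact (mul_pos_iff_of_pos_left ht.1).1 h2
    simpa using hm (left_mem_Icc.2 zero_le_one) (right_mem_Icc.2 zero_le_one) zero_lt_one
  have hne : (Metric.sphere (0 : E2) r).Nonempty :=
    ⟨r • unitVec 0, by simp [norm_smul, abs_of_pos hr]⟩
  obtain ⟨v₀, hv₀, hmin⟩ := (isCompact_sphere (0 : E2) r).exists_isMinOn hne hu.continuous.continuousOn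
  have h0 := hlt v₀ (by simpa using hv₀)
  refine ⟨(u v₀ - u 0) / 2, by linarith, fun v hv => ?_⟩
  have := hmin (show v ∈ Metric.sphere (0 : E2) r by simpa using hv)
  change u v₀ ≤ u v at this
  linarith

/-- The disc is chosen before `c` and `η`. Only `Θ` depends on them, and the estimates hold at every
nonzero point of the disc for all relevant angles. So the annulus may shrink towards the centre
while the argument stays the same. -/
theorem exists_disc_with_limit_cycle (hΨ : ContMDiff (𝓡 3) 𝓘(ℝ, ℝ) ∞ Ψ)
    (hg : ∀ (p : M) (v : TangentSpace (𝓡 3) p), g.inner p (X p) v = -(mfderiv (𝓡 3) 𝓘(ℝ, ℝ) Ψ p v : ℝ))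
    (hX : ContMDiff (𝓡 3) (𝓡 3).tangent ∞ (fun p : M => (⟨p, X p⟩ : TangentBundle (𝓡 3) M)))
    (hXξ : ∀ p, X p ∈ ξ p) (hξ : IsContactStructure ξ)
    {p : M} (h0 : X p = 0) (hmin : ∀ q, Ψ p ≤ Ψ q)
    (hs : IsTransverseSink X p) {N : Set M} (hN : IsOpen N) (hpN : p ∈ N) :
    ∃ ε > 0, ∀ c η, Ψ p < c → 0 < η → c + η < Ψ p + ε →
      ∀ ξ' : ∀ p : M, Submodule ℝ (TangentSpace (𝓡 3) p),
        (∀ e α, IsUnitForm g ξ e α → ∀ q ∈ e.source, ξ' q = rotPlane X (rotAngle Ψ N c η) e α q) →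
        ∃ f : E2 → M, Manifold.IsSmoothEmbedding (𝓡 2) (𝓡 3) ∞ f ∧ HasLimitCycle ξ' f := by
  obtain ⟨e, α, h, hp, he0⟩ := exists_unitForm g hξ p
  obtain ⟨T, a, b, κ, ha, hb, hκ, hα0, hα1, hdα, hH, hβ⟩ :=
    exists_normal_frame hΨ hg hX hXξ h hp he0 h0 hmin hs
  set Y := chartVec X e with hY
  set β := contr α Y with hβe
  set ψ := Ψ ∘ e.symm with hψ
  have hYs : ContDiff ℝ ∞ Y := by
    have := contDiffOn_chartVec h.mem hX
    rwa [h.target, contDiffOn_univ] at this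
  have hψs : ContDiff ℝ ∞ ψ := by
    have := contDiffOn_chartFun h.mem hΨ
    rwa [h.target, contDiffOn_univ] at this
  have hβs : ContDiff ℝ ∞ β :=
    contDiffOn_univ.1 (contDiffOn_contr isOpen_univ h.contDiff.contDiffOn hYs.contDiffOn)
  have hdψs : ContDiff ℝ ∞ (fderiv ℝ ψ) :=
    contDiffOn_univ.1 (contDiffOn_fderiv_top isOpen_univ hψs.contDiffOn)
  have hsymm0 : e.symm 0 = p := by rw [← he0, e.left_inv hp]
  have hψ0 : ψ 0 = Ψ p := by rw [hψ, Function.comp, hsymm0]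
  have hdψ0 : fderiv ℝ ψ 0 = 0 :=
    IsLocalMin.fderiv_eq_zero (Eventually.of_forall fun y => by rw [hψ0]; exact hmin _)
  have hβ0 : β 0 = 0 := by
    have hY0 : Y 0 = 0 := by
      have := chartVec_eq_zero hp h0
      rwa [he0] at this
    rw [hβe, contr, hY0, map_zero]
  -- the slope of the inner boundary
  set l := min a b with hl
  have hl0 : 0 < l := lt_min ha hb
  -- This angle satisfies `sin θ * l = cos θ`, which gives `β` enough weight on the inner boundary
  -- to reverse the crossing direction.
  set θ := Real.arctan l⁻¹ with hθ
  have hθ0 : 0 < θ := Real.arctan_pos.2 (inv_pos.2 hl0)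
  have hθ1 : θ < Real.pi / 2 := Real.arctan_lt_pi_div_two _
  have hk : 0 < Real.cos θ := Real.cos_arctan_pos _
  have hsin : 0 < Real.sin θ := Real.sin_pos_of_pos_of_lt_pi hθ0 (by linarith [Real.pi_pos])
  have hskl : Real.sin θ * l = Real.cos θ := by
    have h1 : Real.tan θ = l⁻¹ := Real.tan_arctan _
    rw [Real.tan_eq_sin_div_cos, div_eq_iff hk.ne'] at h1
    rw [h1]; field_simp
  -- Large enough for `α` to dominate `β` on the radial vector for all angles from `0` to `θ`.
  set C := (κ * (a + b) + 1) / (Real.cos θ * l) with hC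
  have hC0 : 0 < C := by positivity
  have hCl : C * Real.cos θ * l = κ * (a + b) + 1 := by rw [hC]; field_simp
  -- the quadratic graph
  obtain ⟨ι, hι⟩ : ∃ ι : E2 →L[ℝ] E3, ∀ v, ι v = T (v, 0) :=
    ⟨(T : (E2 × ℝ) →L[ℝ] E3).comp (ContinuousLinearMap.inl ℝ E2 ℝ), fun v => rfl⟩
  -- The symmetric part of the derivative of `α` is replaced by `C` times the Hessian of the
  -- potential. The antisymmetric part, half of `dα`, cannot be altered and supplies the `κ / 2`
  -- term.
  obtain ⟨q, hqv⟩ : ∃ q : E2 →L[ℝ] E2 →L[ℝ] ℝ, ∀ v w, q v w = C * (a * v 0 * w 0 + b * v 1 * w 1) -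
      (fderiv ℝ α 0 (T (v, 0)) (T (w, 0)) + fderiv ℝ α 0 (T (w, 0)) (T (v, 0))) / 2 := by
    let H : E2 →L[ℝ] E2 →L[ℝ] ℝ := (fderiv ℝ (fderiv ℝ ψ) 0).bilinearComp ι ι
    let n : E2 →L[ℝ] E2 →L[ℝ] ℝ := (fderiv ℝ α 0).bilinearComp ι ι
    refine ⟨C • H - (2 : ℝ)⁻¹ • (n + n.flip), fun v w => ?_⟩
    have e1 : H v w = a * v 0 * w 0 + b * v 1 * w 1 := by
      rw [← hH, ← hι, ← hι]; rfl
    have e2 : n v w = fderiv ℝ α 0 (T (v, 0)) (T (w, 0)) := by rw [← hι, ← hι]; rfl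
    have e3 : n w v = fderiv ℝ α 0 (T (w, 0)) (T (v, 0)) := by rw [← hι, ← hι]; rfl
    simp only [sub_apply, smul_apply, add_apply, ContinuousLinearMap.flip_apply, smul_eq_mul, e1, e2, e3]
    ring
  have hq : ∀ v w, q v w = q w v := fun v w => by rw [hqv, hqv]; ring
  set A := graphPull T q α with hA
  set B := graphPull T q β with hB
  set U := graphPull T q (fderiv ℝ ψ) with hU
  set u := ψ ∘ graphMap T q with hu
  have hAs : ContDiff ℝ ∞ A := contDiff_graphPull h.contDiff
  have hBs : ContDiff ℝ ∞ B := contDiff_graphPull hβs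
  have hUs : ContDiff ℝ ∞ U := contDiff_graphPull hdψs
  have hus : ContDiff ℝ ∞ u := hψs.comp contDiff_graphMap
  have hfu : ∀ v, fderiv ℝ u v = U v := fun v =>
    ((hψs.differentiable (by simp) _).hasFDerivAt.comp v (hasFDerivAt_graphMap hq v)).fderiv
  have hu0 : u 0 = Ψ p := by rw [hu, Function.comp, graphMap_zero, hψ0]
  have hest := exists_planar_estimates (A := A) (B := B) (U := U) (a := a) (b := b) (C := C)
    (hAs.differentiable (by simp) 0).hasFDerivAt
    (hBs.differentiable (by simp) 0).hasFDerivAt (hUs.differentiable (by simp) 0).hasFDerivAt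
    (graphPull_zero hα0) (graphPull_zero fun v => by rw [hβ0]; rfl)
    (graphPull_zero fun v => by rw [hdψ0]; rfl) hκ hl0 (min_le_left _ _) (min_le_right _ _) hk hsin
    (by rw [add_comm]; exact Real.sin_sq_add_cos_sq θ) hskl hC0 hCl
    (fun v w => by
      have h1 := hdα v w
      rw [dForm] at h1
      rw [hA, fderiv_graphPull h.contDiff hq, hα1, hqv]
      linarith)
    (fun v w => by rw [hB, fderiv_graphPull hβs hq, hβ, hβ0]; simp)
    (fun v w => by rw [hU, fderiv_graphPull hdψs hq, hH, hdψ0]; simp)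
  have hfN : ∀ᶠ v in 𝓝 (0 : E2), e.symm (graphMap T q v) ∈ N := by
    have hc : Continuous fun v => e.symm (graphMap T q v) :=
      (isSmoothEmbedding_graph h.mem h.target T (contDiff_quadratic (q := q))).isEmbedding.continuous
    exact hc.continuousAt.eventually (hN.mem_nhds (by
      change e.symm (graphMap T q 0) ∈ N
      rwa [graphMap_zero, hsymm0]))
  obtain ⟨r, hr, hball⟩ := Metric.eventually_nhds_iff_ball.1 (hest.and hfN)
  -- The annulus must lie in the region of the estimates and also in the closed unit disc required
  -- of a leaf.
  set rb := min (r / 2) 1 with hrb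
  have hrb0 : 0 < rb := lt_min (by linarith) one_pos
  have hrb1 : rb ≤ 1 := min_le_right _ _
  have hin : ∀ v : E2, ‖v‖ ≤ rb → v ∈ Metric.ball (0 : E2) r := fun v hv => by
    rw [mem_ball_zero_iff]
    have := min_le_left (r / 2) 1
    linarith
  obtain ⟨ε, hε, hsph⟩ := exists_lt_on_sphere hus hrb0 fun v hv hvr => by
    rw [hfu]
    exact ((hball v (hin v hvr)).1 hv).1
  rw [hu0] at hsph
  refine ⟨ε, hε, fun c η hc hη hcη ξ' hrot => ⟨fun v => e.symm (graphMap T q v),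
    isSmoothEmbedding_graph h.mem h.target T (contDiff_quadratic (q := q)), ?_⟩⟩
  -- The inner boundary is the level of `u` where the rotation angle equals `θ`. The outer one lies
  -- beyond `c + η`, where rotation has stopped, and below the values of `u` on the outer circle.
  obtain ⟨t, ht0, ht1, hpt⟩ := exists_profile_eq hθ0.le (by linarith [Real.pi_pos])
  set u₁ := c + η * t with hu₁
  set u₂ := (c + η + (Ψ p + ε)) / 2 with hu₂
  have hηt : 0 ≤ η * t := mul_nonneg hη.le ht0
  have hηt' : η * t ≤ η := mul_le_of_le_one_right hη.le ht1
  obtain ⟨ra, hra, hrab, hua⟩ : ∃ ra > 0, ra < rb ∧ ∀ v : E2, ‖v‖ = ra → u v < u₁ := by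
    have h1 : ∀ᶠ v in 𝓝 (0 : E2), u v < u₁ :=
      hus.continuous.continuousAt.eventually (gt_mem_nhds (by rw [hu0]; linarith))
    obtain ⟨r', hr', hb'⟩ := Metric.eventually_nhds_iff_ball.1 h1
    refine ⟨min (r' / 2) (rb / 2), lt_min (by linarith) (by linarith),
      (min_le_right _ _).trans_lt (by linarith), fun v hv => hb' v ?_⟩
    rw [mem_ball_zero_iff, hv]
    exact (min_le_left _ _).trans_lt (by linarith)
  set φ : E2 → ℝ := fun v => profile ((u v - c) / η) with hφ
  have hφs : ContDiff ℝ ∞ φ := contDiff_profile.comp ((hus.sub contDiff_const).div_const η)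
  set μ : E2 → E2 →L[ℝ] ℝ := fun v => Real.cos (φ v) • A v + Real.sin (φ v) • B v with hμ
  have hμs : ContDiff ℝ ∞ μ :=
    ((Real.contDiff_cos.comp hφs).smul hAs).add ((Real.contDiff_sin.comp hφs).smul hBs)
  have hne : ∀ v : E2, ra ≤ ‖v‖ → v ≠ 0 := fun v hv h => by
    rw [h, norm_zero] at hv; linarith
  have hest' : ∀ v : E2, ra ≤ ‖v‖ → ‖v‖ ≤ rb → _ := fun v hv hv' => (hball v (hin v hv')).1 (hne v hv)
  have hφ₁ : ∀ v, u v = u₁ → φ v = θ := fun v hv => by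
    rw [hφ, ← hpt]
    simp only [hv, hu₁]
    congr 1
    field_simp
    ring
  have hφ₂ : ∀ v, u v = u₂ → φ v = 0 := fun v hv => by
    refine profile_of_one_le ((one_le_div hη).2 ?_)
    rw [hv, hu₂]; linarith
  have hpos : ∀ v, ra ≤ ‖v‖ → ‖v‖ ≤ rb → u₁ ≤ u v → u v ≤ u₂ → 0 < μ v v := by
    intro v hv hv' h1 h2
    have hle : φ v ≤ θ := by
      rw [← hpt]
      refine antitone_profile ((le_div_iff₀ hη).2 ?_)
      rw [hu₁] at h1; linarith
    have hge : 0 ≤ φ v := by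
      have := antitone_profile (le_max_left ((u v - c) / η) 1)
      rwa [profile_of_one_le (le_max_right _ _)] at this
    exact (hest' v hv hv').2.1 _ _ (Real.cos_le_cos_of_nonneg_of_le_pi hge (by linarith [Real.pi_pos]) hle)
      (Real.cos_le_one _) (Real.sin_nonneg_of_nonneg_of_le_pi hge (by linarith [Real.pi_pos]))
      (Real.sin_le_one _)
  obtain ⟨c₁, c₂, hc₁, hper, hc₂, hdisj, hlim⟩ := exists_limit_cycle (μ := μ) (u := u) (u₁ := u₁) (u₂ := u₂)
    isOpen_univ (subset_univ _) hra hrab (by rw [hu₁, hu₂]; linarith)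
    (hμs.contDiffOn.of_le (by norm_cast)) (hus.contDiffOn.of_le (by norm_cast)) hua
    (fun v hv => lt_trans (by rw [hu₂]; linarith) (hsph v hv)) hpos
    (fun v hv hv' h1 => by
      rw [hfu]
      simp only [hμ, hφ₁ v h1]
      exact (hest' v hv hv').2.2.2)
    (fun v hv hv' h1 => by
      rw [hfu]
      simp only [hμ, hφ₂ v h1, Real.cos_zero, Real.sin_zero, one_smul, zero_smul, add_zero]
      exact (hest' v hv hv').2.2.1)
  have hS : {v : E2 | ra ≤ ‖v‖ ∧ ‖v‖ ≤ rb ∧ u₁ ≤ u v ∧ u v ≤ u₂} ⊆ Metric.closedBall 0 1 := fun v hv =>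
    mem_closedBall_zero_iff.2 (hv.2.1.trans hrb1)
  have hμ' : ∀ v ∈ {v : E2 | ra ≤ ‖v‖ ∧ ‖v‖ ≤ rb ∧ u₁ ≤ u v ∧ u v ≤ u₂}, ∀ w, μ v w =
      Real.cos (rotAngle Ψ N c η (e.symm (graphMap T q v))) * graphPull T q α v w +
        Real.sin (rotAngle Ψ N c η (e.symm (graphMap T q v))) * graphPull T q (contr α (chartVec X e)) v w := by
    intro v hv w
    have h1 : rotAngle Ψ N c η (e.symm (graphMap T q v)) = φ v := if_pos (hball v (hin v hv.2.1)).2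
    rw [h1]
    rfl
  exact ⟨c₁, c₂, hc₁.isLeafArc h hq hrot hS hμ' fun v hv => hpos v hv.1 hv.2.1 hv.2.2.1 hv.2.2.2, hper,
    hc₂.isLeafArc h hq hrot hS hμ' fun v hv => hpos v hv.1 hv.2.1 hv.2.2.1 hv.2.2.2, hdisj, hlim⟩

end

/-! ### Choice of the shell and the overtwisted structure. -/

section
variable {M : Type*} [TopologicalSpace M] [ChartedSpace E3 M] [IsManifold (𝓡 3) ∞ M]
  {g : Bundle.ContMDiffRiemannianMetric (𝓡 3) ∞ E3 (TangentSpace (𝓡 3) : M → Type)}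
  {ξ : ∀ p : M, Submodule ℝ (TangentSpace (𝓡 3) p)} {X : ∀ p : M, TangentSpace (𝓡 3) p} {Ψ : M → ℝ}

/-- Near a circle of global minima `X` lies in an overtwisted contact structure agreeing with `ξ`
outside a given neighbourhood. -/
theorem exists_overtwisted [CompactSpace M] [T2Space M] (hΨ : ContMDiff (𝓡 3) 𝓘(ℝ, ℝ) ∞ Ψ)
    (hg : ∀ (p : M) (v : TangentSpace (𝓡 3) p), g.inner p (X p) v = -(mfderiv (𝓡 3) 𝓘(ℝ, ℝ) Ψ p v : ℝ))
    (hX : ContMDiff (𝓡 3) (𝓡 3).tangent ∞ (fun p : M => (⟨p, X p⟩ : TangentBundle (𝓡 3) M)))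
    (hXξ : ∀ p, X p ∈ ξ p) (hξ : IsContactStructure ξ) {K : Set M} (hK : IsCompact K) {p : M} (hpK : p ∈ K)
    {m : ℝ} (hKm : ∀ q ∈ K, Ψ q = m) (hmin : ∀ q, m ≤ Ψ q) (hp0 : X p = 0) (hs : IsTransverseSink X p)
    {O : Set M} (hO : IsOpen O) (hKO : K ⊆ O) (hOz : ∀ q ∈ O, X q = 0 → q ∈ K) :
    ∃ ξ' : ∀ p : M, Submodule ℝ (TangentSpace (𝓡 3) p),
      IsOvertwisted ξ' ∧ (∀ p : M, X p ∈ ξ' p) ∧ ∀ p : M, p ∉ O → ξ' p = ξ p := by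
  obtain ⟨N, hN, hKN, hNO⟩ := normal_exists_closure_subset hK.isClosed hO hKO
  obtain ⟨ε, hε, hdisc⟩ := exists_disc_with_limit_cycle hΨ hg hX hXξ hξ hp0
    (fun q => (hKm p hpK).trans_le (hmin q)) hs hN (hKN hpK)
  rw [hKm p hpK] at hdisc
  -- A frontier point at the minimal level would be a zero of `X` in `O`, hence in `K ⊆ N`. So `Ψ`
  -- exceeds `m` by a definite amount on the compact frontier.
  obtain ⟨d₀, hd₀, hfr⟩ : ∃ d₀ > m, ∀ q ∈ closure N, q ∉ N → d₀ ≤ Ψ q := by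
    have hc : IsCompact (closure N \ N) := (isClosed_closure.inter hN.isClosed_compl).isCompact
    rcases (closure N \ N).eq_empty_or_nonempty with h | h
    · refine ⟨m + 1, by linarith, fun q h1 h2 => ?_⟩
      have : q ∈ closure N \ N := ⟨h1, h2⟩
      rw [h] at this
      exact this.elim
    · obtain ⟨q₀, hq₀, hq₀min⟩ := hc.exists_isMinOn h hΨ.continuous.continuousOn
      refine ⟨Ψ q₀, lt_of_le_of_ne (hmin q₀) fun heq => ?_, fun q h1 h2 => hq₀min ⟨h1, h2⟩⟩
      exact hq₀.2 (hKN (hOz q₀ (hNO hq₀.1) (gradient_eq_zero_of_min hΨ hg fun q => heq ▸ hmin q)))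
  -- Levels below `d` avoid the frontier and stay below the range of `Ψ` on the boundary of the
  -- disc. Starting the rotation at `c > m` keeps it away from the zeros in `K`.
  obtain ⟨d, hmd, hdd, hdε⟩ : ∃ d, m < d ∧ d ≤ d₀ ∧ d ≤ m + ε :=
    ⟨min d₀ (m + ε), lt_min hd₀ (by linarith), min_le_left _ _, min_le_right _ _⟩
  set c := (m + d) / 2
  have hmc : m < c := by simp only [c]; linarith
  obtain ⟨η, hη, hcη, hcontact⟩ := exists_contact_rotated hξ hΨ hg hX hXξ hN
    (c := c) (d := d) (by simp only [c]; linarith) (fun q h1 h2 => hdd.trans (hfr q h1 h2))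
    fun q h1 h2 h3 => by
      have := hKm q (hOz q (hNO h1) h3)
      linarith
  obtain ⟨ξ', hrot, hsame, hXξ'⟩ := exists_rotated (g := g) hξ X hXξ (rotAngle Ψ N c η)
  refine ⟨ξ', ⟨hcontact ξ' hrot hsame, hdisc c η hmc hη (by linarith) ξ' hrot⟩, hXξ', fun q hq => hsame q ?_⟩
  rw [rotAngle, if_neg fun h => hq (hNO (subset_closure h)), Real.sin_zero]

end

end PlaneFieldFlow

end

theorem mainTheorem8 {M : Type*} [TopologicalSpace M] [ChartedSpace E3 M]
    [IsManifold (𝓡 3) ∞ M] [CompactSpace M] [T2Space M] [Nonempty M]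
    (ξ : ∀ p : M, Submodule ℝ (TangentSpace (𝓡 3) p))
    (X : ∀ p : M, TangentSpace (𝓡 3) p)
    (hξ : IsTight ξ) (hX : IsGradientField X) (hXξ : IsNondegenerateSection ξ X) :
    ∃ γ : Circle → M, Manifold.IsSmoothEmbedding (𝓡 1) (𝓡 3) ∞ γ ∧
      (∀ p ∈ Set.range γ, p ∈ fixedPoints X ∧ IsTransverseSink X p) ∧
      ∀ U : Set M, IsOpen U → Set.range γ ⊆ U →
        ∃ ξ' : ∀ p : M, Submodule ℝ (TangentSpace (𝓡 3) p),
          IsOvertwisted ξ' ∧ (∀ p : M, X p ∈ ξ' p) ∧ ∀ p : M, p ∉ U → ξ' p = ξ p := by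
  obtain ⟨g, Ψ, hΨ, hg⟩ := hX
  obtain ⟨γ, m, N, hγ, hsink, hmin, hN, hγN, hNz⟩ := exists_sink_circle hΨ hg hXξ
  refine ⟨γ, hγ, fun p hp => ⟨(hsink p hp).1, (hsink p hp).2.1⟩, fun U hU hγU => ?_⟩
  have h1 : γ 1 ∈ Set.range γ := Set.mem_range_self 1
  -- Passing to `U ∩ N` removes every zero of `X` outside the chosen circle.
  obtain ⟨ξ', hot, hXξ', hsame⟩ := exists_overtwisted hΨ hg hXξ.1 hXξ.2.1 hξ.1
    (isCompact_range hγ.isEmbedding.continuous) h1 (fun q hq => (hsink q hq).2.2) hmin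
    (hsink _ h1).1 (hsink _ h1).2.1 (hU.inter hN) (Set.subset_inter hγU hγN) fun q hq => hNz q hq.2
  exact ⟨ξ', hot, hXξ', fun p hp => hsame p fun h => hp h.1⟩
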